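/- **Setting.** Let $\mathbb{T}^3=(\mathbb{R}/2\pi\mathbb{Z})^3$, $\mu(v)=e^{-|v|^2}$, $w(v)=1+|v|$ and $\phi^{ij}(v)=\big(\delta_{ij}-\tfrac{v_iv_j}{|v|^2}\big)|v|^{-1}$ on $\mathbb{R}^3$, and let $\sigma^{ij}=\phi^{ij}*\mu$. All derivatives are in the velocity $v$, convolutions are in $v$, and repeated indices are summed. The Landau collision term is $$\Gamma[g,f]=\partial_i\big[\{\phi^{ij}*[\mu^{1/2}g]\}\partial_jf\big]-\{\phi^{ij}*[v_i\mu^{1/2}g]\}\partial_jf-\partial_i\big[\{\phi^{ij}*[\mu^{1/2}\partial_jg]\}f\big]+\{\phi^{ij}*[v_i\mu^{1/2}\partial_jg]\}f .$$ For functions of $v$ put $|f|_{\sigma,\vartheta}^2=\int_{\mathbb{R}^3}w^{2\vartheta}[\sigma^{ij}\partial_if\,\partial_jf+\sigma^{ij}v_iv_jf^2]\,dv$, let $|f|_\infty$ be the $L^\infty(\mathbb{R}^3)$ norm, and $\langle f,g\rangle=\int_{\mathbb{R}^3}fg\,dv$. For functions of $(x,v)$ put $\|f\|_{2,\vartheta}^2=\iint_{\mathbb{T}^3\times\mathbb{R}^3}w^{2\vartheta}f^2\,dv\,dx$,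 $\|f\|_{\sigma,\vartheta}^2=\iint_{\mathbb{T}^3\times\mathbb{R}^3}w^{2\vartheta}[\sigma^{ij}\partial_if\,\partial_jf+\sigma^{ij}v_iv_jf^2]\,dv\,dx$, let $\|f\|_\infty$ be the $L^\infty(\mathbb{T}^3\times\mathbb{R}^3)$ norm, and $(f,g)=\iint_{\mathbb{T}^3\times\mathbb{R}^3}fg\,dv\,dx$. The functions $g_1,g_2,g_3$ are real-valued and measurable and have a weak velocity gradient on $\mathbb{R}^3$ (for almost every $x$, when they depend on $x$); $\mu^{1/2}\nabla_vg_1$ is integrable over $\mathbb{R}^3$ (for almost every $x$), so that the convolutions in $\Gamma[g_1,g_2]$ converge; and the norms on the right-hand sides below are finite. The pairing of $w^{2\vartheta}\Gamma[g_1,g_2]$ with $g_3$ is understood in the distributional sense: the outer derivatives $\partial_i[\cdot]$ in $\Gamma$ act on $w^{2\vartheta}g_3$ with a minus sign. The assertion includes that the resulting integrand is absolutely integrable. If $g_1$ is $C^1$ and $g_2$ is $C^2$ in $v$ (for almost every $x$), so that $\Gamma[g_1,g_2]$ can be taken with classical derivatives, and $w^{2\vartheta}\Gamma[g_1,g_2]g_3$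 is integrable, then the same bounds, with the same constants, hold also for the ordinary integral of $w^{2\vartheta}\Gamma[g_1,g_2]g_3$. **Theorem.** 1. For every $\vartheta\in\mathbb{R}$ there is a constant $C_\vartheta$ such that for all such functions of $v$ $$\big|\langle w^{2\vartheta}\Gamma[g_1,g_2],g_3\rangle\big|\le C_\vartheta\,|g_1|_\infty\,|g_2|_{\sigma,\vartheta}\,|g_3|_{\sigma,\vartheta},$$ and for all such functions of $(x,v)$ $$\big|(w^{2\vartheta}\Gamma[g_1,g_2],g_3)\big|\le C_\vartheta\,\|g_1\|_\infty\,\|g_2\|_{\sigma,\vartheta}\,\|g_3\|_{\sigma,\vartheta}.$$ 2. There is $\bar\vartheta<0$ such that for every $\vartheta\le\bar\vartheta$ there is a constant $C_\vartheta$ such that for all such functions of $(x,v)$ $$\big|(w^{2\vartheta}\Gamma[g_1,g_2],g_3)\big|\le C_\vartheta\,\min\{\|g_1\|_{2,\vartheta},\|g_1\|_{\sigma,\vartheta}\}\,\big(\|g_2\|_\infty+\|D_vg_2\|_\infty\big)\,\|g_3\|_{\sigma,\vartheta}$$ (here only the minimum is required to be finite, not both norms of $g_1$). -/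

import Mathlib

open MeasureTheory
open scoped ENNReal NNReal ContDiff Gradient

noncomputable section

namespace Landau

instance factTwoPiPos : Fact (0 < 2 * Real.pi) := ⟨Real.two_pi_pos⟩

/-- The velocity space `ℝ³` with its Euclidean norm and Lebesgue measure. -/
abbrev V : Type := EuclideanSpace ℝ (Fin 3)

/-- The torus `𝕋³ = (ℝ / 2πℤ)³`, with the Lebesgue measure of total mass `(2π)³`. -/
abbrev T3 : Type := Fin 3 → AddCircle (2 * Real.pi)

/-- The partial derivative `∂ᵢ f` in the velocity variable. -/
def pd (i : Fin 3) (f : V → ℝ) (v : V) : ℝ := fderiv ℝ f v (EuclideanSpace.single i 1)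

/-- The Landau kernel `φ^{ij}(v) = (δ_{ij} - v_i v_j / |v|²) |v|⁻¹`. -/
def phi (i j : Fin 3) (v : V) : ℝ :=
  ((if i = j then 1 else 0) - v i * v j / ‖v‖ ^ 2) * ‖v‖⁻¹

/-- The Maxwellian `μ(v) = exp (-|v|²)`. -/
def mu (v : V) : ℝ := Real.exp (-‖v‖ ^ 2)

/-- `μ^{1/2}`. -/
def sqrtMu (v : V) : ℝ := Real.sqrt (mu v)

/-- The convolution `σ_u^{ij} = φ^{ij} * u`. -/
def sigmaConv (i j : Fin 3) (u : V → ℝ) (v : V) : ℝ := ∫ v' : V, phi i j (v - v') * u v'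

/-- The weight `w(v)^s = (1 + |v|)^s`. -/
def weight (s : ℝ) (v : V) : ℝ := (1 + ‖v‖) ^ s

/-- The velocity field (with components `i`) of the terms under the divergence in `Γ[g, f]`,
`{φ^{ij} * [μ^{1/2} g]} ∂_j f - {φ^{ij} * [μ^{1/2} ∂_j g]} f`,
where `G` and `F` stand for the gradients of `g` and `f`. -/
def gammaFlux (g : V → ℝ) (G : V → V) (f : V → ℝ) (F : V → V) (i : Fin 3) (v : V) : ℝ :=
  ∑ j, (sigmaConv i j (fun v' => sqrtMu v' * g v') v * F v j
    - sigmaConv i j (fun v' => sqrtMu v' * G v' j) v * f v)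

/-- The terms of `Γ[g, f]` that are not under the divergence,
`-{φ^{ij} * [v_i μ^{1/2} g]} ∂_j f + {φ^{ij} * [v_i μ^{1/2} ∂_j g]} f`,
where `G` and `F` stand for the gradients of `g` and `f`. -/
def gammaSource (g : V → ℝ) (G : V → V) (f : V → ℝ) (F : V → V) (v : V) : ℝ :=
  ∑ i, ∑ j, (-(sigmaConv i j (fun v' => v' i * sqrtMu v' * g v') v * F v j)
    + sigmaConv i j (fun v' => v' i * sqrtMu v' * G v' j) v * f v)

/-- The Landau collision term `Γ[g, f]`, with classical derivatives. -/
def Gamma (g f : V → ℝ) (v : V) : ℝ :=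
  ∑ i, pd i (gammaFlux g (∇ g) f (∇ f) i) v + gammaSource g (∇ g) f (∇ f) v

/-- The integrand of the distributional action of `Γ[g, f]` on a weakly differentiable function `ψ`
with weak gradient `Ψ`: the outer derivative `∂_i` of `Γ` falls on `ψ`. -/
def gammaAction (g : V → ℝ) (G : V → V) (f : V → ℝ) (F : V → V) (ψ : V → ℝ) (Ψ : V → V)
    (v : V) : ℝ :=
  -(∑ i, gammaFlux g G f F i v * Ψ v i) + gammaSource g G f F v * ψ v

/-- The integrand of the pairing of `w^{2ϑ} Γ[g₁, g₂]` with `g₃` in the distributional sense, that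
is, `gammaAction` on `ψ = w^{2ϑ} g₃` (whose weak gradient is given by the product rule). -/
def weakIntegrand (ϑ : ℝ) (g₁ : V → ℝ) (G₁ : V → V) (g₂ : V → ℝ) (G₂ : V → V)
    (g₃ : V → ℝ) (G₃ : V → V) : V → ℝ :=
  gammaAction g₁ G₁ g₂ G₂ (fun v => weight (2 * ϑ) v * g₃ v)
    (fun v => weight (2 * ϑ) v • G₃ v + g₃ v • ∇ (weight (2 * ϑ)) v)

/-- The integrand of the pairing of `w^{2ϑ} Γ[g₁, g₂]` with `g₃`, with classical derivatives. -/
def classicalIntegrand (ϑ : ℝ) (g₁ g₂ g₃ : V → ℝ) (v : V) : ℝ :=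
  weight (2 * ϑ) v * Gamma g₁ g₂ v * g₃ v

/-- `G` is the weak gradient of `g` on `ℝ³`. -/
def HasWeakGradient (g : V → ℝ) (G : V → V) : Prop :=
  LocallyIntegrable g ∧ LocallyIntegrable G ∧
    ∀ η : V → ℝ, ContDiff ℝ ∞ η → HasCompactSupport η →
      ∀ i : Fin 3, ∫ v, g v * pd i η v = -∫ v, G v i * η v

/-- `G` is the weak velocity gradient `D_v g` of `g = g(x, v)`. -/
def HasWeakVelocityGradient (g : T3 × V → ℝ) (G : T3 × V → V) : Prop :=
  AEStronglyMeasurable g ∧ AEStronglyMeasurable G ∧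
    ∀ᵐ x : T3, HasWeakGradient (fun v => g (x, v)) (fun v => G (x, v))

/-- The density `σ^{ij} G_i G_j + σ^{ij} v_i v_j g²` at a point `v`, where `σ = φ * μ`,
for a value `a` of `g` and a value `b` of its gradient. -/
def sigmaDensity (v : V) (a : ℝ) (b : V) : ℝ :=
  ∑ i, ∑ j, (sigmaConv i j mu v * b i * b j + sigmaConv i j mu v * v i * v j * a ^ 2)

/-- The norm `|g|_{σ,ϑ}` of a function of `v` with gradient `G`, as an element of `[0, ∞]`. -/
def sigmaNorm (ϑ : ℝ) (g : V → ℝ) (G : V → V) : ℝ≥0∞ :=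
  (∫⁻ v, ENNReal.ofReal (weight (2 * ϑ) v * sigmaDensity v (g v) (G v))) ^ (1 / 2 : ℝ)

/-- The norm `‖g‖_{σ,ϑ}` of a function of `(x, v)` with velocity gradient `G`. -/
def sigmaNormXV (ϑ : ℝ) (g : T3 × V → ℝ) (G : T3 × V → V) : ℝ≥0∞ :=
  (∫⁻ z : T3 × V, ENNReal.ofReal (weight (2 * ϑ) z.2 * sigmaDensity z.2 (g z) (G z)))
    ^ (1 / 2 : ℝ)

/-- The norm `‖g‖_{2,ϑ}` of a function of `(x, v)`. -/
def l2NormXV (ϑ : ℝ) (g : T3 × V → ℝ) : ℝ≥0∞ :=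
  eLpNorm (fun z : T3 × V => weight ϑ z.2 * g z) 2 volume

/-- `weakIntegrand` for functions of `(x, v)`. -/
def weakIntegrandXV (ϑ : ℝ) (g₁ : T3 × V → ℝ) (G₁ : T3 × V → V) (g₂ : T3 × V → ℝ)
    (G₂ : T3 × V → V) (g₃ : T3 × V → ℝ) (G₃ : T3 × V → V) (z : T3 × V) : ℝ :=
  weakIntegrand ϑ (fun v => g₁ (z.1, v)) (fun v => G₁ (z.1, v)) (fun v => g₂ (z.1, v))
    (fun v => G₂ (z.1, v)) (fun v => g₃ (z.1, v)) (fun v => G₃ (z.1, v)) z.2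

/-- `classicalIntegrand` for functions of `(x, v)`. -/
def classicalIntegrandXV (ϑ : ℝ) (g₁ g₂ g₃ : T3 × V → ℝ) (z : T3 × V) : ℝ :=
  classicalIntegrand ϑ (fun v => g₁ (z.1, v)) (fun v => g₂ (z.1, v)) (fun v => g₃ (z.1, v)) z.2

/-- The convolutions of `φ^{ij}` with `μ^{1/2} ∂_j g` and `v_i μ^{1/2} ∂_j g` in `Γ[g, f]` converge
absolutely (almost everywhere) when `μ^{1/2} ∇g` is integrable. -/
def GammaDefined (G : V → V) : Prop := Integrable (fun v => sqrtMu v • G v)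

/-- The pairing `⟨w^{2ϑ} Γ[g₁, g₂], g₃⟩` is well defined and bounded by `B`: in the distributional
sense and, if the derivatives in `Γ[g₁, g₂]` are classical, also as the ordinary integral. -/
def PairingBound (ϑ : ℝ) (g₁ : V → ℝ) (G₁ : V → V) (g₂ : V → ℝ) (G₂ : V → V)
    (g₃ : V → ℝ) (G₃ : V → V) (B : ℝ≥0∞) : Prop :=
  Integrable (weakIntegrand ϑ g₁ G₁ g₂ G₂ g₃ G₃) ∧
  ‖∫ v, weakIntegrand ϑ g₁ G₁ g₂ G₂ g₃ G₃ v‖ₑ ≤ B ∧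
  (ContDiff ℝ 1 g₁ → ContDiff ℝ 2 g₂ → Integrable (classicalIntegrand ϑ g₁ g₂ g₃) →
    ‖∫ v, classicalIntegrand ϑ g₁ g₂ g₃ v‖ₑ ≤ B)

/-- The pairing `(w^{2ϑ} Γ[g₁, g₂], g₃)` over `𝕋³ × ℝ³` is well defined and bounded by `B`: in the
distributional sense and, if the derivatives in `Γ[g₁, g₂]` are classical, also as the ordinary
integral. -/
def PairingBoundXV (ϑ : ℝ) (g₁ : T3 × V → ℝ) (G₁ : T3 × V → V) (g₂ : T3 × V → ℝ)
    (G₂ : T3 × V → V) (g₃ : T3 × V → ℝ) (G₃ : T3 × V → V) (B : ℝ≥0∞) : Prop :=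
  Integrable (weakIntegrandXV ϑ g₁ G₁ g₂ G₂ g₃ G₃) ∧
  ‖∫ z, weakIntegrandXV ϑ g₁ G₁ g₂ G₂ g₃ G₃ z‖ₑ ≤ B ∧
  ((∀ᵐ x : T3, ContDiff ℝ 1 (fun v => g₁ (x, v))) →
    (∀ᵐ x : T3, ContDiff ℝ 2 (fun v => g₂ (x, v))) →
    Integrable (classicalIntegrandXV ϑ g₁ g₂ g₃) →
    ‖∫ z, classicalIntegrandXV ϑ g₁ g₂ g₃ z‖ₑ ≤ B)

end Landau

end

open MeasureTheory
open scoped ENNReal NNReal ContDiff Gradient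

noncomputable section

namespace Landau

/-! The derivatives of `g₁` occur only inside convolutions, so they are moved onto the kernel and
the Gaussian: `φ^{ij} * (P ∂_j g)` becomes `∫ g(v') (∂_jφ^{ij}(v-v') P(v') - φ^{ij}(v-v') ∂_jP(v'))
dv'`. The flux and the source of `Γ` are then integrals of `g₁` alone against explicit kernels, with
singularity at worst `|v-v'|⁻²`, which is integrable in dimension three, and with Gaussian decay in
`v'`.

The anisotropy of the σ-norm is captured by `modelForm v ξ = (1+|v|)⁻³(|ξ|²+|v×ξ|²)`. Since
`φ(z)(ξ,ξ) = |z×ξ|²|z|⁻³`, writing `z = v-v'` bounds it by `modelForm v ξ` times powers of `1+|v'|`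
and `1+|z|⁻¹`; Cauchy–Schwarz for the nonnegative form `φ(z)` handles mixed terms. The kernel `∂φ`
has size `|z|⁻²`, hence decays like `(1+|v|)⁻²` up to factors in `v'` and `z`, and `|ξ|(1+|v|)⁻²` is
at most `√(modelForm v ξ)` times `(1+|v|)^{-1/2}`. Thus `exists_gamma_bound` estimates `Γ` pointwise
by the product of the two model densities' square roots and `majorantInt g₁`, a single convolution
of `|g₁|`.

That convolution is bounded by the sup norm of `g₁` (`exists_majorantInt_le`), and its `L²` norm
with weight `(1+|v|)⁻⁴` is bounded by the `L²` norm of `g₁` with any power weight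
(`exists_lintegral_majorantInt_sq_le`). Cauchy–Schwarz for the remaining factors gives the two
estimates; in the second, `w^{2ϑ}` with `ϑ ≤ -2` supplies the decay and the density of `g₂` is
bounded by sup norms.

It remains to dominate the model norm by the σ-norm (`exists_modelNormSq_le`). Averaging
`|(v-v')×b|²` over an even, rotation-invariant weight shows `σ(v) ≥ c · modelForm v`. Putting `b =
v` controls the zero-order term, except near the origin, where `σ^{ij}v_iv_j` vanishes. There a
Hardy-type argument, the divergence theorem for `v χ f²`, recovers the `L²` norm from the gradient
and from an annulus.

For classical derivatives, convolutions of `φ` with continuous integrable functions are `C¹`, so the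
outer divergence may be integrated by parts against compactly supported `C¹` approximations of
`w^{2ϑ}`. Dominated convergence identifies the classical and the distributional pairing. -/

/-! ### The quadratic form of the kernel and its pointwise bounds. -/

/-- The squared norm `|v × ξ|²` of the cross product. -/
def crossSq (v ξ : V) : ℝ := ‖v‖ ^ 2 * ‖ξ‖ ^ 2 - inner ℝ v ξ ^ 2

/-- The bilinear form of the matrix `φ(z)`. -/
def phiForm (z a b : V) : ℝ := ∑ i, ∑ j, phi i j z * a i * b j

/-- The quadratic form `(1 + |v|)⁻³ (|ξ|² + |v × ξ|²)`, which is comparable with that of `σ(v)`. -/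
def modelForm (v ξ : V) : ℝ := ((1 + ‖v‖) ^ 3)⁻¹ * (‖ξ‖ ^ 2 + crossSq v ξ)

/-- The density `modelForm v b + (1 + |v|)⁻¹ a²`. -/
def modelDensity (v : V) (a : ℝ) (b : V) : ℝ := modelForm v b + (1 + ‖v‖)⁻¹ * a ^ 2

lemma crossSq_nonneg (v ξ : V) : 0 ≤ crossSq v ξ := by
  have := real_inner_mul_inner_self_le v ξ
  simp only [real_inner_self_eq_norm_sq] at this
  unfold crossSq
  nlinarith

/-- The parallelogram law for `a × ξ` and `b × ξ`. Dropping the sum term gives the upper bound of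
the kernel; averaging over an even weight gives the lower bound of `σ`. -/
lemma crossSq_sub_add (a b ξ : V) :
    crossSq (a - b) ξ + crossSq (a + b) ξ = 2 * crossSq a ξ + 2 * crossSq b ξ := by
  simp only [crossSq, norm_sub_sq_real, norm_add_sq_real, inner_sub_left, inner_add_left]
  ring

lemma crossSq_le (v ξ : V) : crossSq v ξ ≤ ‖v‖ ^ 2 * ‖ξ‖ ^ 2 := by
  unfold crossSq; nlinarith [sq_nonneg (inner ℝ v ξ)]

lemma crossSq_self (v : V) : crossSq v v = 0 := by
  simp only [crossSq, real_inner_self_eq_norm_sq]; ring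

lemma crossSq_smul_right (v ξ : V) (c : ℝ) : crossSq v (c • ξ) = c ^ 2 * crossSq v ξ := by
  simp only [crossSq, norm_smul, inner_smul_right, Real.norm_eq_abs, mul_pow, sq_abs]; ring

lemma inner_eq_sum (a b : V) : inner ℝ a b = ∑ i, a i * b i := by
  simp [PiLp.inner_apply, mul_comm]

lemma norm_sq_eq_sum (a : V) : ‖a‖ ^ 2 = ∑ i, a i ^ 2 := by
  rw [← real_inner_self_eq_norm_sq, inner_eq_sum]; simp [pow_two]

lemma phiForm_eq (z a b : V) :
    phiForm z a b = (inner ℝ a b - inner ℝ z a * inner ℝ z b / ‖z‖ ^ 2) * ‖z‖⁻¹ := by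
  simp only [phiForm, phi, inner_eq_sum, Fin.sum_univ_three]
  simp
  ring

/-- Only the component of `a` orthogonal to `z` contributes. At `z = 0` both sides vanish because
`0⁻¹ = 0`. -/
lemma phiForm_self (z a : V) : phiForm z a a = crossSq z a * (‖z‖⁻¹) ^ 3 := by
  rw [phiForm_eq, crossSq, real_inner_self_eq_norm_sq]
  rcases eq_or_ne z 0 with rfl | hz
  · simp
  · have : ‖z‖ ≠ 0 := norm_ne_zero_iff.2 hz
    field_simp

lemma phiForm_self_nonneg (z a : V) : 0 ≤ phiForm z a a := by
  rw [phiForm_self]; have := crossSq_nonneg z a; positivity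

lemma abs_phiForm_le (z a b : V) : |phiForm z a b| ≤ √(phiForm z a a) * √(phiForm z b b) := by
  rcases eq_or_ne z 0 with rfl | hz
  · simp [phiForm_eq]
  have h0 : ‖z‖ ≠ 0 := norm_ne_zero_iff.2 hz
  -- The matrix `φ(z)` is `‖z‖⁻¹` times the orthogonal projection off `z`, so the claim is
  -- Cauchy–Schwarz for the projected vectors.
  have key : ∀ a b : V, phiForm z a b =
      inner ℝ (a - (inner ℝ z a / ‖z‖ ^ 2) • z) (b - (inner ℝ z b / ‖z‖ ^ 2) • z) * ‖z‖⁻¹ := by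
    intro a b
    rw [phiForm_eq]
    simp only [inner_sub_left, inner_sub_right, inner_smul_left, inner_smul_right,
      real_inner_self_eq_norm_sq, real_inner_comm z, RCLike.conj_to_real]
    field_simp
    ring
  rw [← Real.sqrt_mul (phiForm_self_nonneg z a)]
  apply Real.abs_le_sqrt
  rw [key a b, key a a, key b b]
  have := real_inner_mul_inner_self_le (a - (inner ℝ z a / ‖z‖ ^ 2) • z)
    (b - (inner ℝ z b / ‖z‖ ^ 2) • z)
  have h1 : 0 ≤ (‖z‖⁻¹) ^ 2 := by positivity
  nlinarith [mul_le_mul_of_nonneg_right this h1]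

lemma phi_eq_phiForm (i j : Fin 3) (z : V) :
    phi i j z = phiForm z (EuclideanSpace.single i 1) (EuclideanSpace.single j 1) := by
  simp [phiForm]

lemma phiForm_comm (z a b : V) : phiForm z a b = phiForm z b a := by
  rw [phiForm_eq, phiForm_eq, real_inner_comm, mul_comm (inner ℝ z a)]

lemma phiForm_self_le (z a : V) : phiForm z a a ≤ ‖a‖ ^ 2 * ‖z‖⁻¹ := by
  rw [phiForm_eq, real_inner_self_eq_norm_sq]
  gcongr
  have : 0 ≤ inner ℝ z a * inner ℝ z a / ‖z‖ ^ 2 := by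
    have := mul_self_nonneg (inner ℝ z a); positivity
  linarith

lemma abs_phi_le (i j : Fin 3) (z : V) : |phi i j z| ≤ ‖z‖⁻¹ := by
  rw [phi_eq_phiForm]
  refine (abs_phiForm_le _ _ _).trans ?_
  have h : ∀ i : Fin 3, √(phiForm z (EuclideanSpace.single i 1) (EuclideanSpace.single i 1)) ≤
      √(‖z‖⁻¹) := fun i => Real.sqrt_le_sqrt (by simpa using phiForm_self_le z (EuclideanSpace.single i 1))
  calc _ ≤ √(‖z‖⁻¹) * √(‖z‖⁻¹) := mul_le_mul (h i) (h j) (Real.sqrt_nonneg _) (Real.sqrt_nonneg _)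
    _ = ‖z‖⁻¹ := Real.mul_self_sqrt (by positivity)

lemma modelForm_nonneg (v ξ : V) : 0 ≤ modelForm v ξ := by
  have := crossSq_nonneg v ξ; unfold modelForm; positivity

lemma modelDensity_nonneg (v : V) (a : ℝ) (b : V) : 0 ≤ modelDensity v a b := by
  have := modelForm_nonneg v b; unfold modelDensity; positivity

lemma peetre (v v' : V) : 1 + ‖v‖ ≤ (1 + ‖v - v'‖) * (1 + ‖v'‖) := by
  have : ‖v‖ ≤ ‖v - v'‖ + ‖v'‖ := by simpa using norm_add_le (v - v') v'
  nlinarith [norm_nonneg (v - v'), norm_nonneg v']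

/-- This is `peetre` divided by `‖v - v'‖ (1 + ‖v‖)`. It trades a negative power of the distance for
decay in `v`; the growth in `v'` is absorbed later by the Gaussian. -/
lemma inv_norm_sub_le (v v' : V) :
    ‖v - v'‖⁻¹ ≤ (1 + ‖v‖)⁻¹ * (1 + ‖v'‖) * (1 + ‖v - v'‖⁻¹) := by
  have h := peetre v v'
  rcases eq_or_ne ‖v - v'‖ 0 with h0 | h0
  · rw [h0]; simp only [inv_zero]; positivity
  have hp : 0 < ‖v - v'‖ := lt_of_le_of_ne (norm_nonneg _) h0.symm
  have hw : 0 < 1 + ‖v‖ := by positivity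
  rw [← sub_nonneg]
  have : (1 + ‖v‖)⁻¹ * (1 + ‖v'‖) * (1 + ‖v - v'‖⁻¹) - ‖v - v'‖⁻¹ =
    ((1 + ‖v - v'‖) * (1 + ‖v'‖) - (1 + ‖v‖)) * ((1 + ‖v‖)⁻¹ * ‖v - v'‖⁻¹) := by
    field_simp
    ring
  rw [this]
  exact mul_nonneg (by linarith) (by positivity)

/-- The factor `|v-v'|⁻³` yields `(1+|v|)⁻³`, and `|(v-v')×ξ|² ≤ 2|v×ξ|² + 2|v'|²|ξ|²` turns the
numerator into that of `modelForm`. -/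
lemma phiForm_self_le_modelForm (v v' ξ : V) : phiForm (v - v') ξ ξ ≤
    16 * modelForm v ξ * ((1 + ‖v'‖) ^ 5 * (1 + ‖v - v'‖⁻¹)) := by
  rw [phiForm_self]
  have hP := inv_norm_sub_le v v'
  have hz : crossSq (v - v') ξ ≤ 2 * crossSq v ξ + 2 * ‖v'‖ ^ 2 * ‖ξ‖ ^ 2 := by
    have := crossSq_sub_add v v' ξ
    have := crossSq_nonneg (v + v') ξ
    have := crossSq_le v' ξ
    linarith
  set t := ‖v - v'‖⁻¹ with ht
  have ht0 : 0 ≤ t := by positivity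
  have h0 := crossSq_nonneg (v - v') ξ
  have hQ := crossSq_nonneg v ξ
  -- The numerator is quadratic in `v - v'` and cancels two of the three singular powers; only one
  -- factor `1 + t` survives.
  have h1 : crossSq (v - v') ξ * t ^ 2 ≤ ‖ξ‖ ^ 2 := by
    have h2 := crossSq_le (v - v') ξ
    rcases eq_or_ne ‖v - v'‖ 0 with h0 | h0
    · simp [ht, h0]
    · calc crossSq (v - v') ξ * t ^ 2 ≤ (‖v - v'‖ ^ 2 * ‖ξ‖ ^ 2) * t ^ 2 := by gcongr
        _ = _ := by rw [ht]; field_simp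
  have h2 : crossSq (v - v') ξ * (1 + t) ^ 3 ≤
      16 * ((‖ξ‖ ^ 2 + crossSq v ξ) * ((1 + ‖v'‖) ^ 2 * (1 + t))) := by
    have h3 : crossSq (v - v') ξ * (1 + t) ^ 3 ≤
        5 * crossSq (v - v') ξ + 5 * ‖ξ‖ ^ 2 * (1 + t) := by
      nlinarith [mul_nonneg h0 (sq_nonneg (1 - t)), mul_le_mul_of_nonneg_right h1 ht0,
        mul_nonneg ht0 (sq_nonneg ‖ξ‖)]
    have hn := norm_nonneg v'
    have h4 : 2 * crossSq v ξ + 2 * ‖v'‖ ^ 2 * ‖ξ‖ ^ 2 ≤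
        2 * ((‖ξ‖ ^ 2 + crossSq v ξ) * (1 + ‖v'‖) ^ 2) := by
      nlinarith [mul_nonneg hQ hn, mul_nonneg (sq_nonneg ‖ξ‖) hn, mul_nonneg hQ (sq_nonneg ‖v'‖)]
    have h5 : ‖ξ‖ ^ 2 ≤ (‖ξ‖ ^ 2 + crossSq v ξ) * (1 + ‖v'‖) ^ 2 := by
      nlinarith [mul_nonneg hQ hn, mul_nonneg (sq_nonneg ‖ξ‖) hn, mul_nonneg hQ (sq_nonneg ‖v'‖),
        mul_nonneg (sq_nonneg ‖ξ‖) (sq_nonneg ‖v'‖)]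
    have h6 : 0 ≤ (‖ξ‖ ^ 2 + crossSq v ξ) * (1 + ‖v'‖) ^ 2 := by positivity
    nlinarith [mul_le_mul_of_nonneg_right h5 ht0, mul_nonneg h6 ht0]
  calc crossSq (v - v') ξ * t ^ 3
      ≤ crossSq (v - v') ξ * ((1 + ‖v‖)⁻¹ * (1 + ‖v'‖) * (1 + t)) ^ 3 := by gcongr
    _ = ((1 + ‖v‖) ^ 3)⁻¹ * (1 + ‖v'‖) ^ 3 * (crossSq (v - v') ξ * (1 + t) ^ 3) := by
      rw [mul_pow, mul_pow, inv_pow]; ring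
    _ ≤ ((1 + ‖v‖) ^ 3)⁻¹ * (1 + ‖v'‖) ^ 3 *
        (16 * ((‖ξ‖ ^ 2 + crossSq v ξ) * ((1 + ‖v'‖) ^ 2 * (1 + t)))) := by gcongr
    _ = _ := by rw [modelForm]; ring

/-- The first power of `1 + ‖v - v'‖⁻¹` would suffice; the square matches the singularity of `∂φ`,
so that one majorant serves all kernels. -/
lemma abs_phiForm_le_modelForm (v v' ξ η : V) : |phiForm (v - v') ξ η| ≤
    16 * (√(modelForm v ξ) * √(modelForm v η)) * ((1 + ‖v'‖) ^ 5 * (1 + ‖v - v'‖⁻¹) ^ 2) := by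
  refine (abs_phiForm_le _ _ _).trans ?_
  have hA : 0 ≤ (1 + ‖v'‖) ^ 5 * (1 + ‖v - v'‖⁻¹) := by positivity
  have h : ∀ ξ, √(phiForm (v - v') ξ ξ) ≤
      4 * √(modelForm v ξ) * √((1 + ‖v'‖) ^ 5 * (1 + ‖v - v'‖⁻¹)) := by
    intro ξ
    refine (Real.sqrt_le_sqrt (phiForm_self_le_modelForm v v' ξ)).trans_eq ?_
    have h4 : √(16 : ℝ) = 4 := by
      rw [show (16 : ℝ) = 4 ^ 2 by norm_num]; exact Real.sqrt_sq (by norm_num)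
    have := modelForm_nonneg v ξ
    rw [Real.sqrt_mul (by positivity), Real.sqrt_mul (by norm_num), h4]
  calc _ ≤ _ := mul_le_mul (h ξ) (h η) (Real.sqrt_nonneg _) (by positivity)
    _ = 16 * (√(modelForm v ξ) * √(modelForm v η)) * ((1 + ‖v'‖) ^ 5 * (1 + ‖v - v'‖⁻¹)) := by
      linear_combination 16 * √(modelForm v ξ) * √(modelForm v η) * Real.mul_self_sqrt hA
    _ ≤ _ := by
      gcongr
      have : 0 ≤ ‖v - v'‖⁻¹ := by positivity
      nlinarith

/-- A derivative of the Gaussian puts `v'` into one slot of the form. There the crude bound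
`|v'|²/|v-v'|` already decays like `(1+|v|)⁻¹`, which is the weight of the zero-order term in
`modelDensity`. -/
lemma abs_phiForm_right_le (v v' ξ : V) : |phiForm (v - v') ξ v'| ≤
    4 * (√(modelForm v ξ) * √((1 + ‖v‖)⁻¹)) * ((1 + ‖v'‖) ^ 5 * (1 + ‖v - v'‖⁻¹) ^ 2) := by
  refine (abs_phiForm_le _ _ _).trans ?_
  have hξ := modelForm_nonneg v ξ
  have hn := norm_nonneg v'
  have ht : 0 ≤ ‖v - v'‖⁻¹ := by positivity
  have h2 : phiForm (v - v') v' v' ≤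
      (1 + ‖v‖)⁻¹ * ((1 + ‖v'‖) ^ 5 * (1 + ‖v - v'‖⁻¹)) := by
    calc phiForm (v - v') v' v' ≤ ‖v'‖ ^ 2 * ‖v - v'‖⁻¹ := phiForm_self_le _ _
      _ ≤ (1 + ‖v'‖) ^ 4 * ((1 + ‖v‖)⁻¹ * (1 + ‖v'‖) * (1 + ‖v - v'‖⁻¹)) := by
        gcongr
        · nlinarith [sq_nonneg (‖v'‖ ^ 2), pow_nonneg hn 3, pow_nonneg hn 2]
        · exact inv_norm_sub_le v v'
      _ = _ := by ring
  have h1 := phiForm_self_le_modelForm v v' ξ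
  have hB : 0 ≤ (1 + ‖v'‖) ^ 5 * (1 + ‖v - v'‖⁻¹) := by positivity
  rw [← Real.sqrt_mul (phiForm_self_nonneg _ _), ← Real.sqrt_mul hξ]
  have h4 : √(16 : ℝ) = 4 := by
    rw [show (16 : ℝ) = 4 ^ 2 by norm_num]; exact Real.sqrt_sq (by norm_num)
  calc √(phiForm (v - v') ξ ξ * phiForm (v - v') v' v')
      ≤ √(16 * (modelForm v ξ * (1 + ‖v‖)⁻¹) * ((1 + ‖v'‖) ^ 5 * (1 + ‖v - v'‖⁻¹)) ^ 2) := by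
        apply Real.sqrt_le_sqrt
        calc _ ≤ _ := mul_le_mul h1 h2 (phiForm_self_nonneg _ _) (by positivity)
          _ = _ := by ring
    _ = 4 * √(modelForm v ξ * (1 + ‖v‖)⁻¹) * ((1 + ‖v'‖) ^ 5 * (1 + ‖v - v'‖⁻¹)) := by
      rw [Real.sqrt_mul (by positivity), Real.sqrt_mul (by norm_num), h4, Real.sqrt_sq hB]
    _ ≤ _ := by
      gcongr
      nlinarith

/-- Used for the terms with `∂φ`: the decay `(1+|v|)⁻²` splits as the exponents `3/2` and `1/2` of
the two parts of the density. -/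
lemma norm_mul_inv_sq_le (v ξ : V) :
    ‖ξ‖ * ((1 + ‖v‖) ^ 2)⁻¹ ≤ √(modelForm v ξ) * √((1 + ‖v‖)⁻¹) := by
  rw [← Real.sqrt_mul (modelForm_nonneg v ξ)]
  apply Real.le_sqrt_of_sq_le
  have := crossSq_nonneg v ξ
  calc (‖ξ‖ * ((1 + ‖v‖) ^ 2)⁻¹) ^ 2 = ((1 + ‖v‖) ^ 3)⁻¹ * ‖ξ‖ ^ 2 * (1 + ‖v‖)⁻¹ := by
        field_simp
    _ ≤ _ := by rw [modelForm]; gcongr; linarith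

lemma modelForm_le (v ξ : V) : modelForm v ξ ≤ ‖ξ‖ ^ 2 := by
  have h := crossSq_le v ξ
  have hn := norm_nonneg v
  rw [modelForm, inv_mul_le_iff₀ (by positivity)]
  nlinarith [mul_nonneg hn (sq_nonneg ‖ξ‖), mul_nonneg (pow_nonneg hn 3) (sq_nonneg ‖ξ‖),
    mul_nonneg (sq_nonneg ‖v‖) (sq_nonneg ‖ξ‖)]

lemma modelDensity_le (v : V) (a : ℝ) (b : V) : modelDensity v a b ≤ a ^ 2 + ‖b‖ ^ 2 := by
  have h := modelForm_le v b
  have : (1 + ‖v‖)⁻¹ * a ^ 2 ≤ 1 * a ^ 2 := by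
    gcongr
    exact inv_le_one_of_one_le₀ (by linarith [norm_nonneg v])
  unfold modelDensity; linarith

lemma sqrt_modelForm_le (v : V) (a : ℝ) (b : V) : √(modelForm v b) ≤ √(modelDensity v a b) := by
  apply Real.sqrt_le_sqrt
  have : 0 ≤ (1 + ‖v‖)⁻¹ * a ^ 2 := by positivity
  unfold modelDensity; linarith

lemma sqrt_mul_abs_le (v : V) (a : ℝ) (b : V) :
    √((1 + ‖v‖)⁻¹) * |a| ≤ √(modelDensity v a b) := by
  rw [← Real.sqrt_sq_eq_abs, ← Real.sqrt_mul (by positivity)]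
  apply Real.sqrt_le_sqrt
  have := modelForm_nonneg v b
  unfold modelDensity; linarith

/-! ### The majorant kernel and the bounds of its convolution. -/

/-- The majorant of the kernels of the convolutions in `Γ[g, f]`. -/
def majorant (v v' : V) : ℝ := (1 + ‖v - v'‖⁻¹) ^ 2 * ((1 + ‖v'‖) ^ 5 * sqrtMu v')

/-- The convolution of the majorant with `|g|`. -/
def majorantInt (g : V → ℝ) (v : V) : ℝ≥0∞ := ∫⁻ v', ENNReal.ofReal (majorant v v') * ‖g v'‖ₑ

lemma sqrtMu_eq (v : V) : sqrtMu v = Real.exp (-‖v‖ ^ 2 / 2) := by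
  rw [sqrtMu, mu, Real.exp_half]

lemma sqrtMu_pos (v : V) : 0 < sqrtMu v := by rw [sqrtMu_eq]; exact Real.exp_pos _

lemma contDiff_sqrtMu : ContDiff ℝ ∞ sqrtMu := by
  have : sqrtMu = fun v => Real.exp (-‖v‖ ^ 2 / 2) := funext sqrtMu_eq
  rw [this]
  exact (((contDiff_norm_sq ℝ).neg).div_const 2).exp

lemma weight_pos (s : ℝ) (v : V) : 0 < weight s v := by
  unfold weight; exact Real.rpow_pos_of_pos (by positivity) _

lemma continuous_weight (s : ℝ) : Continuous (weight s) := by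
  unfold weight
  exact (continuous_const.add continuous_norm).rpow_const
    (fun v => Or.inl (by simp only [Pi.add_apply]; positivity))

lemma weight_natCast (n : ℕ) (v : V) : weight n v = (1 + ‖v‖) ^ n := by
  simp [weight]

lemma weight_add (s t : ℝ) (v : V) : weight (s + t) v = weight s v * weight t v :=
  Real.rpow_add (by positivity) _ _

lemma exists_weight_mul_sqrtMu_le (s : ℝ) : ∃ C : ℝ, 0 < C ∧ ∀ v, weight s v * sqrtMu v ≤ C := by
  obtain ⟨n, hn⟩ := exists_nat_ge s
  -- From `x^n ≤ n! e^x` at `x = 1 + |v|`, together with `1 + |v| - |v|²/2 ≤ 2`.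
  refine ⟨n.factorial * Real.exp 2, by positivity, fun v => ?_⟩
  have h1 : weight s v ≤ (1 + ‖v‖) ^ n := by
    rw [← weight_natCast]
    exact Real.rpow_le_rpow_of_exponent_le (by linarith [norm_nonneg v]) hn
  have h2 := Real.pow_div_factorial_le_exp (x := 1 + ‖v‖) (by positivity) n
  rw [div_le_iff₀ (by positivity)] at h2
  calc weight s v * sqrtMu v ≤ (Real.exp (1 + ‖v‖) * n.factorial) * sqrtMu v := by
        gcongr
        · exact (sqrtMu_pos v).le
        · exact h1.trans h2
    _ = n.factorial * Real.exp (1 + ‖v‖ + -‖v‖ ^ 2 / 2) := by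
        rw [sqrtMu_eq, Real.exp_add (1 + ‖v‖)]; ring
    _ ≤ _ := by
        gcongr
        nlinarith [sq_nonneg (‖v‖ - 1)]

lemma finrank_V : Module.finrank ℝ V = 3 := by simp

/-- In polar coordinates in dimension three the Jacobian `y²` cancels the singularity `y⁻²`. -/
lemma integrableOn_norm_inv_sq (r : ℝ) :
    IntegrableOn (fun z : V => (‖z‖⁻¹) ^ 2) (Metric.ball 0 r) := by
  rw [← integrable_indicator_iff measurableSet_ball]
  have h := integrable_fun_norm_addHaar (volume : Measure V)
    (f := fun y : ℝ => Set.indicator (Set.Iio r) (fun y => (y⁻¹) ^ 2) y)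
  have h2 : (Metric.ball (0 : V) r).indicator (fun z : V => (‖z‖⁻¹) ^ 2) =
      fun x : V => Set.indicator (Set.Iio r) (fun y => (y⁻¹) ^ 2) ‖x‖ := by
    ext x
    simp [Set.indicator, Metric.mem_ball]
  rw [h2, h, finrank_V]
  have h3 : IntegrableOn (Set.indicator (Set.Iio r) (fun _ : ℝ => (1 : ℝ))) (Set.Ioi 0) := by
    rw [IntegrableOn, integrable_indicator_iff measurableSet_Iio, IntegrableOn,
      Measure.restrict_restrict measurableSet_Iio, Set.Iio_inter_Ioi]
    exact integrableOn_const (by simp) (by simp)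
  refine h3.congr_fun (fun y hy => ?_) measurableSet_Ioi
  have hy : (0 : ℝ) < y := hy
  simp only [Set.indicator, Set.mem_Iio]
  split_ifs
  · simp; field_simp
  · simp

lemma lintegral_norm_inv_sq_lt_top (r : ℝ) :
    ∫⁻ z in Metric.ball (0 : V) r, ENNReal.ofReal ((‖z‖⁻¹) ^ 2) < ⊤ := by
  have := (integrableOn_norm_inv_sq r).2
  rwa [hasFiniteIntegral_iff_ofReal (ae_of_all _ fun z => by positivity)] at this

lemma lintegral_weight_lt_top : ∫⁻ v : V, ENNReal.ofReal (((1 + ‖v‖) ^ 4)⁻¹) < ⊤ := by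
  have h := (integrable_one_add_norm (E := V) (μ := volume) (r := 4)
    (by rw [finrank_V]; norm_num)).2
  rw [hasFiniteIntegral_iff_ofReal (ae_of_all _ fun z => by positivity)] at h
  convert h using 4 with v
  rw [Real.rpow_neg (by positivity)]
  norm_cast

lemma measurable_sqrtMu : Measurable sqrtMu := contDiff_sqrtMu.continuous.measurable

/-- Within distance one of `v` the singularity is integrable and the weight is at most one; farther
away the first factor is at most `4` and the weight `(1+|v'|)⁻⁴` is integrable. Both contributions
are independent of `v`. -/
lemma exists_lintegral_inv_le : ∃ C : ℝ≥0, ∀ v : V,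
    ∫⁻ v', ENNReal.ofReal ((1 + ‖v - v'‖⁻¹) ^ 2 * ((1 + ‖v'‖) ^ 4)⁻¹) ≤ C := by
  have hA := lintegral_weight_lt_top
  have hB := lintegral_norm_inv_sq_lt_top 1
  set A := ∫⁻ v : V, ENNReal.ofReal (((1 + ‖v‖) ^ 4)⁻¹)
  set B := ∫⁻ z in Metric.ball (0 : V) 1, ENNReal.ofReal ((‖z‖⁻¹) ^ 2) with hBdef
  refine ⟨(4 * A + 4 * B).toNNReal, fun v => ?_⟩
  rw [ENNReal.coe_toNNReal (by finiteness)]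
  have hle : ∀ v' : V, ENNReal.ofReal ((1 + ‖v - v'‖⁻¹) ^ 2 * ((1 + ‖v'‖) ^ 4)⁻¹) ≤
      4 * ENNReal.ofReal (((1 + ‖v'‖) ^ 4)⁻¹) +
      4 * (Metric.ball (0 : V) 1).indicator (fun z => ENNReal.ofReal ((‖z‖⁻¹) ^ 2)) (v - v') := by
    intro v'
    have h4 : (4 : ℝ≥0∞) = ENNReal.ofReal 4 := by norm_num
    have hw : ((1 + ‖v'‖) ^ 4)⁻¹ ≤ 1 :=
      inv_le_one_of_one_le₀ (one_le_pow₀ (by linarith [norm_nonneg v']))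
    have hw0 : 0 ≤ ((1 + ‖v'‖) ^ 4)⁻¹ := by positivity
    by_cases hz : v - v' ∈ Metric.ball (0 : V) 1
    · rw [Set.indicator_of_mem hz, h4, ← ENNReal.ofReal_mul (by norm_num),
        ← ENNReal.ofReal_mul (by norm_num), ← ENNReal.ofReal_add (by positivity) (by positivity)]
      apply ENNReal.ofReal_le_ofReal
      have ht : 0 ≤ ‖v - v'‖⁻¹ := by positivity
      have : (1 + ‖v - v'‖⁻¹) ^ 2 ≤ 4 + 4 * (‖v - v'‖⁻¹) ^ 2 := by
        nlinarith [sq_nonneg (‖v - v'‖⁻¹ - 1)]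
      calc _ ≤ (4 + 4 * (‖v - v'‖⁻¹) ^ 2) * ((1 + ‖v'‖) ^ 4)⁻¹ := by gcongr
        _ = 4 * ((1 + ‖v'‖) ^ 4)⁻¹ + 4 * (‖v - v'‖⁻¹) ^ 2 * ((1 + ‖v'‖) ^ 4)⁻¹ := by ring
        _ ≤ 4 * ((1 + ‖v'‖) ^ 4)⁻¹ + 4 * (‖v - v'‖⁻¹) ^ 2 * 1 := by gcongr
        _ = _ := by ring
    · rw [Set.indicator_of_notMem hz, mul_zero, add_zero, h4, ← ENNReal.ofReal_mul (by norm_num)]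
      apply ENNReal.ofReal_le_ofReal
      gcongr
      have h1 : 1 ≤ ‖v - v'‖ := by simpa using hz
      have : ‖v - v'‖⁻¹ ≤ 1 := inv_le_one_of_one_le₀ h1
      have ht : 0 ≤ ‖v - v'‖⁻¹ := by positivity
      nlinarith
  refine (lintegral_mono hle).trans ?_
  have hm1 : Measurable fun z : V => ENNReal.ofReal (‖z‖⁻¹ ^ 2) := by fun_prop
  have hm : Measurable ((Metric.ball (0 : V) 1).indicator
      (fun z => ENNReal.ofReal ((‖z‖⁻¹) ^ 2))) := hm1.indicator measurableSet_ball
  rw [lintegral_add_left (by fun_prop), lintegral_const_mul _ (by fun_prop),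
    lintegral_const_mul _ (by fun_prop),
    lintegral_sub_left_eq_self ((Metric.ball (0 : V) 1).indicator
      (fun z => ENNReal.ofReal ((‖z‖⁻¹) ^ 2))) v, lintegral_indicator measurableSet_ball]

lemma majorant_nonneg (v v' : V) : 0 ≤ majorant v v' := by
  have := sqrtMu_pos v'; unfold majorant; positivity

lemma measurable_majorant : Measurable (fun p : V × V => majorant p.1 p.2) := by
  have := measurable_sqrtMu
  unfold majorant
  fun_prop

/-- Any polynomial weight in the second variable is absorbed by the Gaussian. -/
lemma exists_majorant_le (s : ℝ) : ∃ C : ℝ≥0, ∀ v v' : V, ENNReal.ofReal (majorant v v') ≤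
    C * ENNReal.ofReal (weight s v') * ENNReal.ofReal ((1 + ‖v - v'‖⁻¹) ^ 2 * ((1 + ‖v'‖) ^ 4)⁻¹) := by
  -- The exponent is `9 = 5 + 4`: five powers occur in the majorant and four are needed to create
  -- the integrable factor.
  obtain ⟨C, hC, h⟩ := exists_weight_mul_sqrtMu_le ((9 : ℕ) - s)
  refine ⟨C.toNNReal, fun v v' => ?_⟩
  rw [← ENNReal.ofReal, ← ENNReal.ofReal_mul hC.le,
    ← ENNReal.ofReal_mul (mul_nonneg hC.le (weight_pos s v').le)]
  apply ENNReal.ofReal_le_ofReal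
  have h1 := h v'
  have h2 : weight ((9 : ℕ) - s) v' * weight s v' = (1 + ‖v'‖) ^ 9 := by
    rw [← weight_add, ← weight_natCast]; ring_nf
  have h3 : (1 + ‖v'‖) ^ 9 * sqrtMu v' ≤ C * weight s v' := by
    rw [← h2]; nlinarith [weight_pos s v']
  calc majorant v v' = (1 + ‖v - v'‖⁻¹) ^ 2 * ((1 + ‖v'‖) ^ 4)⁻¹ * ((1 + ‖v'‖) ^ 9 * sqrtMu v') := by
        unfold majorant; field_simp
    _ ≤ (1 + ‖v - v'‖⁻¹) ^ 2 * ((1 + ‖v'‖) ^ 4)⁻¹ * (C * weight s v') := by gcongr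
    _ = _ := by ring

lemma exists_lintegral_majorant_le : ∃ C : ℝ≥0, ∀ v : V,
    ∫⁻ v', ENNReal.ofReal (majorant v v') ≤ C := by
  obtain ⟨C, hC⟩ := exists_majorant_le 0
  obtain ⟨D, hD⟩ := exists_lintegral_inv_le
  refine ⟨C * D, fun v => ?_⟩
  calc _ ≤ ∫⁻ v', C * ENNReal.ofReal ((1 + ‖v - v'‖⁻¹) ^ 2 * ((1 + ‖v'‖) ^ 4)⁻¹) :=
        lintegral_mono fun v' => by simpa [weight] using hC v v'
    _ ≤ _ := by
        rw [lintegral_const_mul _ (by fun_prop)]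
        push_cast
        gcongr
        exact hD v

lemma exists_majorantInt_le : ∃ C : ℝ≥0, ∀ (g : V → ℝ) (v : V),
    majorantInt g v ≤ C * eLpNorm g ⊤ volume := by
  obtain ⟨C, hC⟩ := exists_lintegral_majorant_le
  refine ⟨C, fun g v => ?_⟩
  have h : ∀ᵐ v', ‖g v'‖ₑ ≤ eLpNorm g ⊤ volume := by
    rw [eLpNorm_exponent_top]; exact ae_le_eLpNormEssSup
  have hm : Measurable fun v' => ENNReal.ofReal (majorant v v') :=
    (measurable_majorant.comp measurable_prodMk_left).ennreal_ofReal
  calc majorantInt g v ≤ ∫⁻ v', ENNReal.ofReal (majorant v v') * eLpNorm g ⊤ volume :=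
        lintegral_mono_ae (h.mono fun v' hv' => by gcongr)
    _ ≤ _ := by rw [lintegral_mul_const _ hm]; gcongr; exact hC v

lemma measurable_lintegral_majorant {h : V → ℝ≥0∞} (hh : AEMeasurable h) :
    Measurable fun v => ∫⁻ v', ENNReal.ofReal (majorant v v') * h v' := by
  have : (fun v => ∫⁻ v', ENNReal.ofReal (majorant v v') * h v') =
      fun v => ∫⁻ v', ENNReal.ofReal (majorant v v') * hh.mk h v' := by
    ext v
    exact lintegral_congr_ae (hh.ae_eq_mk.mono fun v' hv' => by simp only [hv'])
  rw [this]
  apply Measurable.lintegral_prod_right'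
    (f := fun p : V × V => ENNReal.ofReal (majorant p.1 p.2) * hh.mk h p.2)
  exact measurable_majorant.ennreal_ofReal.mul (hh.measurable_mk.comp measurable_snd)

/-- The `L²` bound of `majorantInt` by weighted `L²` norms. -/
lemma exists_lintegral_majorantInt_sq_le (s : ℝ) : ∃ C : ℝ≥0, ∀ g : V → ℝ, AEStronglyMeasurable g →
    ∫⁻ v, ENNReal.ofReal (((1 + ‖v‖) ^ 4)⁻¹) * majorantInt g v ^ 2 ≤
      C * ∫⁻ v, ENNReal.ofReal (weight s v) * ‖g v‖ₑ ^ 2 := by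
  obtain ⟨A, hA⟩ := exists_lintegral_majorant_le
  obtain ⟨D, hD⟩ := exists_lintegral_inv_le
  obtain ⟨E, hE⟩ := exists_weight_mul_sqrtMu_le ((5 : ℕ) - s)
  refine ⟨A * (D * E.toNNReal), fun g hg => ?_⟩
  have hgm : AEMeasurable (fun v => ‖g v‖ₑ) := hg.enorm
  -- Cauchy–Schwarz with the majorant split into two square roots; one factor is the total mass of
  -- the kernel, bounded by `A`.
  have hCS : ∀ v, majorantInt g v ^ 2 ≤
      A * ∫⁻ v', ENNReal.ofReal (majorant v v') * ‖g v'‖ₑ ^ 2 := by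
    intro v
    have hm : Measurable fun v' => ENNReal.ofReal (majorant v v') :=
      (measurable_majorant.comp measurable_prodMk_left).ennreal_ofReal
    have h := ENNReal.lintegral_mul_le_Lp_mul_Lq volume Real.HolderConjugate.two_two
      (f := fun v' => ENNReal.ofReal (majorant v v') ^ (1 / 2 : ℝ))
      (g := fun v' => ENNReal.ofReal (majorant v v') ^ (1 / 2 : ℝ) * ‖g v'‖ₑ)
      (hm.pow_const _).aemeasurable ((hm.pow_const _).aemeasurable.mul hgm)
    have h1 : ∀ x : ℝ≥0∞, (x ^ (1 / 2 : ℝ)) ^ (2 : ℝ) = x := fun x => by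
      rw [← ENNReal.rpow_mul]; norm_num
    have h1' : ∀ x : ℝ≥0∞, (x ^ (1 / 2 : ℝ)) ^ 2 = x := fun x => by
      rw [← ENNReal.rpow_two, h1]
    have h2 : ∀ x : ℝ≥0∞, x ^ (1 / 2 : ℝ) * x ^ (1 / 2 : ℝ) = x := fun x => by
      rw [← sq, h1']
    simp only [Pi.mul_apply, ← mul_assoc, h2, h1, ENNReal.mul_rpow_of_nonneg _ _ zero_le_two] at h
    calc majorantInt g v ^ 2 ≤ _ := pow_le_pow_left' h 2
      _ = (∫⁻ v', ENNReal.ofReal (majorant v v')) *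
          ∫⁻ v', ENNReal.ofReal (majorant v v') * ‖g v'‖ₑ ^ 2 := by
        rw [mul_pow, h1', h1']; simp only [ENNReal.rpow_two]
      _ ≤ _ := by gcongr; exact hA v
  have hmeas2 : AEMeasurable (fun p : V × V => ENNReal.ofReal (((1 + ‖p.1‖) ^ 4)⁻¹) *
      (ENNReal.ofReal (majorant p.1 p.2) * ‖g p.2‖ₑ ^ 2)) (volume.prod volume) := by
    refine AEMeasurable.mul (by fun_prop) (measurable_majorant.ennreal_ofReal.aemeasurable.mul ?_)
    exact (hgm.comp_quasiMeasurePreserving Measure.quasiMeasurePreserving_snd).pow_const 2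
  calc ∫⁻ v, ENNReal.ofReal (((1 + ‖v‖) ^ 4)⁻¹) * majorantInt g v ^ 2
      ≤ ∫⁻ v, A * ∫⁻ v', ENNReal.ofReal (((1 + ‖v‖) ^ 4)⁻¹) *
          (ENNReal.ofReal (majorant v v') * ‖g v'‖ₑ ^ 2) := by
        apply lintegral_mono
        intro v
        simp only
        rw [lintegral_const_mul' _ _ ENNReal.ofReal_ne_top, mul_left_comm]
        gcongr
        exact hCS v
    -- After Tonelli the weight `(1+|v|)⁻⁴` makes the integral in `v` uniformly bounded in `v'`, and
    -- the Gaussian left in `v'` absorbs any power weight.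
    _ = A * ∫⁻ v', ∫⁻ v, ENNReal.ofReal (((1 + ‖v‖) ^ 4)⁻¹) *
          (ENNReal.ofReal (majorant v v') * ‖g v'‖ₑ ^ 2) := by
        rw [lintegral_const_mul' _ _ ENNReal.coe_ne_top]
        congr 1
        exact lintegral_lintegral_swap hmeas2
    _ ≤ A * ∫⁻ v', (D * E.toNNReal) * (ENNReal.ofReal (weight s v') * ‖g v'‖ₑ ^ 2) := by
        gcongr with v'
        have h5 : (1 + ‖v'‖) ^ 5 * sqrtMu v' ≤ E * weight s v' := by
          have h2 : weight ((5 : ℕ) - s) v' * weight s v' = (1 + ‖v'‖) ^ 5 := by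
            rw [← weight_add, ← weight_natCast]; ring_nf
          rw [← h2]; nlinarith [weight_pos s v', hE.2 v']
        calc _ ≤ ∫⁻ v, ENNReal.ofReal ((1 + ‖v' - v‖⁻¹) ^ 2 * ((1 + ‖v‖) ^ 4)⁻¹) *
              (ENNReal.ofReal (E * weight s v') * ‖g v'‖ₑ ^ 2) := by
              apply lintegral_mono
              intro v
              simp only
              rw [← mul_assoc, ← mul_assoc]
              refine mul_le_mul' ?_ le_rfl
              rw [← ENNReal.ofReal_mul (by positivity), ← ENNReal.ofReal_mul (by positivity)]
              apply ENNReal.ofReal_le_ofReal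
              rw [norm_sub_rev v' v, majorant]
              calc _ = (1 + ‖v - v'‖⁻¹) ^ 2 * ((1 + ‖v‖) ^ 4)⁻¹ * ((1 + ‖v'‖) ^ 5 * sqrtMu v') := by
                    ring
                _ ≤ _ := by gcongr
          _ ≤ D * (ENNReal.ofReal (E * weight s v') * ‖g v'‖ₑ ^ 2) := by
              rw [lintegral_mul_const _ (by fun_prop)]
              gcongr
              exact hD v'
          _ = _ := by
              rw [ENNReal.ofReal_mul hE.1.le, ENNReal.ofReal]; ring
    _ = _ := by
        rw [lintegral_const_mul' _ _ (by finiteness)]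
        push_cast; ring

/-! ### The lower bound of the matrix `σ`. -/

lemma measurable_phi (i j : Fin 3) : Measurable (phi i j) := by
  unfold phi; fun_prop

lemma mu_eq_sq (v : V) : mu v = sqrtMu v ^ 2 := (Real.sq_sqrt (Real.exp_pos _).le).symm

lemma sqrtMu_le_one (v : V) : sqrtMu v ≤ 1 := by
  rw [sqrtMu_eq, Real.exp_le_one_iff]; nlinarith [sq_nonneg ‖v‖]

lemma mu_pos (v : V) : 0 < mu v := Real.exp_pos _

lemma mu_le_sqrtMu (v : V) : mu v ≤ sqrtMu v := by
  rw [mu_eq_sq]; nlinarith [sqrtMu_pos v, sqrtMu_le_one v]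

lemma continuous_mu : Continuous mu := by unfold mu; fun_prop

lemma inv_norm_le_sq (z : V) : ‖z‖⁻¹ ≤ (1 + ‖z‖⁻¹) ^ 2 := by
  nlinarith [inv_nonneg.2 (norm_nonneg z)]

lemma inv_norm_mul_sqrtMu_le_majorant (v v' : V) : ‖v - v'‖⁻¹ * sqrtMu v' ≤ majorant v v' := by
  have h1 : 1 ≤ (1 + ‖v'‖) ^ 5 := one_le_pow₀ (by linarith [norm_nonneg v'])
  have := sqrtMu_pos v'
  unfold majorant
  gcongr
  · exact inv_norm_le_sq _
  · nlinarith

lemma integrable_majorant (v : V) : Integrable (majorant v) := by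
  obtain ⟨C, hC⟩ := exists_lintegral_majorant_le
  refine ⟨(measurable_majorant.comp measurable_prodMk_left).aestronglyMeasurable, ?_⟩
  rw [hasFiniteIntegral_iff_ofReal (ae_of_all _ fun z => majorant_nonneg _ _)]
  exact (hC v).trans_lt ENNReal.coe_lt_top

lemma integrable_phi_mul_mu (i j : Fin 3) (v : V) : Integrable fun v' => phi i j (v - v') * mu v' := by
  refine (integrable_majorant v).mono' ?_ (ae_of_all _ fun v' => ?_)
  · exact (((measurable_phi i j).comp (by fun_prop)).mul
      continuous_mu.measurable).aestronglyMeasurable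
  · rw [norm_mul, Real.norm_eq_abs, Real.norm_of_nonneg (mu_pos v').le]
    refine le_trans ?_ (inv_norm_mul_sqrtMu_le_majorant v v')
    gcongr
    · exact (mu_pos v').le
    · exact abs_phi_le _ _ _
    · exact mu_le_sqrtMu v'

lemma integrable_phiForm_mul_mu (v b : V) : Integrable fun v' => phiForm (v - v') b b * mu v' := by
  have : (fun v' => phiForm (v - v') b b * mu v') =
      fun v' => ∑ i, ∑ j, (phi i j (v - v') * mu v') * (b i * b j) := by
    ext v'
    simp only [phiForm, Finset.sum_mul]
    exact Finset.sum_congr rfl fun i _ => Finset.sum_congr rfl fun j _ => by ring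
  rw [this]
  exact integrable_finsetSum _ fun i _ => integrable_finsetSum _ fun j _ =>
    (integrable_phi_mul_mu i j v).mul_const _

lemma sum_sigmaConv_mu (v b : V) : ∑ i, ∑ j, sigmaConv i j mu v * b i * b j =
    ∫ v', phiForm (v - v') b b * mu v' := by
  have hI : ∀ i j, Integrable fun v' => phi i j (v - v') * b i * b j * mu v' := fun i j => by
    refine ((integrable_phi_mul_mu i j v).mul_const (b i * b j)).congr (ae_of_all _ fun v' => ?_)
    simp only
    ring
  simp only [phiForm, Finset.sum_mul]
  rw [integral_finsetSum _ fun i _ => integrable_finsetSum _ fun j _ => hI i j]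
  refine Finset.sum_congr rfl fun i _ => ?_
  rw [integral_finsetSum _ fun j _ => hI i j]
  refine Finset.sum_congr rfl fun j _ => ?_
  rw [sigmaConv, mul_assoc, ← integral_mul_const]
  congr 1 with v'
  ring

/-- The weight `(1 + |v|)⁻³ μ(v)`. -/
def auxWeight (v : V) : ℝ := ((1 + ‖v‖) ^ 3)⁻¹ * mu v

lemma auxWeight_pos (v : V) : 0 < auxWeight v := by
  have := mu_pos v; unfold auxWeight; positivity

lemma continuous_auxWeight : Continuous auxWeight := by
  unfold auxWeight
  exact (Continuous.inv₀ (by fun_prop) fun v => by positivity).mul continuous_mu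

lemma continuous_crossSq : Continuous fun p : V × V => crossSq p.1 p.2 := by
  unfold crossSq; fun_prop

/-- Since `|v-v'| ≤ (1+|v|)(1+|v'|)`, the cubic denominator is replaced by a product that separates
`v` from `v'`. What remains is polynomial in `v` and can be averaged exactly. -/
lemma crossSq_mul_auxWeight_le (v v' b : V) :
    ((1 + ‖v‖) ^ 3)⁻¹ * (crossSq (v - v') b * auxWeight v') ≤ phiForm (v - v') b b * mu v' := by
  rw [phiForm_self, auxWeight]
  have hc := crossSq_nonneg (v - v') b
  have hmu := mu_pos v'
  rcases eq_or_ne (v - v') 0 with h | h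
  · simp [h, crossSq]
  have hz : 0 < ‖v - v'‖ := norm_pos_iff.2 h
  have hle : ((1 + ‖v‖) ^ 3)⁻¹ * ((1 + ‖v'‖) ^ 3)⁻¹ ≤ (‖v - v'‖⁻¹) ^ 3 := by
    rw [← mul_inv, ← mul_pow, inv_pow]
    gcongr
    have := norm_sub_le v v'
    nlinarith [norm_nonneg v, norm_nonneg v']
  calc _ = crossSq (v - v') b * (((1 + ‖v‖) ^ 3)⁻¹ * ((1 + ‖v'‖) ^ 3)⁻¹) * mu v' := by ring
    _ ≤ _ := by gcongr

lemma integrable_crossSq_sub_mul_auxWeight (v b : V) :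
    Integrable fun v' => crossSq (v - v') b * auxWeight v' := by
  refine ((integrable_phiForm_mul_mu v b).const_mul ((1 + ‖v‖) ^ 3)).mono' ?_
    (ae_of_all _ fun v' => ?_)
  · exact ((continuous_crossSq.comp (by fun_prop : Continuous fun v' : V => (v - v', b))).mul
      continuous_auxWeight).aestronglyMeasurable
  · have h := crossSq_mul_auxWeight_le v v' b
    rw [inv_mul_le_iff₀ (by positivity)] at h
    rwa [Real.norm_of_nonneg (mul_nonneg (crossSq_nonneg _ _) (auxWeight_pos _).le)]

lemma integrable_crossSq_mul_auxWeight (b : V) :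
    Integrable fun v' => crossSq v' b * auxWeight v' := by
  convert integrable_crossSq_sub_mul_auxWeight 0 b using 3 with v'
  simp [crossSq]

lemma integrable_auxWeight : Integrable auxWeight := by
  refine (integrable_majorant 0).mono' continuous_auxWeight.aestronglyMeasurable
    (ae_of_all _ fun v => ?_)
  rw [Real.norm_of_nonneg (auxWeight_pos _).le, auxWeight, majorant]
  have h1 : 1 ≤ (1 + ‖v‖) ^ 5 := one_le_pow₀ (by linarith [norm_nonneg v])
  have h2 : 1 ≤ (1 + ‖0 - v‖⁻¹) ^ 2 := one_le_pow₀ (by linarith [inv_nonneg.2 (norm_nonneg (0 - v))])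
  have h3 : ((1 + ‖v‖) ^ 3)⁻¹ ≤ 1 :=
    inv_le_one_of_one_le₀ (one_le_pow₀ (by linarith [norm_nonneg v]))
  have := sqrtMu_pos v
  have := mu_pos v
  calc _ ≤ 1 * sqrtMu v := by gcongr; exact mu_le_sqrtMu v
    _ ≤ 1 * (1 * sqrtMu v) := by simp
    _ ≤ _ := by gcongr

/-- The weight is even, so the integrals with `v - v'` and `v + v'` agree; their sum is evaluated by
the parallelogram law. -/
lemma integral_crossSq_sub (v b : V) : ∫ v', crossSq (v - v') b * auxWeight v' =
    crossSq v b * (∫ v', auxWeight v') + ∫ v', crossSq v' b * auxWeight v' := by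
  have hneg : ∀ v', auxWeight (-v') = auxWeight v' := fun v' => by simp [auxWeight, mu]
  have h1 : ∫ v', crossSq (v + v') b * auxWeight v' = ∫ v', crossSq (v - v') b * auxWeight v' := by
    rw [← integral_neg_eq_self (fun v' => crossSq (v + v') b * auxWeight v')]
    simp only [hneg, sub_eq_add_neg]
  have h2 : Integrable fun v' => crossSq (v + v') b * auxWeight v' := by
    have := (integrable_crossSq_sub_mul_auxWeight v b).comp_neg
    simpa only [hneg, sub_neg_eq_add] using this
  have h3 : ∫ v', (crossSq (v - v') b * auxWeight v' + crossSq (v + v') b * auxWeight v') =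
      ∫ v', (2 * crossSq v b * auxWeight v' + 2 * (crossSq v' b * auxWeight v')) := by
    congr 1 with v'
    rw [← add_mul, crossSq_sub_add]; ring
  rw [integral_add (integrable_crossSq_sub_mul_auxWeight v b) h2, h1,
    integral_add (integrable_auxWeight.const_mul _)
      ((integrable_crossSq_mul_auxWeight b).const_mul _),
    integral_const_mul, integral_const_mul] at h3
  linear_combination h3 / 2

/-- The weight is rotation invariant, and a reflection carries `b` to a multiple of the first basis
vector, so the dependence on `b` is through `‖b‖²` only. -/
lemma integral_crossSq_eq (b : V) : ∫ v', crossSq v' b * auxWeight v' =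
    ‖b‖ ^ 2 * ∫ v', crossSq v' (EuclideanSpace.single 0 (1 : ℝ)) * auxWeight v' := by
  set e : V := EuclideanSpace.single 0 (1 : ℝ)
  have hn : ‖b‖ = ‖‖b‖ • e‖ := by simp [e, norm_smul]
  set R := (Submodule.span ℝ {b - ‖b‖ • e})ᗮ.reflection
  have hR : R b = ‖b‖ • e := Submodule.reflection_sub hn
  have hmp := R.measurePreserving
  rw [← integral_const_mul,
    ← hmp.integral_comp R.toHomeomorph.measurableEmbedding
      (fun v' => ‖b‖ ^ 2 * (crossSq v' e * auxWeight v'))]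
  congr 1 with v'
  have h1 : crossSq (R v') (R b) = crossSq v' b := by
    simp only [crossSq, LinearIsometryEquiv.norm_map, LinearIsometryEquiv.inner_map_map]
  have h2 : auxWeight (R v') = auxWeight v' := by
    simp only [auxWeight, mu, LinearIsometryEquiv.norm_map]
  rw [h2, ← mul_assoc, ← crossSq_smul_right, ← hR, h1]

lemma integral_pos_of_continuous {f : V → ℝ} (hf : Continuous f) (hfi : Integrable f)
    (h0 : ∀ v, 0 ≤ f v) (a : V) (ha : f a ≠ 0) : 0 < ∫ v, f v := by
  rw [integral_pos_iff_support_of_nonneg h0 hfi]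
  exact hf.isOpen_support.measure_pos _ ⟨a, ha⟩

/-- The matrix `σ = φ * μ` dominates the model quadratic form. -/
lemma exists_modelForm_le : ∃ c : ℝ, 0 < c ∧ ∀ v b : V,
    c * modelForm v b ≤ ∑ i, ∑ j, sigmaConv i j mu v * b i * b j := by
  set A := ∫ v, auxWeight v
  set B := ∫ v', crossSq v' (EuclideanSpace.single 0 (1 : ℝ)) * auxWeight v'
  have hA : 0 < A := integral_pos_of_continuous continuous_auxWeight integrable_auxWeight
    (fun v => (auxWeight_pos v).le) 0 (auxWeight_pos 0).ne'
  have hB : 0 < B := by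
    refine integral_pos_of_continuous ?_ (integrable_crossSq_mul_auxWeight _)
      (fun v => mul_nonneg (crossSq_nonneg _ _) (auxWeight_pos v).le) (EuclideanSpace.single 1 (1 : ℝ) : V)
      (mul_ne_zero ?_ (auxWeight_pos _).ne')
    · exact (continuous_crossSq.comp
        (by fun_prop : Continuous fun v' : V => (v', (EuclideanSpace.single 0 (1 : ℝ) : V)))).mul
          continuous_auxWeight
    · simp [crossSq, inner_eq_sum]
  refine ⟨min A B, lt_min hA hB, fun v b => ?_⟩
  have hQ := crossSq_nonneg v b
  rw [sum_sigmaConv_mu]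
  calc min A B * modelForm v b = ((1 + ‖v‖) ^ 3)⁻¹ * (crossSq v b * min A B + ‖b‖ ^ 2 * min A B) := by
        rw [modelForm]; ring
    _ ≤ ((1 + ‖v‖) ^ 3)⁻¹ * (crossSq v b * A + ‖b‖ ^ 2 * B) := by
        gcongr
        · exact min_le_left _ _
        · exact min_le_right _ _
    _ = ∫ v', ((1 + ‖v‖) ^ 3)⁻¹ * (crossSq (v - v') b * auxWeight v') := by
        rw [integral_const_mul, integral_crossSq_sub, integral_crossSq_eq]
    _ ≤ _ := integral_mono ((integrable_crossSq_sub_mul_auxWeight v b).const_mul _)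
        (integrable_phiForm_mul_mu v b) fun v' => crossSq_mul_auxWeight_le v v' b

/-- The zero-order part of `sigmaDensity` is the form of `σ` at `b = v`, and `v × v = 0`. The
resulting factor `|v|²` degenerates at the origin; this is the only gap to `modelDensity`. -/
lemma exists_le_sigmaDensity : ∃ c : ℝ, 0 < c ∧ ∀ (v : V) (a : ℝ) (b : V),
    c * (modelForm v b + ((1 + ‖v‖) ^ 3)⁻¹ * ‖v‖ ^ 2 * a ^ 2) ≤ sigmaDensity v a b := by
  obtain ⟨c, hc, h⟩ := exists_modelForm_le
  refine ⟨c, hc, fun v a b => ?_⟩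
  have h1 := h v b
  have h2 := mul_le_mul_of_nonneg_right (h v v) (sq_nonneg a)
  rw [modelForm, crossSq_self, add_zero] at h2
  have h3 : sigmaDensity v a b = (∑ i, ∑ j, sigmaConv i j mu v * b i * b j) +
      (∑ i, ∑ j, sigmaConv i j mu v * v i * v j) * a ^ 2 := by
    simp only [sigmaDensity, Finset.sum_add_distrib, Finset.sum_mul]
  rw [h3]
  linarith

/-! ### Mollification of weakly differentiable functions. -/

/-- A sequence of bump functions shrinking to the origin. -/
def shrinkingBump (n : ℕ) : ContDiffBump (0 : V) where
  -- The ratio of the radii is always `2`, which the almost everywhere convergence of mollifications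
  -- requires; the outer radius never exceeds `1/2`.
  rIn := 1 / (2 * (n + 2))
  rOut := 1 / (n + 2)
  rIn_pos := by positivity
  rIn_lt_rOut := by
    apply one_div_lt_one_div_of_lt <;> linarith [Nat.cast_nonneg (α := ℝ) n]

/-- The associated mollifier. -/
def mollifier (n : ℕ) : V → ℝ := (shrinkingBump n).normed volume

open scoped Convolution in
/-- Mollification. -/
def mollify (n : ℕ) (f : V → ℝ) : V → ℝ := mollifier n ⋆[ContinuousLinearMap.lsmul ℝ ℝ, volume] f

lemma mollify_apply (n : ℕ) (f : V → ℝ) (x : V) :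
    mollify n f x = ∫ t, mollifier n t * f (x - t) := rfl

lemma mollify_apply_swap (n : ℕ) (f : V → ℝ) (x : V) :
    mollify n f x = ∫ t, mollifier n (x - t) * f t := by
  rw [mollify, convolution_eq_swap]; rfl

lemma tendsto_shrinkingBump : Filter.Tendsto (fun n => (shrinkingBump n).rOut) Filter.atTop (nhds 0) := by
  have : Filter.Tendsto (fun n : ℕ => ((n : ℝ) + 2)) Filter.atTop Filter.atTop :=
    Filter.tendsto_atTop_add_const_right _ _ tendsto_natCast_atTop_atTop
  simp only [shrinkingBump, one_div]
  exact this.inv_tendsto_atTop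

lemma shrinkingBump_rOut_le (n : ℕ) : (shrinkingBump n).rOut ≤ 1 / 2 := by
  simp only [shrinkingBump]
  apply one_div_le_one_div_of_le <;> linarith [Nat.cast_nonneg (α := ℝ) n]

lemma mollifier_nonneg (n : ℕ) (x : V) : 0 ≤ mollifier n x := (shrinkingBump n).nonneg_normed x

lemma contDiff_mollifier (n : ℕ) : ContDiff ℝ ∞ (mollifier n) := (shrinkingBump n).contDiff_normed

lemma integral_mollifier (n : ℕ) : ∫ x, mollifier n x = 1 := (shrinkingBump n).integral_normed

lemma integrable_mollifier (n : ℕ) : Integrable (mollifier n) := (shrinkingBump n).integrable_normed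

lemma hasCompactSupport_mollifier (n : ℕ) : HasCompactSupport (mollifier n) :=
  (shrinkingBump n).hasCompactSupport_normed

lemma mollifier_eq_zero (n : ℕ) {x : V} (hx : 1 / 2 ≤ ‖x‖) : mollifier n x = 0 := by
  by_contra h
  have h2 : x ∈ Function.support (mollifier n) := h
  rw [mollifier, ContDiffBump.support_normed_eq, Metric.mem_ball, dist_zero_right] at h2
  linarith [shrinkingBump_rOut_le n]

lemma contDiff_mollify (n : ℕ) {f : V → ℝ} (hf : LocallyIntegrable f) :
    ContDiff ℝ ∞ (mollify n f) :=
  (hasCompactSupport_mollifier n).contDiff_convolution_left _ (contDiff_mollifier n) hf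

lemma pd_mollify (n : ℕ) (i : Fin 3) {f : V → ℝ} (hf : ContDiff ℝ 1 f) (hc : HasCompactSupport f) :
    pd i (mollify n f) = mollify n (pd i f) := by
  ext x
  have h := hc.hasFDerivAt_convolution_right (ContinuousLinearMap.lsmul ℝ ℝ)
    ((contDiff_mollifier n).continuous.locallyIntegrable (μ := volume)) hf x
  rw [pd, mollify, h.fderiv, mollify_apply, convolution]
  rw [ContinuousLinearMap.integral_apply]
  · rfl
  · exact ((hc.fderiv ℝ).convolutionExists_right _
      (contDiff_mollifier n).continuous.locallyIntegrable (hf.continuous_fderiv one_ne_zero)) x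

lemma abs_mollify_le (n : ℕ) {f : V → ℝ} {M : ℝ} (hf : ∀ v, |f v| ≤ M) (x : V) :
    |mollify n f x| ≤ M := by
  rw [mollify_apply, ← Real.norm_eq_abs]
  refine (norm_integral_le_of_norm_le ((integrable_mollifier n).mul_const M)
    (ae_of_all _ fun t => ?_)).trans_eq ?_
  · rw [norm_mul, Real.norm_of_nonneg (mollifier_nonneg n t)]
    exact mul_le_mul_of_nonneg_left (hf _) (mollifier_nonneg n t)
  · rw [integral_mul_const, integral_mollifier, one_mul]

lemma mollify_eq_zero (n : ℕ) {f : V → ℝ} {R : ℝ} (hf : ∀ v, R ≤ ‖v‖ → f v = 0) {x : V}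
    (hx : R + 1 ≤ ‖x‖) : mollify n f x = 0 := by
  rw [mollify_apply]
  apply integral_eq_zero_of_ae
  refine ae_of_all _ fun t => ?_
  rcases le_or_gt (1 / 2) ‖t‖ with h | h
  · simp [mollifier_eq_zero n h]
  · have := norm_sub_norm_le x t
    simp [hf (x - t) (by linarith)]

lemma tendsto_mollify {f : V → ℝ} (hf : Continuous f) (x : V) :
    Filter.Tendsto (fun n => mollify n f x) Filter.atTop (nhds (f x)) :=
  ContDiffBump.convolution_tendsto_right_of_continuous tendsto_shrinkingBump hf x

lemma ae_tendsto_mollify {f : V → ℝ} (hf : LocallyIntegrable f) :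
    ∀ᵐ x, Filter.Tendsto (fun n => mollify n f x) Filter.atTop (nhds (f x)) := by
  refine ContDiffBump.ae_convolution_tendsto_right_of_locallyIntegrable (K := 2)
    tendsto_shrinkingBump (Filter.Eventually.of_forall fun n => ?_) hf
  simp only [shrinkingBump]
  apply le_of_eq
  field_simp

lemma exists_bound_of_hasCompactSupport {f : V → ℝ} (hf : Continuous f) (hc : HasCompactSupport f) :
    ∃ M R : ℝ, 0 ≤ M ∧ (∀ v, |f v| ≤ M) ∧ ∀ v, R ≤ ‖v‖ → f v = 0 := by
  obtain ⟨M, hM⟩ := hf.bounded_above_of_compact_support hc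
  obtain ⟨R, -, hR⟩ := hc.exists_pos_le_norm
  exact ⟨M, R, (norm_nonneg _).trans (hM 0), hM, hR⟩

lemma hasCompactSupport_of_eq_zero {f : V → ℝ} {R : ℝ} (hf : ∀ v, R ≤ ‖v‖ → f v = 0) :
    HasCompactSupport f := by
  refine HasCompactSupport.intro (isCompact_closedBall (0 : V) R) fun x hx => hf x ?_
  simp only [Metric.mem_closedBall, dist_zero_right, not_le] at hx
  exact hx.le

lemma tendsto_integral_mul_mollify {g f : V → ℝ} (hg : LocallyIntegrable g) (hf : Continuous f)
    (hc : HasCompactSupport f) :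
    Filter.Tendsto (fun n => ∫ v, g v * mollify n f v) Filter.atTop (nhds (∫ v, g v * f v)) := by
  obtain ⟨M, R, hM0, hM, hR⟩ := exists_bound_of_hasCompactSupport hf hc
  have hgi : Integrable ((Metric.closedBall (0 : V) (R + 1)).indicator fun v => |g v| * M) := by
    rw [integrable_indicator_iff Metric.isClosed_closedBall.measurableSet]
    exact ((hg.integrableOn_isCompact (isCompact_closedBall _ _)).abs).mul_const M
  refine tendsto_integral_of_dominated_convergence _ (fun n => ?_) hgi (fun n => ae_of_all _ fun v => ?_)
    (ae_of_all _ fun v => (tendsto_mollify hf v).const_mul _)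
  · exact hg.aestronglyMeasurable.mul
      (contDiff_mollify n hf.locallyIntegrable).continuous.aestronglyMeasurable
  · by_cases hv : v ∈ Metric.closedBall (0 : V) (R + 1)
    · rw [Set.indicator_of_mem hv, norm_mul, Real.norm_eq_abs]
      exact mul_le_mul_of_nonneg_left (abs_mollify_le n hM v) (abs_nonneg _)
    · rw [Set.indicator_of_notMem hv, mollify_eq_zero n hR, mul_zero, norm_zero]
      simpa using (lt_of_not_ge fun h => hv (by simpa using h)).le

lemma continuous_pd (i : Fin 3) {f : V → ℝ} (hf : ContDiff ℝ 1 f) : Continuous (pd i f) :=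
  (hf.continuous_fderiv one_ne_zero).clm_apply continuous_const

lemma hasCompactSupport_pd (i : Fin 3) {f : V → ℝ} (hc : HasCompactSupport f) :
    HasCompactSupport (pd i f) := hc.fderiv_apply ℝ _

lemma locallyIntegrable_coord {G : V → V} (hG : LocallyIntegrable G) (i : Fin 3) :
    LocallyIntegrable fun v => G v i := by
  intro x
  obtain ⟨s, hs, h⟩ := hG x
  exact ⟨s, hs, (EuclideanSpace.proj (𝕜 := ℝ) i).integrable_comp h⟩

/-- Weak gradients may be tested against `C¹` functions. -/
lemma HasWeakGradient.integral_mul_pd {g : V → ℝ} {G : V → V} (h : HasWeakGradient g G)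
    {η : V → ℝ} (hη : ContDiff ℝ 1 η) (hc : HasCompactSupport η) (i : Fin 3) :
    ∫ v, g v * pd i η v = -∫ v, G v i * η v := by
  have h1 := tendsto_integral_mul_mollify h.1 (continuous_pd i hη) (hasCompactSupport_pd i hc)
  have h2 := (tendsto_integral_mul_mollify (locallyIntegrable_coord h.2.1 i) hη.continuous hc).neg
  refine tendsto_nhds_unique (h1.congr fun n => ?_) h2
  rw [← pd_mollify n i hη hc]
  obtain ⟨M, R, -, -, hR⟩ := exists_bound_of_hasCompactSupport hη.continuous hc
  exact h.2.2 _ (contDiff_mollify n hη.continuous.locallyIntegrable)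
    (hasCompactSupport_of_eq_zero fun v hv => mollify_eq_zero n hR hv) i

lemma pd_comp_sub (i : Fin 3) (f : V → ℝ) (hf : Differentiable ℝ f) (x t : V) :
    pd i (fun t => f (x - t)) t = -pd i f (x - t) := by
  have h : HasFDerivAt (fun t => f (x - t)) ((fderiv ℝ f (x - t)).comp (-ContinuousLinearMap.id ℝ V)) t :=
    (hf (x - t)).hasFDerivAt.comp t ((hasFDerivAt_id t).const_sub x)
  simp [pd, h.fderiv]

/-- Mollification commutes with weak differentiation. -/
lemma HasWeakGradient.pd_mollify {g : V → ℝ} {G : V → V} (h : HasWeakGradient g G) (n : ℕ)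
    (i : Fin 3) : pd i (mollify n g) = mollify n (fun v => G v i) := by
  ext x
  have hd := (hasCompactSupport_mollifier n).hasFDerivAt_convolution_left
    (ContinuousLinearMap.lsmul ℝ ℝ) ((contDiff_mollifier n).of_le (by simp)) h.1 x
  have hdiff : Differentiable ℝ (mollifier n) := (contDiff_mollifier n).differentiable (by simp)
  rw [pd, mollify, hd.fderiv, mollify_apply_swap, convolution_eq_swap,
    ContinuousLinearMap.integral_apply]
  · have h2 := h.2.2 (fun t => mollifier n (x - t)) ((contDiff_mollifier n).comp (by fun_prop))
      ((hasCompactSupport_mollifier n).comp_homeomorph (Homeomorph.subLeft x)) i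
    simp only [pd_comp_sub i _ hdiff, mul_neg, integral_neg, neg_inj] at h2
    rw [← integral_congr_ae (ae_of_all _ fun t => mul_comm (G t i) (mollifier n (x - t))), ← h2]
    refine integral_congr_ae (ae_of_all _ fun t => ?_)
    simp [pd, mul_comm, ContinuousLinearMap.precompL_apply]
  · exact (((hasCompactSupport_mollifier n).fderiv ℝ).convolutionExists_left _
      ((contDiff_mollifier n).continuous_fderiv (by simp)) h.1 x).integrable_swap

lemma lintegral_mollifier (n : ℕ) : ∫⁻ x, ENNReal.ofReal (mollifier n x) = 1 := by
  rw [← ofReal_integral_eq_lintegral_ofReal (integrable_mollifier n)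
    (ae_of_all _ (mollifier_nonneg n)), integral_mollifier, ENNReal.ofReal_one]

/-- Cauchy–Schwarz with respect to the probability density `mollifier n`. -/
lemma enorm_mollify_sq_le (n : ℕ) {f : V → ℝ} (hf : LocallyIntegrable f) (x : V) :
    ‖mollify n f x‖ₑ ^ 2 ≤ ∫⁻ t, ENNReal.ofReal (mollifier n t) * ‖f (x - t)‖ₑ ^ 2 := by
  have hm : Measurable fun v' => ENNReal.ofReal (mollifier n v') :=
    (contDiff_mollifier n).continuous.measurable.ennreal_ofReal
  have hfm : AEMeasurable fun t => ‖f (x - t)‖ₑ :=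
    (hf.aestronglyMeasurable.comp_quasiMeasurePreserving
      (quasiMeasurePreserving_sub_left volume x)).enorm
  have h := ENNReal.lintegral_mul_le_Lp_mul_Lq volume Real.HolderConjugate.two_two
    (f := fun v' => ENNReal.ofReal (mollifier n v') ^ (1 / 2 : ℝ))
    (g := fun v' => ENNReal.ofReal (mollifier n v') ^ (1 / 2 : ℝ) * ‖f (x - v')‖ₑ)
    (hm.pow_const _).aemeasurable ((hm.pow_const _).aemeasurable.mul hfm)
  have h1 : ∀ x : ℝ≥0∞, (x ^ (1 / 2 : ℝ)) ^ (2 : ℝ) = x := fun x => by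
    rw [← ENNReal.rpow_mul]; norm_num
  have h1' : ∀ x : ℝ≥0∞, (x ^ (1 / 2 : ℝ)) ^ 2 = x := fun x => by
    rw [← ENNReal.rpow_two, h1]
  have h2 : ∀ x : ℝ≥0∞, x ^ (1 / 2 : ℝ) * x ^ (1 / 2 : ℝ) = x := fun x => by
    rw [← sq, h1']
  simp only [Pi.mul_apply, ← mul_assoc, h2, h1, ENNReal.mul_rpow_of_nonneg _ _ zero_le_two,
    lintegral_mollifier, ENNReal.one_rpow, one_mul] at h
  have h3 : ‖mollify n f x‖ₑ ≤ ∫⁻ t, ENNReal.ofReal (mollifier n t) * ‖f (x - t)‖ₑ := by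
    rw [mollify_apply]
    refine (enorm_integral_le_lintegral_enorm _).trans_eq (lintegral_congr fun t => ?_)
    rw [enorm_mul, Real.enorm_of_nonneg (mollifier_nonneg n t)]
  calc _ ≤ _ := pow_le_pow_left' (h3.trans h) 2
    _ = _ := by rw [h1']; simp only [ENNReal.rpow_two]

/-- Jensen's inequality for mollifications. -/
lemma lintegral_mollify_sq_le (n : ℕ) {f : V → ℝ} (hf : LocallyIntegrable f) {S T : Set V}
    (hS : MeasurableSet S) (hT : MeasurableSet T)
    (hST : ∀ x ∈ S, ∀ t : V, ‖t‖ < 1 / 2 → x - t ∈ T) :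
    ∫⁻ x in S, ‖mollify n f x‖ₑ ^ 2 ≤ ∫⁻ x in T, ‖f x‖ₑ ^ 2 := by
  have hfe : AEMeasurable (fun t => ‖f t‖ₑ ^ 2) := hf.aestronglyMeasurable.enorm.pow_const 2
  have hm : Measurable fun v' => ENNReal.ofReal (mollifier n v') :=
    (contDiff_mollifier n).continuous.measurable.ennreal_ofReal
  calc ∫⁻ x in S, ‖mollify n f x‖ₑ ^ 2
      ≤ ∫⁻ x in S, ∫⁻ t, ENNReal.ofReal (mollifier n t) * ‖f (x - t)‖ₑ ^ 2 :=
        lintegral_mono fun x => enorm_mollify_sq_le n hf x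
    _ = ∫⁻ t, ∫⁻ x in S, ENNReal.ofReal (mollifier n t) * ‖f (x - t)‖ₑ ^ 2 := by
        apply lintegral_lintegral_swap
        have h1 : AEMeasurable (fun p : V × V => ‖f (p.1 - p.2)‖ₑ ^ 2) (volume.prod volume) :=
          hfe.comp_quasiMeasurePreserving (quasiMeasurePreserving_sub volume volume)
        exact (((hm.comp measurable_snd).aemeasurable.mul h1).mono_ac
          (Measure.AbsolutelyContinuous.prod Measure.restrict_le_self.absolutelyContinuous
            (Measure.AbsolutelyContinuous.refl _)))
    _ ≤ ∫⁻ t, ENNReal.ofReal (mollifier n t) * ∫⁻ x in T, ‖f x‖ₑ ^ 2 := by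
        refine lintegral_mono fun t => ?_
        simp only
        rw [lintegral_const_mul' _ _ ENNReal.ofReal_ne_top]
        rcases le_or_gt (1 / 2) ‖t‖ with h | h
        · simp [mollifier_eq_zero n h]
        · refine mul_le_mul' le_rfl ?_
          rw [← lintegral_indicator hS, ← lintegral_indicator hT,
            ← lintegral_sub_right_eq_self (T.indicator fun x => ‖f x‖ₑ ^ 2) t]
          refine lintegral_mono fun x => ?_
          by_cases hx : x ∈ S
          · rw [Set.indicator_of_mem hx, Set.indicator_of_mem (hST x hx t h)]
          · rw [Set.indicator_of_notMem hx]; exact zero_le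
    _ = _ := by rw [lintegral_mul_const _ hm, lintegral_mollifier, one_mul]

/-! ### Control of the `L²` norm near the origin. -/

lemma integral_pd_eq_zero {f : V → ℝ} (hf : ContDiff ℝ 1 f) (hc : HasCompactSupport f) (i : Fin 3) :
    ∫ v, pd i f v = 0 := by
  have h := integral_mul_fderiv_eq_neg_fderiv_mul_of_integrable (μ := (volume : Measure V))
    (f := fun _ => (1 : ℝ)) (g := f) (v := EuclideanSpace.single i 1) (by simp) ?_ ?_
    (fun x _ => differentiableAt_const _) (fun x _ => hf.differentiable one_ne_zero x)
  · simpa [pd] using h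
  · simp only [one_mul]
    exact (continuous_pd i hf).integrable_of_hasCompactSupport (hasCompactSupport_pd i hc)
  · simp only [one_mul]
    exact hf.continuous.integrable_of_hasCompactSupport hc

lemma pd_mul {f g : V → ℝ} {v : V} (hf : DifferentiableAt ℝ f v) (hg : DifferentiableAt ℝ g v)
    (i : Fin 3) : pd i (fun v => f v * g v) v = f v * pd i g v + pd i f v * g v := by
  simp only [pd]
  rw [fderiv_fun_mul hf hg]
  simp [mul_comm]

lemma pd_coord (i j : Fin 3) (v : V) : pd i (fun v => v j) v = if i = j then 1 else 0 := by
  have : HasFDerivAt (fun v : V => v j) (EuclideanSpace.proj (𝕜 := ℝ) j) v :=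
    (EuclideanSpace.proj (𝕜 := ℝ) j).hasFDerivAt
  rw [pd, this.fderiv]
  simp [eq_comm]

/-- A fixed cutoff, equal to one on the unit ball and vanishing outside the ball of radius two. -/
def cutoff : ContDiffBump (0 : V) := ⟨1, 2, one_pos, one_lt_two⟩

lemma contDiff_cutoff : ContDiff ℝ ∞ (cutoff : V → ℝ) := cutoff.contDiff

lemma cutoff_eq_one {v : V} (hv : ‖v‖ ≤ 1) : cutoff v = 1 :=
  cutoff.one_of_mem_closedBall (by simpa [cutoff] using hv)

lemma cutoff_eq_zero {v : V} (hv : 2 ≤ ‖v‖) : cutoff v = 0 :=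
  cutoff.zero_of_le_dist (by simpa [cutoff] using hv)

lemma pd_cutoff_eq_zero_of_lt {v : V} (hv : ‖v‖ < 1) (i : Fin 3) : pd i cutoff v = 0 := by
  have : (cutoff : V → ℝ) =ᶠ[nhds v] fun _ => 1 := by
    filter_upwards [Metric.isOpen_ball.mem_nhds (by simpa using hv : v ∈ Metric.ball (0 : V) 1)]
      with x hx
    exact cutoff_eq_one (mem_ball_zero_iff.1 hx).le
  rw [pd, this.fderiv_eq]; simp

lemma pd_cutoff_eq_zero_of_gt {v : V} (hv : 2 < ‖v‖) (i : Fin 3) : pd i cutoff v = 0 := by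
  have : (cutoff : V → ℝ) =ᶠ[nhds v] fun _ => 0 := by
    filter_upwards [(isOpen_lt continuous_const continuous_norm).mem_nhds hv] with x hx
    exact cutoff_eq_zero (le_of_lt hx)
  rw [pd, this.fderiv_eq]; simp

lemma exists_abs_sum_mul_pd_cutoff_le :
    ∃ M : ℝ, 0 ≤ M ∧ ∀ v : V, |∑ i, v i * pd i cutoff v| ≤ M := by
  have hc : Continuous fun v : V => ∑ i, v i * pd i cutoff v :=
    continuous_finsetSum _ fun i _ => (by fun_prop : Continuous fun v : V => v i).mul
      (continuous_pd i (contDiff_cutoff.of_le (by simp)))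
  obtain ⟨M, R, h0, hM, -⟩ := exists_bound_of_hasCompactSupport hc
    (hasCompactSupport_of_eq_zero (R := 3) fun v hv => Finset.sum_eq_zero fun i _ => by
      rw [pd_cutoff_eq_zero_of_gt (by linarith), mul_zero])
  exact ⟨M, h0, hM⟩

lemma sum_mul_sq_le (v p : Fin 3 → ℝ) : (∑ i, v i * p i) ^ 2 ≤ (∑ i, v i ^ 2) * ∑ i, p i ^ 2 :=
  Finset.sum_mul_sq_le_sq_mul_sq _ _ _

/-- The energy inequality behind the control of the `L²` norm near the origin. -/
lemma exists_integral_cutoff_mul_sq_le : ∃ M : ℝ, 0 ≤ M ∧ ∀ f : V → ℝ, ContDiff ℝ 1 f →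
    ∫ v, cutoff v * f v ^ 2 ≤ ∫ v, (4 * (Metric.ball (0 : V) 2).indicator (fun v => ∑ i, pd i f v ^ 2) v
      + M * (Metric.closedBall (0 : V) 2 \ Metric.ball 0 1).indicator (fun v => f v ^ 2) v) := by
  obtain ⟨M, hM0, hM⟩ := exists_abs_sum_mul_pd_cutoff_le
  refine ⟨M, hM0, fun f hf => ?_⟩
  have hχ : ContDiff ℝ 1 (cutoff : V → ℝ) := contDiff_cutoff.of_le (by simp)
  have hco : ∀ i : Fin 3, ContDiff ℝ 1 fun v : V => v i := fun i => by fun_prop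
  -- The field `v χ f²` has divergence `3χf² + (v·∇χ)f² + 2χf (v·∇f)`, whose integral is zero. The
  -- good term `3χf²` comes from the divergence of `v` in dimension three.
  have hF : ∀ i : Fin 3, ContDiff ℝ 1 fun v : V => v i * (cutoff v * (f v * f v)) := fun i =>
    (hco i).mul (hχ.mul (hf.mul hf))
  have hFc : ∀ i : Fin 3, HasCompactSupport fun v : V => v i * (cutoff v * (f v * f v)) := fun i =>
    hasCompactSupport_of_eq_zero (R := 2) fun v hv => by simp [cutoff_eq_zero hv]
  have hpd : ∀ i v, pd i (fun v : V => v i * (cutoff v * (f v * f v))) v =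
      cutoff v * f v ^ 2 + v i * pd i cutoff v * f v ^ 2 +
        2 * (cutoff v * f v * (v i * pd i f v)) := by
    intro i v
    have hdχ := hχ.differentiable one_ne_zero v
    have hdf := hf.differentiable one_ne_zero v
    rw [pd_mul ((hco i).differentiable one_ne_zero v) (hdχ.fun_mul (hdf.fun_mul hdf)),
      pd_mul hdχ (hdf.fun_mul hdf), pd_mul hdf hdf, pd_coord]
    simp
    ring
  have h0 : ∫ v, ∑ i, pd i (fun v : V => v i * (cutoff v * (f v * f v))) v = 0 := by
    rw [integral_finsetSum _ fun i _ => (continuous_pd i (hF i)).integrable_of_hasCompactSupport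
      (hasCompactSupport_pd i (hFc i))]
    exact Finset.sum_eq_zero fun i _ => integral_pd_eq_zero (hF i) (hFc i) i
  have hI0 : Integrable fun v => cutoff v * f v ^ 2 :=
    (hχ.continuous.mul (hf.continuous.pow 2)).integrable_of_hasCompactSupport
      (hasCompactSupport_of_eq_zero (R := 2) fun v hv => by simp [cutoff_eq_zero hv])
  have hI1 : Integrable fun v => ∑ i, pd i (fun v : V => v i * (cutoff v * (f v * f v))) v :=
    integrable_finsetSum _ fun i _ => (continuous_pd i (hF i)).integrable_of_hasCompactSupport
      (hasCompactSupport_pd i (hFc i))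
  have hI2 : Integrable fun v => 4 * (Metric.ball (0 : V) 2).indicator (fun v => ∑ i, pd i f v ^ 2) v
      + M * (Metric.closedBall (0 : V) 2 \ Metric.ball 0 1).indicator (fun v => f v ^ 2) v := by
    refine Integrable.add (Integrable.const_mul ?_ _) (Integrable.const_mul ?_ _)
    · rw [integrable_indicator_iff measurableSet_ball]
      refine (ContinuousOn.integrableOn_compact (isCompact_closedBall (0 : V) 2) ?_).mono_set
        Metric.ball_subset_closedBall
      exact (continuous_finsetSum _ fun i _ => (continuous_pd i hf).pow 2).continuousOn
    · rw [integrable_indicator_iff (measurableSet_closedBall.diff measurableSet_ball)]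
      refine (ContinuousOn.integrableOn_compact (isCompact_closedBall (0 : V) 2) ?_).mono_set
        Set.sdiff_subset
      exact (hf.continuous.pow 2).continuousOn
  have key : ∫ v, (cutoff v * f v ^ 2 - ∑ i, pd i (fun v : V => v i * (cutoff v * (f v * f v))) v)
      = ∫ v, cutoff v * f v ^ 2 := by
    rw [integral_sub hI0 hI1, h0, sub_zero]
  rw [← key]
  refine integral_mono (hI0.sub hI1) hI2 fun v => ?_
  simp only [hpd, Finset.sum_add_distrib, ← Finset.mul_sum, ← Finset.sum_mul]
  have hχ0 : 0 ≤ cutoff v := cutoff.nonneg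
  have hχ1 : cutoff v ≤ 1 := cutoff.le_one
  have hcs := sum_mul_sq_le v (fun i => pd i f v)
  rw [← norm_sq_eq_sum] at hcs
  set T := ∑ i, v i * pd i f v
  set P := ∑ i, pd i f v ^ 2
  have hP : 0 ≤ P := Finset.sum_nonneg fun i _ => sq_nonneg _
  set X := ∑ i, v i * pd i cutoff v with hX
  -- The function `v·∇χ` is supported in the annulus where the cutoff varies, away from the origin.
  have e1 : -(X * f v ^ 2) ≤
      M * (Metric.closedBall (0 : V) 2 \ Metric.ball 0 1).indicator (fun v => f v ^ 2) v := by
    by_cases hv : v ∈ Metric.closedBall (0 : V) 2 \ Metric.ball 0 1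
    · rw [Set.indicator_of_mem hv]
      nlinarith [hM v, neg_abs_le X, sq_nonneg (f v)]
    · rw [Set.indicator_of_notMem hv]
      have : X = 0 := by
        simp only [Set.mem_sdiff, Metric.mem_closedBall, Metric.mem_ball, dist_zero_right, not_and,
          not_lt, not_le] at hv
        refine Finset.sum_eq_zero fun i _ => ?_
        rcases le_or_gt ‖v‖ 2 with h | h
        · rw [pd_cutoff_eq_zero_of_lt (not_le.1 fun h' => by have := hv h; linarith), mul_zero]
        · rw [pd_cutoff_eq_zero_of_gt h, mul_zero]
      simp [this]
  -- Of the three copies of `χf²`, one is the quantity to be bounded, one completes the square `(f +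
  -- T)²`, and one is discarded. The factor `4` is the bound of `|v|²` on the support of `χ`.
  have e2 : -(2 * (cutoff v * f v * T)) - 2 * (cutoff v * f v ^ 2) + cutoff v * f v ^ 2 ≤
      4 * (Metric.ball (0 : V) 2).indicator (fun v => ∑ i, pd i f v ^ 2) v := by
    by_cases hv : v ∈ Metric.ball (0 : V) 2
    · rw [Set.indicator_of_mem hv]
      have hv2 : ‖v‖ ^ 2 ≤ 4 := by
        have : ‖v‖ < 2 := by simpa using hv
        nlinarith [norm_nonneg v]
      have hT : T ^ 2 ≤ 4 * P := hcs.trans (by gcongr)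
      have : cutoff v * T ^ 2 ≤ 4 * P := by nlinarith [sq_nonneg T]
      nlinarith [mul_nonneg hχ0 (sq_nonneg (f v + T))]
    · rw [Set.indicator_of_notMem hv]
      have : cutoff v = 0 := cutoff_eq_zero (by simpa using hv)
      simp [this]
  simp only [Finset.sum_const, Finset.card_univ, Fintype.card_fin, nsmul_eq_mul] at *
  push_cast
  linarith [mul_nonneg hχ0 (sq_nonneg (f v))]

lemma exists_lintegral_ball_sq_le_of_contDiff : ∃ M : ℝ≥0, ∀ f : V → ℝ, ContDiff ℝ 1 f →
    ∫⁻ v in Metric.ball (0 : V) 1, ‖f v‖ₑ ^ 2 ≤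
      4 * (∑ i, ∫⁻ v in Metric.ball (0 : V) 2, ‖pd i f v‖ₑ ^ 2) +
      M * ∫⁻ v in Metric.closedBall (0 : V) 2 \ Metric.ball 0 1, ‖f v‖ₑ ^ 2 := by
  obtain ⟨M, hM0, hM⟩ := exists_integral_cutoff_mul_sq_le
  refine ⟨M.toNNReal, fun f hf => ?_⟩
  have hsq : ∀ x : ℝ, ‖x‖ₑ ^ 2 = ENNReal.ofReal (x ^ 2) := fun x => by
    rw [← sq_abs, ENNReal.ofReal_pow (abs_nonneg _), Real.enorm_eq_ofReal_abs]
  have hχ : Continuous (cutoff : V → ℝ) := contDiff_cutoff.continuous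
  have hpm : ∀ i, Measurable fun v => ENNReal.ofReal (pd i f v ^ 2) := fun i =>
    ((continuous_pd i hf).pow 2).measurable.ennreal_ofReal
  have hfm : Measurable fun v => ENNReal.ofReal (f v ^ 2) :=
    (hf.continuous.pow 2).measurable.ennreal_ofReal
  have hI0 : Integrable fun v => cutoff v * f v ^ 2 :=
    (hχ.mul (hf.continuous.pow 2)).integrable_of_hasCompactSupport
      (hasCompactSupport_of_eq_zero (R := 2) fun v hv => by simp [cutoff_eq_zero hv])
  calc ∫⁻ v in Metric.ball (0 : V) 1, ‖f v‖ₑ ^ 2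
      ≤ ∫⁻ v, ENNReal.ofReal (cutoff v * f v ^ 2) := by
        rw [← lintegral_indicator measurableSet_ball]
        refine lintegral_mono fun v => ?_
        by_cases hv : v ∈ Metric.ball (0 : V) 1
        · rw [Set.indicator_of_mem hv, cutoff_eq_one (by simpa using (Metric.mem_ball.1 hv).le),
            one_mul, hsq]
        · rw [Set.indicator_of_notMem hv]; exact zero_le
    _ = ENNReal.ofReal (∫ v, cutoff v * f v ^ 2) :=
        (ofReal_integral_eq_lintegral_ofReal hI0
          (ae_of_all _ fun v => mul_nonneg cutoff.nonneg (sq_nonneg _))).symm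
    _ ≤ ‖∫ v, (4 * (Metric.ball (0 : V) 2).indicator (fun v => ∑ i, pd i f v ^ 2) v
      + M * (Metric.closedBall (0 : V) 2 \ Metric.ball 0 1).indicator (fun v => f v ^ 2) v)‖ₑ := by
        rw [Real.enorm_eq_ofReal_abs]
        exact ENNReal.ofReal_le_ofReal ((hM f hf).trans (le_abs_self _))
    _ ≤ _ := enorm_integral_le_lintegral_enorm _
    _ ≤ ∫⁻ v, (4 * ∑ i, (Metric.ball (0 : V) 2).indicator (fun v => ENNReal.ofReal (pd i f v ^ 2)) v
      + M.toNNReal * (Metric.closedBall (0 : V) 2 \ Metric.ball 0 1).indicator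
          (fun v => ENNReal.ofReal (f v ^ 2)) v) := by
        refine lintegral_mono fun v => (enorm_add_le _ _).trans (add_le_add (le_of_eq ?_) (le_of_eq ?_))
        · by_cases hv : v ∈ Metric.ball (0 : V) 2
          · simp only [Set.indicator_of_mem hv]
            rw [Real.enorm_of_nonneg (by positivity), ENNReal.ofReal_mul (by norm_num),
              ENNReal.ofReal_sum_of_nonneg fun i _ => sq_nonneg _]
            simp
          · simp [Set.indicator_of_notMem hv]
        · by_cases hv : v ∈ Metric.closedBall (0 : V) 2 \ Metric.ball 0 1
          · simp only [Set.indicator_of_mem hv]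
            rw [Real.enorm_of_nonneg (by positivity), ENNReal.ofReal_mul hM0, ENNReal.ofReal]
          · simp [Set.indicator_of_notMem hv]
    _ = _ := by
        rw [lintegral_add_right _ ((hfm.indicator
          (measurableSet_closedBall.diff measurableSet_ball)).const_mul _),
          lintegral_const_mul _ (Finset.measurable_sum _ fun i _ =>
            (hpm i).indicator measurableSet_ball),
          lintegral_const_mul _ (hfm.indicator (measurableSet_closedBall.diff measurableSet_ball)),
          lintegral_finsetSum _ fun i _ => (hpm i).indicator measurableSet_ball,
          lintegral_indicator (measurableSet_closedBall.diff measurableSet_ball)]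
        simp only [lintegral_indicator measurableSet_ball, hsq]

lemma enorm_coord_le (x : V) (i : Fin 3) : ‖x i‖ₑ ≤ ‖x‖ₑ := by
  rw [enorm_le_iff_norm_le]; exact PiLp.norm_apply_le x i

/-- The `L²` norm near the origin of a weakly differentiable function is controlled by its gradient
and by its `L²` norm away from the origin. -/
lemma exists_lintegral_ball_sq_le : ∃ M : ℝ≥0, ∀ (g : V → ℝ) (G : V → V), HasWeakGradient g G →
    ∫⁻ v in Metric.ball (0 : V) 1, ‖g v‖ₑ ^ 2 ≤
      M * ((∫⁻ v in Metric.ball (0 : V) 3, ‖G v‖ₑ ^ 2) +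
        ∫⁻ v in Metric.ball (0 : V) 3 \ Metric.ball 0 (1 / 2), ‖g v‖ₑ ^ 2) := by
  obtain ⟨M, hM⟩ := exists_lintegral_ball_sq_le_of_contDiff
  -- The constant `12` is `4` times the number of partial derivatives, each bounded by the full
  -- gradient.
  refine ⟨max 12 M, fun g G h => ?_⟩
  set A := ∫⁻ v in Metric.ball (0 : V) 3, ‖G v‖ₑ ^ 2
  set B := ∫⁻ v in Metric.ball (0 : V) 3 \ Metric.ball 0 (1 / 2), ‖g v‖ₑ ^ 2
  -- Mollifying moves points by less than `1/2`, so the sets on the right are enlarged: the ball of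
  -- radius two into that of radius three, and the annulus inward only to radius `1/2`.
  have hn : ∀ n, ∫⁻ v in Metric.ball (0 : V) 1, ‖mollify n g v‖ₑ ^ 2 ≤ (max 12 M : ℝ≥0) * (A + B) := by
    intro n
    have h1 : ∀ i, ∫⁻ v in Metric.ball (0 : V) 2, ‖pd i (mollify n g) v‖ₑ ^ 2 ≤ A := by
      intro i
      rw [h.pd_mollify n i]
      refine (lintegral_mollify_sq_le n (locallyIntegrable_coord h.2.1 i) (T := Metric.ball (0 : V) 3)
        measurableSet_ball measurableSet_ball fun x hx t ht => ?_).trans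
        (lintegral_mono fun v => pow_le_pow_left' (enorm_coord_le _ _) 2)
      rw [mem_ball_zero_iff] at *
      linarith [norm_sub_le x t]
    have h2 : ∫⁻ v in Metric.closedBall (0 : V) 2 \ Metric.ball 0 1, ‖mollify n g v‖ₑ ^ 2 ≤ B := by
      refine lintegral_mollify_sq_le n h.1 (measurableSet_closedBall.diff measurableSet_ball)
        (measurableSet_ball.diff measurableSet_ball) fun x hx t ht => ?_
      simp only [Set.mem_sdiff, mem_closedBall_zero_iff, mem_ball_zero_iff, not_lt] at *
      exact ⟨by linarith [norm_sub_le x t], by linarith [norm_sub_norm_le x t]⟩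
    calc _ ≤ _ := hM _ ((contDiff_mollify n h.1).of_le (by simp))
      _ ≤ 4 * (∑ i : Fin 3, A) + M * B := by gcongr with i; exact h1 i
      _ = 12 * A + M * B := by simp; ring
      _ ≤ (max 12 M : ℝ≥0) * A + (max 12 M : ℝ≥0) * B := by
        gcongr
        · exact_mod_cast le_max_left 12 M
        · exact le_max_right _ _
      _ = _ := by ring
  calc ∫⁻ v in Metric.ball (0 : V) 1, ‖g v‖ₑ ^ 2
      ≤ ∫⁻ v in Metric.ball (0 : V) 1,
          Filter.liminf (fun n => ‖mollify n g v‖ₑ ^ 2) Filter.atTop := by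
        refine lintegral_mono_ae (ae_restrict_of_ae ((ae_tendsto_mollify h.1).mono fun v hv => ?_))
        exact ((ENNReal.continuous_pow 2).tendsto _ |>.comp hv.enorm).liminf_eq.ge
    -- Fatou's lemma passes the uniform bound for the mollifications to `g`, with no integrability
    -- of `g²` assumed.
    _ ≤ Filter.liminf (fun n => ∫⁻ v in Metric.ball (0 : V) 1, ‖mollify n g v‖ₑ ^ 2) Filter.atTop :=
        lintegral_liminf_le fun n => (contDiff_mollify n h.1).continuous.measurable.enorm.pow_const 2
    _ ≤ _ := Filter.liminf_le_of_le (by isBoundedDefault)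
        fun b hb => (hb.exists.choose_spec.trans (hn _))

/-! ### Domination of the model norm by the σ-norm. -/

lemma enorm_sq_eq_ofReal {E : Type*} [NormedAddCommGroup E] (x : E) :
    ‖x‖ₑ ^ 2 = ENNReal.ofReal (‖x‖ ^ 2) := by
  rw [ENNReal.ofReal_pow (norm_nonneg _), ofReal_norm]

lemma weight_le_of_norm_le (s : ℝ) {v : V} (hv : ‖v‖ ≤ 3) : weight s v ≤ 4 ^ |s| := by
  calc weight s v ≤ (1 + ‖v‖) ^ |s| :=
        Real.rpow_le_rpow_of_exponent_le (by linarith [norm_nonneg v]) (le_abs_self s)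
    _ ≤ 4 ^ |s| := Real.rpow_le_rpow (by positivity) (by linarith) (abs_nonneg s)

lemma one_le_mul_weight (s : ℝ) {v : V} (hv : ‖v‖ ≤ 3) : 1 ≤ 4 ^ |s| * weight s v := by
  have h := weight_le_of_norm_le (-s) hv
  rw [abs_neg] at h
  have h1 : weight (-s) v * weight s v = 1 := by rw [← weight_add]; simp [weight]
  rw [← h1]
  exact mul_le_mul_of_nonneg_right h (weight_pos s v).le

lemma sigmaNorm_sq (ϑ : ℝ) (g : V → ℝ) (G : V → V) : sigmaNorm ϑ g G ^ 2 =
    ∫⁻ v, ENNReal.ofReal (weight (2 * ϑ) v * sigmaDensity v (g v) (G v)) := by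
  rw [sigmaNorm, ← ENNReal.rpow_two, ← ENNReal.rpow_mul]; norm_num

/-- The square of the weighted norm defined by `modelDensity`. -/
def modelNormSq (ϑ : ℝ) (g : V → ℝ) (G : V → V) : ℝ≥0∞ :=
  ∫⁻ v, ENNReal.ofReal (weight (2 * ϑ) v * modelDensity v (g v) (G v))

/-- The norm `|g|_{σ,ϑ}` dominates the model norm. -/
lemma exists_modelNormSq_le (ϑ : ℝ) : ∃ C : ℝ≥0, ∀ (g : V → ℝ) (G : V → V), HasWeakGradient g G →
    modelNormSq ϑ g G ≤ C * sigmaNorm ϑ g G ^ 2 := by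
  obtain ⟨c, hc, hσ⟩ := exists_le_sigmaDensity
  obtain ⟨M, hM⟩ := exists_lintegral_ball_sq_le
  -- On the ball of radius three both the weight and its inverse are at most `K`, so weights can be
  -- inserted or removed there.
  set K : ℝ := 4 ^ |2 * ϑ| with hK
  have hK0 : 0 < K := by positivity
  refine ⟨(4 / c).toNNReal + K.toNNReal * (M * ((256 * K / c).toNNReal + (256 * K / c).toNNReal)),
    fun g G h => ?_⟩
  rw [sigmaNorm_sq]
  set S := ∫⁻ v, ENNReal.ofReal (weight (2 * ϑ) v * sigmaDensity v (g v) (G v))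
  have hgm : AEMeasurable fun v => ‖g v‖ₑ ^ 2 := h.1.aestronglyMeasurable.enorm.pow_const 2
  have hX : ∀ v, 0 ≤ ((1 + ‖v‖) ^ 3)⁻¹ * ‖v‖ ^ 2 * g v ^ 2 := fun v => by positivity
  have hW := fun v => (weight_pos (2 * ϑ) v).le
  -- For `|v| ≥ 1` one has `(1+|v|)² ≤ 4|v|²`, so the σ-density dominates the whole model density.
  -- Inside the unit ball it misses the zero-order term, which is carried separately.
  have hp : ∀ v, ENNReal.ofReal (weight (2 * ϑ) v * modelDensity v (g v) (G v)) ≤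
      (4 / c).toNNReal * ENNReal.ofReal (weight (2 * ϑ) v * sigmaDensity v (g v) (G v)) +
      K.toNNReal * (Metric.ball (0 : V) 1).indicator (fun v => ‖g v‖ₑ ^ 2) v := by
    intro v
    have h1 := hσ v (g v) (G v)
    have hm := modelForm_nonneg v (G v)
    have h3 : modelForm v (G v) + ((1 + ‖v‖) ^ 3)⁻¹ * ‖v‖ ^ 2 * g v ^ 2 ≤
        1 / c * sigmaDensity v (g v) (G v) := by
      rw [div_mul_eq_mul_div, le_div_iff₀ hc]; linarith
    have h4 : 4 / c * sigmaDensity v (g v) (G v) = 4 * (1 / c * sigmaDensity v (g v) (G v)) := by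
      ring
    by_cases hv : v ∈ Metric.ball (0 : V) 1
    · rw [Set.indicator_of_mem hv, enorm_sq_eq_ofReal, ← ENNReal.ofReal, ← ENNReal.ofReal,
        ← ENNReal.ofReal_mul (by positivity), ← ENNReal.ofReal_mul (by positivity)]
      refine le_trans (ENNReal.ofReal_le_ofReal ?_) (ENNReal.ofReal_add_le)
      have hv1 : ‖v‖ < 1 := by simpa using hv
      have h2 : weight (2 * ϑ) v ≤ K := weight_le_of_norm_le _ (by linarith)
      have h5 : (1 + ‖v‖)⁻¹ * g v ^ 2 ≤ 1 * g v ^ 2 := by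
        gcongr
        exact inv_le_one_of_one_le₀ (by linarith [norm_nonneg v])
      have h6 : modelForm v (G v) ≤ 4 / c * sigmaDensity v (g v) (G v) := by linarith [hX v]
      have h7 : weight (2 * ϑ) v * g v ^ 2 ≤ K * g v ^ 2 := by gcongr
      have := mul_le_mul_of_nonneg_left h6 (hW v)
      have := mul_le_mul_of_nonneg_left h5 (hW v)
      rw [modelDensity, Real.norm_eq_abs, sq_abs]
      linarith
    · rw [Set.indicator_of_notMem hv, mul_zero, add_zero, ← ENNReal.ofReal,
        ← ENNReal.ofReal_mul (by positivity)]
      apply ENNReal.ofReal_le_ofReal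
      have hv1 : 1 ≤ ‖v‖ := by simpa using hv
      have h5 : (1 + ‖v‖)⁻¹ * g v ^ 2 ≤ 4 * (((1 + ‖v‖) ^ 3)⁻¹ * ‖v‖ ^ 2 * g v ^ 2) := by
        rw [show 4 * (((1 + ‖v‖) ^ 3)⁻¹ * ‖v‖ ^ 2 * g v ^ 2) =
          (4 * (((1 + ‖v‖) ^ 3)⁻¹ * ‖v‖ ^ 2)) * g v ^ 2 by ring]
        gcongr
        rw [inv_eq_one_div, div_le_iff₀ (by positivity)]
        have : 4 * (((1 + ‖v‖) ^ 3)⁻¹ * ‖v‖ ^ 2) * (1 + ‖v‖) = 4 * ‖v‖ ^ 2 / (1 + ‖v‖) ^ 2 := by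
          field_simp
        rw [this, le_div_iff₀ (by positivity)]
        nlinarith
      have h6 : modelDensity v (g v) (G v) ≤ 4 / c * sigmaDensity v (g v) (G v) := by
        rw [modelDensity]; linarith [hX v]
      linarith [mul_le_mul_of_nonneg_left h6 (hW v)]
  -- Here `64 = (1+3)³` bounds the denominator of `modelForm`. The further factor `4` is needed only
  -- for `g`, where `|v|² ≥ 1/4`; it is kept so that both bounds share a constant.
  have hq : ∀ v ∈ Metric.ball (0 : V) 3, ‖G v‖ₑ ^ 2 ≤ (256 * K / c).toNNReal *
      ENNReal.ofReal (weight (2 * ϑ) v * sigmaDensity v (g v) (G v)) := by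
    intro v hv
    rw [enorm_sq_eq_ofReal, ← ENNReal.ofReal, ← ENNReal.ofReal_mul (by positivity)]
    apply ENNReal.ofReal_le_ofReal
    have hv3 : ‖v‖ < 3 := by simpa using hv
    have h1 := one_le_mul_weight (2 * ϑ) hv3.le
    have h2 := hσ v (g v) (G v)
    have h3 : ‖G v‖ ^ 2 ≤ 64 * modelForm v (G v) := by
      rw [modelForm, ← div_eq_inv_mul, ← mul_div_assoc, le_div_iff₀ (by positivity)]
      have : (1 + ‖v‖) ^ 3 ≤ 4 ^ 3 := by gcongr; linarith
      nlinarith [crossSq_nonneg v (G v), sq_nonneg ‖G v‖]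
    have h4 : ‖G v‖ ^ 2 ≤ 64 / c * sigmaDensity v (g v) (G v) := by
      rw [div_mul_eq_mul_div, le_div_iff₀ hc]
      nlinarith [hX v]
    have h5 : 0 ≤ 64 / c * sigmaDensity v (g v) (G v) := (sq_nonneg _).trans h4
    calc ‖G v‖ ^ 2 ≤ 1 * (64 / c * sigmaDensity v (g v) (G v)) := by linarith
      _ ≤ (4 * (K * weight (2 * ϑ) v)) * (64 / c * sigmaDensity v (g v) (G v)) := by
        gcongr; linarith
      _ = _ := by ring
  have hr : ∀ v ∈ Metric.ball (0 : V) 3 \ Metric.ball 0 (1 / 2), ‖g v‖ₑ ^ 2 ≤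
      (256 * K / c).toNNReal *
        ENNReal.ofReal (weight (2 * ϑ) v * sigmaDensity v (g v) (G v)) := by
    intro v hv
    rw [enorm_sq_eq_ofReal, ← ENNReal.ofReal, ← ENNReal.ofReal_mul (by positivity)]
    apply ENNReal.ofReal_le_ofReal
    simp only [Set.mem_sdiff, mem_ball_zero_iff, not_lt] at hv
    have h1 := one_le_mul_weight (2 * ϑ) hv.1.le
    have h2 := hσ v (g v) (G v)
    have h3 : g v ^ 2 ≤ 256 * (((1 + ‖v‖) ^ 3)⁻¹ * ‖v‖ ^ 2 * g v ^ 2) := by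
      rw [show 256 * (((1 + ‖v‖) ^ 3)⁻¹ * ‖v‖ ^ 2 * g v ^ 2) =
          (256 * ‖v‖ ^ 2 * g v ^ 2) / (1 + ‖v‖) ^ 3 by ring, le_div_iff₀ (by positivity)]
      have : (1 + ‖v‖) ^ 3 ≤ 4 ^ 3 := by gcongr; linarith
      have h6 : 1 / 4 ≤ ‖v‖ ^ 2 := by nlinarith
      nlinarith [sq_nonneg (g v)]
    have h4 : g v ^ 2 ≤ 256 / c * sigmaDensity v (g v) (G v) := by
      rw [div_mul_eq_mul_div, le_div_iff₀ hc]
      nlinarith [hX v, modelForm_nonneg v (G v)]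
    have h5 : 0 ≤ 256 / c * sigmaDensity v (g v) (G v) := (sq_nonneg _).trans h4
    rw [Real.norm_eq_abs, sq_abs]
    calc g v ^ 2 ≤ 1 * (256 / c * sigmaDensity v (g v) (G v)) := by linarith
      _ ≤ (K * weight (2 * ϑ) v) * (256 / c * sigmaDensity v (g v) (G v)) := by
        gcongr
      _ = _ := by ring
  have hball : ∀ (s : Set V) (f : V → ℝ≥0∞), MeasurableSet s → (∀ v ∈ s, f v ≤
      (256 * K / c).toNNReal * ENNReal.ofReal (weight (2 * ϑ) v * sigmaDensity v (g v) (G v))) →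
      ∫⁻ v in s, f v ≤ (256 * K / c).toNNReal * S := by
    intro s f hs hf
    calc _ ≤ ∫⁻ v in s, (256 * K / c).toNNReal *
          ENNReal.ofReal (weight (2 * ϑ) v * sigmaDensity v (g v) (G v)) :=
          setLIntegral_mono' hs hf
      _ ≤ ∫⁻ v, _ := setLIntegral_le_lintegral _ _
      _ = _ := lintegral_const_mul' _ _ ENNReal.coe_ne_top
  calc modelNormSq ϑ g G ≤ _ := lintegral_mono hp
    _ = (4 / c).toNNReal * S + K.toNNReal * ∫⁻ v in Metric.ball (0 : V) 1, ‖g v‖ₑ ^ 2 := by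
      rw [lintegral_add_right', lintegral_const_mul' _ _ ENNReal.coe_ne_top,
        lintegral_const_mul' _ _ ENNReal.coe_ne_top, lintegral_indicator measurableSet_ball]
      exact (hgm.indicator measurableSet_ball).const_mul _
    _ ≤ (4 / c).toNNReal * S + K.toNNReal * (M * ((256 * K / c).toNNReal * S +
          (256 * K / c).toNNReal * S)) := by
      gcongr
      refine (hM g G h).trans ?_
      gcongr
      · exact hball _ _ measurableSet_ball hq
      · exact hball _ _ (measurableSet_ball.diff measurableSet_ball) hr
    _ = _ := by push_cast; ring

/-! ### Coulomb kernels and integration by parts in singular convolutions. -/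

/-- A kernel that is homogeneous of degree `-1` and smooth away from the origin. -/
structure IsCoulombKernel (K : V → ℝ) : Prop where
  contDiffAt : ∀ z, z ≠ 0 → ContDiffAt ℝ ∞ K z
  homogeneous : ∀ t : ℝ, 0 < t → ∀ z, K (t • z) = t⁻¹ * K z
  bound : ∀ z, |K z| ≤ ‖z‖⁻¹

lemma isCoulombKernel_phi (i j : Fin 3) : IsCoulombKernel (phi i j) where
  contDiffAt z hz := by
    have hn : ContDiffAt ℝ ∞ (fun z : V => ‖z‖) z := contDiffAt_norm ℝ hz
    have h0 : ‖z‖ ≠ 0 := norm_ne_zero_iff.2 hz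
    have hc : ∀ i : Fin 3, ContDiffAt ℝ ∞ (fun z : V => z i) z := fun i => by fun_prop
    unfold phi
    exact (contDiffAt_const.sub (((hc i).mul (hc j)).div (hn.pow 2) (by positivity))).mul
      (hn.inv h0)
  homogeneous t ht z := by
    simp only [phi, norm_smul, PiLp.smul_apply, smul_eq_mul, Real.norm_of_nonneg ht.le]
    rcases eq_or_ne z 0 with rfl | hz
    · simp
    have h0 : ‖z‖ ≠ 0 := norm_ne_zero_iff.2 hz
    field_simp
  bound := abs_phi_le i j

/-- Smooth regularizations of a kernel. -/
def regKernel (K : V → ℝ) (n : ℕ) (z : V) : ℝ :=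
  (n + 1) * ((1 - cutoff (((n : ℝ) + 1) • z)) * K (((n : ℝ) + 1) • z))

section CoulombKernel

variable {K : V → ℝ}

lemma hasFDerivAt_smul_comp {f : V → ℝ} {s c : ℝ} {z : V} (hf : DifferentiableAt ℝ f (s • z)) :
    HasFDerivAt (fun z => c * f (s • z)) ((c * s) • fderiv ℝ f (s • z)) z := by
  have h : HasFDerivAt (fun z => c * f (s • z))
      (c • (fderiv ℝ f (s • z)).comp (s • ContinuousLinearMap.id ℝ V)) z :=
    (hf.hasFDerivAt.comp z ((hasFDerivAt_id z).const_smul s)).const_mul c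
  have e : (c * s) • fderiv ℝ f (s • z) =
      c • (fderiv ℝ f (s • z)).comp (s • ContinuousLinearMap.id ℝ V) := by
    ext x
    simp [mul_assoc]
  rw [e]
  exact h

lemma IsCoulombKernel.zero (hK : IsCoulombKernel K) : K 0 = 0 := by
  simpa using hK.bound 0

lemma regKernel_zero_eq (K : V → ℝ) (z : V) : regKernel K 0 z = (1 - cutoff z) * K z := by
  simp [regKernel]

/-- All regularizations are rescalings of one smooth function, so bounds uniform in `n` reduce to `n
= 0`. -/
lemma regKernel_eq_scale (K : V → ℝ) (n : ℕ) :
    regKernel K n = fun z => ((n : ℝ) + 1) * regKernel K 0 (((n : ℝ) + 1) • z) := by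
  ext z; rw [regKernel_zero_eq, regKernel]

lemma regKernel_zero_eventuallyEq {z : V} (hz : ‖z‖ < 1) : regKernel K 0 =ᶠ[nhds z] fun _ => 0 := by
  filter_upwards [Metric.isOpen_ball.mem_nhds (mem_ball_zero_iff.2 hz)] with x hx
  rw [regKernel_zero_eq, cutoff_eq_one (mem_ball_zero_iff.1 hx).le, sub_self, zero_mul]

lemma IsCoulombKernel.contDiff_regKernel (hK : IsCoulombKernel K) (n : ℕ) :
    ContDiff ℝ ∞ (regKernel K n) := by
  have h0 : ContDiff ℝ ∞ (regKernel K 0) := by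
    rw [contDiff_iff_contDiffAt]
    intro z
    rcases lt_or_ge ‖z‖ 1 with hz | hz
    · exact contDiffAt_const.congr_of_eventuallyEq (regKernel_zero_eventuallyEq hz)
    · have hz0 : z ≠ 0 := by rintro rfl; simp at hz; linarith
      have : regKernel K 0 = fun z => (1 - cutoff z) * K z := funext (regKernel_zero_eq K)
      rw [this]
      exact (contDiffAt_const.sub contDiff_cutoff.contDiffAt).mul (hK.contDiffAt z hz0)
  rw [regKernel_eq_scale]
  exact contDiff_const.mul (h0.comp (by fun_prop))

lemma IsCoulombKernel.regKernel_eq (hK : IsCoulombKernel K) {n : ℕ} {z : V}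
    (hz : 2 ≤ ((n : ℝ) + 1) * ‖z‖) : regKernel K n z = K z := by
  have hn : (0 : ℝ) < n + 1 := by positivity
  rw [regKernel, cutoff_eq_zero, hK.homogeneous _ hn]
  · field_simp; ring
  · rwa [norm_smul, Real.norm_of_nonneg hn.le]

lemma IsCoulombKernel.regKernel_eventuallyEq (hK : IsCoulombKernel K) {n : ℕ} {z : V}
    (hz : 2 < ((n : ℝ) + 1) * ‖z‖) : regKernel K n =ᶠ[nhds z] K := by
  filter_upwards [(isOpen_lt continuous_const (by fun_prop :
    Continuous fun z : V => ((n : ℝ) + 1) * ‖z‖)).mem_nhds hz] with x hx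
  exact hK.regKernel_eq (le_of_lt hx)

lemma IsCoulombKernel.abs_regKernel_le (hK : IsCoulombKernel K) (n : ℕ) (z : V) :
    |regKernel K n z| ≤ ‖z‖⁻¹ := by
  have hn : (0 : ℝ) < n + 1 := by positivity
  rw [regKernel, hK.homogeneous _ hn, abs_mul, abs_mul, abs_mul, abs_of_pos hn, abs_inv,
    abs_of_pos hn]
  have h1 : |1 - cutoff (((n : ℝ) + 1) • z)| ≤ 1 := by
    rw [abs_le]
    constructor
    · linarith [cutoff.le_one (x := ((n : ℝ) + 1) • z)]
    · linarith [cutoff.nonneg (x := ((n : ℝ) + 1) • z)]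
  calc _ = |1 - cutoff (((n : ℝ) + 1) • z)| * |K z| := by field_simp
    _ ≤ 1 * ‖z‖⁻¹ := by gcongr; exact hK.bound z
    _ = _ := one_mul _

/-- The gradient of `K` is homogeneous of degree `-2`, hence controlled by its size on one sphere,
and scaling carries the bound to every regularization. The second bound, which depends on `n`, has
no singularity and serves to differentiate under the integral for fixed `n`. -/
lemma IsCoulombKernel.exists_norm_fderiv_le (hK : IsCoulombKernel K) : ∃ C : ℝ, 0 ≤ C ∧
    (∀ n z, ‖fderiv ℝ (regKernel K n) z‖ ≤ C * (‖z‖⁻¹) ^ 2) ∧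
    (∀ n z, ‖fderiv ℝ (regKernel K n) z‖ ≤ C * ((n : ℝ) + 1) ^ 2) ∧
    (∀ z, z ≠ 0 → ‖fderiv ℝ K z‖ ≤ C * (‖z‖⁻¹) ^ 2) := by
  have hk := hK.contDiff_regKernel 0
  have hkd : Differentiable ℝ (regKernel K 0) := hk.differentiable (by simp)
  obtain ⟨M, hM⟩ := (isCompact_closedBall (0 : V) 3).exists_bound_of_continuousOn
    (hk.continuous_fderiv (by simp)).continuousOn
  have hM0 : 0 ≤ M := (norm_nonneg _).trans (hM 0 (by simp))
  have hKd : ∀ z, z ≠ 0 → DifferentiableAt ℝ K z := fun z hz =>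
    (hK.contDiffAt z hz).differentiableAt (by simp)
  have hDK : ∀ z, z ≠ 0 → ‖fderiv ℝ K z‖ ≤ 9 * M * (‖z‖⁻¹) ^ 2 := by
    intro z hz
    have hz0 : 0 < ‖z‖ := norm_pos_iff.2 hz
    -- The dilation puts `z` on the sphere of radius three, where the cutoff vanishes nearby and `K`
    -- agrees with the smooth function `regKernel K 0`.
    set s := 3 * ‖z‖⁻¹ with hs
    have hs0 : 0 < s := by positivity
    have hy : ‖s • z‖ = 3 := by
      rw [norm_smul, Real.norm_of_nonneg hs0.le, hs]; field_simp
    have h1 := hasFDerivAt_smul_comp (c := s) (hKd (s • z) (smul_ne_zero hs0.ne' hz))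
    have h2 : (fun z => s * K (s • z)) = K := by
      ext x; rw [hK.homogeneous s hs0]; field_simp
    rw [h2] at h1
    have h3 : fderiv ℝ K (s • z) = fderiv ℝ (regKernel K 0) (s • z) :=
      (hK.regKernel_eventuallyEq (n := 0) (by rw [hy]; norm_num)).fderiv_eq.symm
    rw [h1.fderiv, norm_smul, h3, Real.norm_of_nonneg (by positivity)]
    calc s * s * ‖_‖ ≤ s * s * M := by gcongr; exact hM _ (by simp [hy])
      _ = _ := by rw [hs]; ring
  have hDk : ∀ z, ‖fderiv ℝ (regKernel K 0) z‖ ≤ 9 * M * (‖z‖⁻¹) ^ 2 := by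
    intro z
    rcases lt_or_ge ‖z‖ 1 with hz | hz
    · rw [(regKernel_zero_eventuallyEq hz).fderiv_eq]
      simp; positivity
    rcases le_or_gt ‖z‖ 3 with hz3 | hz3
    · refine (hM z (by simpa using hz3)).trans ?_
      have h : 3⁻¹ ≤ ‖z‖⁻¹ := by gcongr
      have : (3⁻¹ : ℝ) ^ 2 ≤ (‖z‖⁻¹) ^ 2 := by gcongr
      nlinarith
    · rw [(hK.regKernel_eventuallyEq (n := 0) (by simp; linarith)).fderiv_eq]
      exact hDK z (by rintro rfl; simp at hz3; linarith)
  have hDk' : ∀ z, ‖fderiv ℝ (regKernel K 0) z‖ ≤ 9 * M := by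
    intro z
    rcases lt_or_ge ‖z‖ 1 with hz | hz
    · rw [(regKernel_zero_eventuallyEq hz).fderiv_eq]
      simp; positivity
    · refine (hDk z).trans ?_
      have : (‖z‖⁻¹) ^ 2 ≤ 1 := pow_le_one₀ (by positivity) (inv_le_one_of_one_le₀ hz)
      nlinarith
  have hreg : ∀ (n : ℕ) z, ‖fderiv ℝ (regKernel K n) z‖ =
      ((n : ℝ) + 1) ^ 2 * ‖fderiv ℝ (regKernel K 0) (((n : ℝ) + 1) • z)‖ := by
    intro n z
    rw [regKernel_eq_scale K n, (hasFDerivAt_smul_comp (hkd _)).fderiv, norm_smul,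
      Real.norm_of_nonneg (by positivity), sq]
  refine ⟨9 * M, by positivity, fun n z => ?_, fun n z => ?_, hDK⟩
  · rw [hreg]
    refine (mul_le_mul_of_nonneg_left (hDk _) (by positivity)).trans_eq ?_
    rw [norm_smul, Real.norm_of_nonneg (by positivity)]
    field_simp
  · rw [hreg, mul_comm (9 * M)]
    exact mul_le_mul_of_nonneg_left (hDk' _) (by positivity)

lemma eventually_two_lt_mul_norm {z : V} (hz : z ≠ 0) :
    ∀ᶠ n : ℕ in Filter.atTop, 2 < ((n : ℝ) + 1) * ‖z‖ := by
  have hz0 : 0 < ‖z‖ := norm_pos_iff.2 hz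
  obtain ⟨N, hN⟩ := exists_nat_gt (2 / ‖z‖)
  filter_upwards [Filter.eventually_ge_atTop N] with n hn
  rw [div_lt_iff₀ hz0] at hN
  have : (N : ℝ) ≤ n := by exact_mod_cast hn
  nlinarith

lemma IsCoulombKernel.measurable (hK : IsCoulombKernel K) : Measurable K := by
  refine measurable_of_tendsto_metrizable (fun n => (hK.contDiff_regKernel n).continuous.measurable)
    (tendsto_pi_nhds.2 fun z => ?_)
  rcases eq_or_ne z 0 with rfl | hz
  · refine tendsto_const_nhds.congr fun n => ?_
    simp [regKernel, hK.zero]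
  · refine tendsto_const_nhds.congr' ?_
    filter_upwards [eventually_two_lt_mul_norm hz] with n hn
    exact (hK.regKernel_eq hn.le).symm

/-- Integration by parts for test functions without compact support. -/
lemma HasWeakGradient.integral_mul_pd_of_integrable {g : V → ℝ} {G : V → V}
    (h : HasWeakGradient g G) {η : V → ℝ} (hη : ContDiff ℝ 1 η) (i : Fin 3)
    (h0 : Integrable fun v => g v * η v) (h1 : Integrable fun v => g v * pd i η v)
    (h2 : Integrable fun v => G v i * η v) :
    ∫ v, g v * pd i η v = -∫ v, G v i * η v := by
  have hχ1 : ContDiff ℝ 1 (cutoff : V → ℝ) := contDiff_cutoff.of_le (by simp)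
  obtain ⟨M, R, hM0, hM, -⟩ := exists_bound_of_hasCompactSupport (continuous_pd i hχ1)
    (hasCompactSupport_pd i cutoff.hasCompactSupport)
  -- The cutoffs `χ(v/(n+1))` exhaust the space, and their gradients carry the factor `s n`, so the
  -- commutator term tends to zero.
  let s : ℕ → ℝ := fun n => ((n : ℝ) + 1)⁻¹
  have hs0 : ∀ n, 0 < s n := fun n => by positivity
  have hs : Filter.Tendsto s Filter.atTop (nhds 0) := by
    simpa [s] using tendsto_one_div_add_atTop_nhds_zero_nat (𝕜 := ℝ)
  have hs1 : ∀ n, s n ≤ 1 := fun n => inv_le_one_of_one_le₀ (by simp)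
  let χ : ℕ → V → ℝ := fun n v => cutoff (s n • v)
  have hχ : ∀ n, ContDiff ℝ 1 (χ n) := fun n => hχ1.comp (by fun_prop)
  have hχc : ∀ n, HasCompactSupport (χ n) := fun n =>
    hasCompactSupport_of_eq_zero (R := 2 / s n) fun v hv => cutoff_eq_zero (by
      rw [norm_smul, Real.norm_of_nonneg (hs0 n).le]
      rw [div_le_iff₀ (hs0 n)] at hv
      linarith)
  have hχpd : ∀ n v, pd i (χ n) v = s n * pd i cutoff (s n • v) := by
    intro n v
    have := hasFDerivAt_smul_comp (f := cutoff) (s := s n) (c := 1) (z := v)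
      (hχ1.differentiable one_ne_zero _)
    simp only [one_mul] at this
    rw [pd, this.fderiv]
    simp [pd]
  have hχle : ∀ n v, ‖χ n v‖ ≤ 1 := fun n v => by
    rw [Real.norm_of_nonneg cutoff.nonneg]; exact cutoff.le_one
  have hχt : ∀ v, Filter.Tendsto (fun n => χ n v) Filter.atTop (nhds 1) := by
    intro v
    have h1 : Filter.Tendsto (fun n => s n • v) Filter.atTop (nhds (0 : V)) := by
      simpa using hs.smul_const v
    have := (hχ1.continuous.tendsto 0).comp h1
    rwa [cutoff_eq_one (by simp)] at this
  have hpd : ∀ n v, pd i (fun v => χ n v * η v) v = χ n v * pd i η v + pd i (χ n) v * η v :=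
    fun n v => pd_mul ((hχ n).differentiable one_ne_zero v) (hη.differentiable one_ne_zero v) i
  have hn : ∀ n, ∫ v, g v * pd i (fun v => χ n v * η v) v = -∫ v, G v i * (χ n v * η v) := fun n =>
    h.integral_mul_pd ((hχ n).mul hη) ((hχc n).mul_right) i
  have t1 : Filter.Tendsto (fun n => ∫ v, g v * pd i (fun v => χ n v * η v) v) Filter.atTop
      (nhds (∫ v, g v * pd i η v)) := by
    refine tendsto_integral_of_dominated_convergence
      (fun v => ‖g v * pd i η v‖ + M * ‖g v * η v‖) (fun n => ?_)
      (h1.norm.add (h0.norm.const_mul M)) (fun n => ae_of_all _ fun v => ?_)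
      (ae_of_all _ fun v => ?_)
    · exact h.1.aestronglyMeasurable.mul
        (continuous_pd i ((hχ n).mul hη)).aestronglyMeasurable
    · rw [hpd, mul_add]
      refine (norm_add_le _ _).trans (add_le_add ?_ ?_)
      · rw [mul_left_comm, norm_mul]
        exact mul_le_of_le_one_left (norm_nonneg _) (hχle n v)
      · rw [mul_left_comm, norm_mul, hχpd, norm_mul]
        gcongr
        rw [Real.norm_of_nonneg (hs0 n).le]
        calc s n * ‖_‖ ≤ 1 * M := by
              gcongr
              · exact hs1 n
              · exact hM _
          _ = M := one_mul M
    · refine Filter.Tendsto.const_mul _ ?_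
      simp only [hpd]
      have e1 := (hχt v).mul_const (pd i η v)
      have e2 : Filter.Tendsto (fun n => pd i (χ n) v * η v) Filter.atTop (nhds 0) := by
        rw [← zero_mul (η v)]
        refine Filter.Tendsto.mul_const _ ?_
        refine squeeze_zero_norm (a := fun n => s n * M) (fun n => ?_) (by simpa using hs.mul_const M)
        rw [hχpd, norm_mul, Real.norm_of_nonneg (hs0 n).le]
        exact mul_le_mul_of_nonneg_left (hM _) (hs0 n).le
      simpa using e1.add e2
  have t2 : Filter.Tendsto (fun n => ∫ v, G v i * (χ n v * η v)) Filter.atTop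
      (nhds (∫ v, G v i * η v)) := by
    refine tendsto_integral_of_dominated_convergence (fun v => ‖G v i * η v‖) (fun n => ?_)
      h2.norm (fun n => ae_of_all _ fun v => ?_) (ae_of_all _ fun v => ?_)
    · exact (locallyIntegrable_coord h.2.1 i).aestronglyMeasurable.mul
        ((hχ n).continuous.mul hη.continuous).aestronglyMeasurable
    · rw [mul_left_comm, norm_mul]
      exact mul_le_of_le_one_left (norm_nonneg _) (hχle n v)
    · simpa using ((hχt v).mul_const (η v)).const_mul (G v i)
  exact tendsto_nhds_unique (t1.congr hn) t2.neg

lemma ae_sub_ne_zero (v : V) : ∀ᵐ v' : V, v - v' ≠ 0 := by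
  filter_upwards [compl_mem_ae_iff.2 (measure_singleton v)] with v' hv' h
  exact hv' (by simp [sub_eq_zero.1 h])

lemma abs_pd_le (i : Fin 3) (f : V → ℝ) (z : V) : |pd i f z| ≤ ‖fderiv ℝ f z‖ := by
  have := (fderiv ℝ f z).le_opNorm (EuclideanSpace.single i 1)
  simpa [pd] using this

lemma measurable_pd (i : Fin 3) (f : V → ℝ) : Measurable (pd i f) :=
  measurable_fderiv_apply_const ℝ f _

/-- Integration by parts in a convolution with a Coulomb kernel. -/
lemma IsCoulombKernel.integral_mul_grad (hK : IsCoulombKernel K) {g : V → ℝ} {G : V → V}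
    (h : HasWeakGradient g G) {P : V → ℝ} (hP : ContDiff ℝ 1 P) (i : Fin 3) (v : V)
    (h1 : Integrable fun v' => (1 + ‖v - v'‖⁻¹) ^ 2 * ((|P v'| + |pd i P v'|) * |g v'|))
    (h2 : Integrable fun v' => ‖v - v'‖⁻¹ * (P v' * G v' i)) :
    ∫ v', K (v - v') * (P v' * G v' i) =
      ∫ v', g v' * (pd i K (v - v') * P v' - K (v - v') * pd i P v') := by
  obtain ⟨C, hC0, hC, -, -⟩ := hK.exists_norm_fderiv_le
  have hsub : Measurable fun v' : V => v - v' := by fun_prop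
  have hgm := h.1.aestronglyMeasurable
  have hGm := (locallyIntegrable_coord h.2.1 i).aestronglyMeasurable
  have hr : ∀ n, ContDiff ℝ 1 (regKernel K n) := fun n => (hK.contDiff_regKernel n).of_le (by simp)
  have hη : ∀ n, ContDiff ℝ 1 fun v' => regKernel K n (v - v') * P v' := fun n =>
    ((hr n).comp (by fun_prop)).mul hP
  have hpd : ∀ n v', pd i (fun v' => regKernel K n (v - v') * P v') v' =
      regKernel K n (v - v') * pd i P v' - pd i (regKernel K n) (v - v') * P v' := by
    intro n v'
    have hc : ContDiff ℝ 1 fun v' => regKernel K n (v - v') := (hr n).comp (by fun_prop)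
    rw [pd_mul (hc.differentiable one_ne_zero v') (hP.differentiable one_ne_zero v') i,
      pd_comp_sub i _ ((hr n).differentiable one_ne_zero)]
    ring
  have ht : ∀ v', (0 : ℝ) ≤ ‖v - v'‖⁻¹ := fun v' => by positivity
  have hb1 : ∀ v', ‖v - v'‖⁻¹ ≤ (1 + ‖v - v'‖⁻¹) ^ 2 := fun v' => inv_norm_le_sq _
  have hb2 : ∀ v', (‖v - v'‖⁻¹) ^ 2 ≤ (1 + ‖v - v'‖⁻¹) ^ 2 := fun v' => by nlinarith [ht v']
  have hbound : ∀ n v', ‖g v' * pd i (fun v' => regKernel K n (v - v') * P v') v'‖ ≤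
      (1 + C) * ((1 + ‖v - v'‖⁻¹) ^ 2 * ((|P v'| + |pd i P v'|) * |g v'|)) := by
    intro n v'
    rw [hpd, norm_mul, Real.norm_eq_abs, Real.norm_eq_abs]
    have e1 : |regKernel K n (v - v') * pd i P v'| ≤ (1 + ‖v - v'‖⁻¹) ^ 2 * |pd i P v'| := by
      rw [abs_mul]; gcongr; exact (hK.abs_regKernel_le n _).trans (hb1 v')
    have e2 : |pd i (regKernel K n) (v - v') * P v'| ≤ C * (1 + ‖v - v'‖⁻¹) ^ 2 * |P v'| := by
      rw [abs_mul]; gcongr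
      exact (abs_pd_le _ _ _).trans ((hC n _).trans
        (mul_le_mul_of_nonneg_left (hb2 v') hC0))
    calc _ ≤ |g v'| * ((1 + ‖v - v'‖⁻¹) ^ 2 * |pd i P v'| +
          C * (1 + ‖v - v'‖⁻¹) ^ 2 * |P v'|) := by
          gcongr; exact (abs_sub _ _).trans (add_le_add e1 e2)
      _ ≤ _ := by
          have h3 : 0 ≤ |g v'| * (1 + ‖v - v'‖⁻¹) ^ 2 := by positivity
          nlinarith [mul_nonneg h3 (abs_nonneg (P v')),
            mul_nonneg hC0 (mul_nonneg h3 (abs_nonneg (pd i P v')))]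
  have hmeas1 : ∀ n, AEStronglyMeasurable (fun v' => g v' *
      pd i (fun v' => regKernel K n (v - v') * P v') v') volume := fun n =>
    hgm.mul (continuous_pd i (hη n)).aestronglyMeasurable
  have hbound2 : ∀ n v', ‖G v' i * (regKernel K n (v - v') * P v')‖ ≤
      ‖‖v - v'‖⁻¹ * (P v' * G v' i)‖ := by
    intro n v'
    rw [show G v' i * (regKernel K n (v - v') * P v') = regKernel K n (v - v') * (P v' * G v' i) by
      ring, norm_mul, norm_mul ‖v - v'‖⁻¹, Real.norm_of_nonneg (ht v')]
    gcongr
    exact hK.abs_regKernel_le n _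
  have hmeas2 : ∀ n, AEStronglyMeasurable (fun v' => G v' i *
      (regKernel K n (v - v') * P v')) volume := fun n =>
    hGm.mul (hη n).continuous.aestronglyMeasurable
  have hn : ∀ n, ∫ v', g v' * pd i (fun v' => regKernel K n (v - v') * P v') v' =
      -∫ v', G v' i * (regKernel K n (v - v') * P v') := by
    intro n
    refine h.integral_mul_pd_of_integrable (hη n) i ?_
      ((h1.const_mul (1 + C)).mono' (hmeas1 n) (ae_of_all _ (hbound n)))
      (h2.norm.mono' (hmeas2 n) (ae_of_all _ (hbound2 n)))
    refine h1.mono' (hgm.mul (hη n).continuous.aestronglyMeasurable) (ae_of_all _ fun v' => ?_)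
    rw [norm_mul, norm_mul, Real.norm_eq_abs, Real.norm_eq_abs, Real.norm_eq_abs]
    calc |g v'| * (|regKernel K n (v - v')| * |P v'|)
        ≤ |g v'| * ((1 + ‖v - v'‖⁻¹) ^ 2 * (|P v'| + |pd i P v'|)) := by
          gcongr
          · exact (hK.abs_regKernel_le n _).trans (hb1 v')
          · linarith [abs_nonneg (pd i P v')]
      _ = _ := by ring
  -- At every `v' ≠ v` the regularized kernel and its derivative eventually equal those of `K`, and
  -- the domination by `h1` is uniform in `n` because the singularity is at most `|v-v'|⁻²`. No
  -- boundary term at the singularity survives.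
  have t1 : Filter.Tendsto (fun n => ∫ v', g v' * pd i (fun v' => regKernel K n (v - v') * P v') v')
      Filter.atTop
      (nhds (∫ v', g v' * (K (v - v') * pd i P v' - pd i K (v - v') * P v'))) := by
    refine tendsto_integral_of_dominated_convergence _ hmeas1 (h1.const_mul (1 + C))
      (fun n => ae_of_all _ (hbound n)) ?_
    filter_upwards [ae_sub_ne_zero v] with v' hv'
    refine tendsto_const_nhds.congr' ?_
    filter_upwards [eventually_two_lt_mul_norm hv'] with n hn
    rw [hpd, hK.regKernel_eq hn.le, pd, pd, pd, (hK.regKernel_eventuallyEq hn).fderiv_eq]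
  have t2 : Filter.Tendsto (fun n => ∫ v', G v' i * (regKernel K n (v - v') * P v'))
      Filter.atTop (nhds (∫ v', G v' i * (K (v - v') * P v'))) := by
    refine tendsto_integral_of_dominated_convergence _ hmeas2 h2.norm
      (fun n => ae_of_all _ (hbound2 n)) ?_
    filter_upwards [ae_sub_ne_zero v] with v' hv'
    refine tendsto_const_nhds.congr' ?_
    filter_upwards [eventually_two_lt_mul_norm hv'] with n hn
    rw [hK.regKernel_eq hn.le]
  have := tendsto_nhds_unique (t1.congr hn) t2.neg
  calc ∫ v', K (v - v') * (P v' * G v' i) = ∫ v', G v' i * (K (v - v') * P v') := by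
        congr 1 with v'; ring
    _ = -∫ v', g v' * (K (v - v') * pd i P v' - pd i K (v - v') * P v') := by rw [this, neg_neg]
    _ = _ := by
        rw [← integral_neg]; congr 1 with v'; ring

end CoulombKernel

/-! ### Differentiability of convolutions with Coulomb kernels. -/

section Convolution

variable {K : V → ℝ}

lemma integrableOn_singular (r : ℝ) :
    IntegrableOn (fun z : V => (1 + ‖z‖⁻¹) ^ 2) (Metric.ball 0 r) := by
  have h1 : IntegrableOn (fun _ : V => (2 : ℝ)) (Metric.ball 0 r) :=
    integrableOn_const measure_ball_lt_top.ne
  refine (h1.add ((integrableOn_norm_inv_sq r).const_mul 2)).mono' (by fun_prop)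
    (ae_of_all _ fun z => ?_)
  rw [Real.norm_of_nonneg (by positivity)]
  simp only [Pi.add_apply]
  nlinarith [sq_nonneg (‖z‖⁻¹ - 1)]

/-- Near `v` the function `u` is bounded and the singularity is integrable; away from `v` the kernel
is bounded and `u` is integrable. -/
lemma integrable_singular_mul_of_continuous {u : V → ℝ} (hu : Continuous u) (hui : Integrable u)
    (v : V) : Integrable fun v' => (1 + ‖v - v'‖⁻¹) ^ 2 * |u v'| := by
  obtain ⟨M, hM⟩ := (isCompact_closedBall v 1).exists_bound_of_continuousOn hu.continuousOn
  have hM0 : 0 ≤ M := (norm_nonneg _).trans (hM v (by simp))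
  have hi : Integrable ((Metric.ball (0 : V) 1).indicator fun z : V => (1 + ‖z‖⁻¹) ^ 2) :=
    (integrable_indicator_iff measurableSet_ball).2 (integrableOn_singular 1)
  have h2 := ((hi.comp_sub_left v).mul_const M).add (hui.abs.const_mul 4)
  refine h2.mono' ?_ (ae_of_all _ fun v' => ?_)
  · have : Measurable fun v' => (1 + ‖v - v'‖⁻¹) ^ 2 := by fun_prop
    exact (this.mul hu.measurable.abs).aestronglyMeasurable
  rw [Real.norm_of_nonneg (by positivity)]
  simp only [Pi.add_apply]
  by_cases hz : v - v' ∈ Metric.ball (0 : V) 1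
  · rw [Set.indicator_of_mem hz]
    have h3 : |u v'| ≤ M := hM v' (by
      rw [mem_closedBall_iff_norm']
      exact (mem_ball_zero_iff.1 hz).le)
    have : (1 + ‖v - v'‖⁻¹) ^ 2 * |u v'| ≤ (1 + ‖v - v'‖⁻¹) ^ 2 * M := by gcongr
    linarith [abs_nonneg (u v')]
  · rw [Set.indicator_of_notMem hz, zero_mul, zero_add]
    have h1 : 1 ≤ ‖v - v'‖ := by simpa using hz
    have : ‖v - v'‖⁻¹ ≤ 1 := inv_le_one_of_one_le₀ h1
    have ht : 0 ≤ ‖v - v'‖⁻¹ := by positivity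
    gcongr
    nlinarith

/-- Tonelli against the weight `(1+|v|)⁻⁴`. For a merely integrable `u` the convolution need only
converge almost everywhere. -/
lemma ae_integrable_singular_mul {u : V → ℝ} (hui : Integrable u) :
    ∀ᵐ v, Integrable fun v' => (1 + ‖v - v'‖⁻¹) ^ 2 * |u v'| := by
  obtain ⟨D, hD⟩ := exists_lintegral_inv_le
  have hum : AEMeasurable (fun v => ‖u v‖ₑ) := hui.1.enorm
  have hmeas2 : AEMeasurable (fun p : V × V => ENNReal.ofReal (((1 + ‖p.1‖) ^ 4)⁻¹) *
      (ENNReal.ofReal ((1 + ‖p.1 - p.2‖⁻¹) ^ 2) * ‖u p.2‖ₑ)) (volume.prod volume) := by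
    have e1 : Measurable fun p : V × V => ENNReal.ofReal (((1 + ‖p.1‖) ^ 4)⁻¹) := by fun_prop
    have e2 : Measurable fun p : V × V => ENNReal.ofReal ((1 + ‖p.1 - p.2‖⁻¹) ^ 2) := by fun_prop
    refine e1.aemeasurable.mul (e2.aemeasurable.mul ?_)
    exact hum.comp_quasiMeasurePreserving Measure.quasiMeasurePreserving_snd
  have hle : ∫⁻ v, ∫⁻ v', ENNReal.ofReal (((1 + ‖v‖) ^ 4)⁻¹) *
      (ENNReal.ofReal ((1 + ‖v - v'‖⁻¹) ^ 2) * ‖u v'‖ₑ) ≤ D * ∫⁻ v', ‖u v'‖ₑ := by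
    rw [lintegral_lintegral_swap hmeas2, ← lintegral_const_mul' _ _ ENNReal.coe_ne_top]
    refine lintegral_mono fun v' => ?_
    calc _ = ∫⁻ v, ENNReal.ofReal ((1 + ‖v' - v‖⁻¹) ^ 2 * ((1 + ‖v‖) ^ 4)⁻¹) * ‖u v'‖ₑ := by
          refine lintegral_congr fun v => ?_
          rw [← mul_assoc, ← ENNReal.ofReal_mul (by positivity), norm_sub_rev v v', mul_comm (_⁻¹)]
      _ ≤ _ := by
          rw [lintegral_mul_const _ (by fun_prop)]
          gcongr
          exact hD v'
  have hfin := hle.trans_lt (ENNReal.mul_lt_top ENNReal.coe_lt_top hui.2)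
  have hae := ae_lt_top' hmeas2.lintegral_prod_right' hfin.ne
  filter_upwards [hae] with v hv
  have hm : Measurable fun v' => (1 + ‖v - v'‖⁻¹) ^ 2 := by fun_prop
  refine ⟨hm.aestronglyMeasurable.mul hui.1.norm, ?_⟩
  rw [lintegral_const_mul' _ _ ENNReal.ofReal_ne_top] at hv
  have hv2 : ∫⁻ v', ENNReal.ofReal ((1 + ‖v - v'‖⁻¹) ^ 2) * ‖u v'‖ₑ ≠ ⊤ := by
    intro h
    rw [h, ENNReal.mul_top (by simp; positivity)] at hv
    exact lt_irrefl _ hv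
  rw [hasFiniteIntegral_iff_enorm]
  refine lt_of_le_of_lt (le_of_eq (lintegral_congr fun v' => ?_)) hv2.lt_top
  rw [enorm_mul, Real.enorm_of_nonneg (by positivity), Real.enorm_abs]

section LocallyUniform

variable {E : Type*} [NormedAddCommGroup E] [NormedSpace ℝ E]

lemma integrable_smul_kernel {B : V → E} {C : ℝ} (hBm : StronglyMeasurable B)
    (hB : ∀ z, z ≠ 0 → ‖B z‖ ≤ C * (1 + ‖z‖⁻¹) ^ 2) {u : V → ℝ} (hum : AEStronglyMeasurable u) {v : V}
    (hu : Integrable fun v' => (1 + ‖v - v'‖⁻¹) ^ 2 * |u v'|) :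
    Integrable fun v' => u v' • B (v - v') := by
  refine (hu.const_mul C).mono' (hum.smul (hBm.comp_measurable (by fun_prop)).aestronglyMeasurable) ?_
  filter_upwards [ae_sub_ne_zero v] with v' hv'
  rw [norm_smul, Real.norm_eq_abs]
  calc |u v'| * ‖B (v - v')‖ ≤ |u v'| * (C * (1 + ‖v - v'‖⁻¹) ^ 2) := by gcongr; exact hB _ hv'
    _ = _ := by ring

/-- The kernels `A n` and `B` differ only where `|v-v'| ≤ 2/(n+1)`. The singular mass of that ball
tends to zero, and `u` is bounded near a given point, so the error is small uniformly for nearby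
`v`. -/
lemma tendstoLocallyUniformly_integral_smul {A : ℕ → V → E} {B : V → E} {C : ℝ} (hC : 0 ≤ C)
    (hAm : ∀ n, StronglyMeasurable (A n)) (hBm : StronglyMeasurable B)
    (hA : ∀ n z, z ≠ 0 → ‖A n z‖ ≤ C * (1 + ‖z‖⁻¹) ^ 2)
    (hB : ∀ z, z ≠ 0 → ‖B z‖ ≤ C * (1 + ‖z‖⁻¹) ^ 2)
    (hAB : ∀ (n : ℕ) z, 2 < ((n : ℝ) + 1) * ‖z‖ → A n z = B z)
    {u : V → ℝ} (hu : Continuous u) (hui : Integrable u) :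
    TendstoLocallyUniformly (fun n v => ∫ v', u v' • A n (v - v')) (fun v => ∫ v', u v' • B (v - v'))
      Filter.atTop := by
  let ind : ℕ → V → ℝ := fun n => {z : V | ((n : ℝ) + 1) * ‖z‖ ≤ 2}.indicator
    fun z => 2 * C * (1 + ‖z‖⁻¹) ^ 2
  have hset : ∀ n : ℕ, MeasurableSet {z : V | ((n : ℝ) + 1) * ‖z‖ ≤ 2} := fun n =>
    measurableSet_le (by fun_prop) measurable_const
  have hsub : ∀ n : ℕ, {z : V | ((n : ℝ) + 1) * ‖z‖ ≤ 2} ⊆ Metric.ball 0 3 := by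
    intro n z hz
    have hz : ((n : ℝ) + 1) * ‖z‖ ≤ 2 := hz
    rw [mem_ball_zero_iff]
    nlinarith [norm_nonneg z, mul_nonneg (Nat.cast_nonneg (α := ℝ) n) (norm_nonneg z)]
  have hi : ∀ n, Integrable (ind n) := fun n =>
    (integrable_indicator_iff (hset n)).2 (IntegrableOn.mono_set ((integrableOn_singular 3).const_mul _) (hsub n))
  have hlim : Filter.Tendsto (fun n => ∫ z, ind n z) Filter.atTop (nhds 0) := by
    have h3 : Integrable ((Metric.ball (0 : V) 3).indicator fun z : V => 2 * C * (1 + ‖z‖⁻¹) ^ 2) :=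
      (integrable_indicator_iff measurableSet_ball).2 ((integrableOn_singular 3).const_mul _)
    have := tendsto_integral_of_dominated_convergence (F := ind) (f := fun _ : V => (0 : ℝ)) _
      (fun n => (hi n).1) h3 (fun n => ae_of_all _ fun z => ?_) ?_
    · simpa using this
    · rw [Real.norm_of_nonneg (Set.indicator_nonneg (fun z _ => by positivity) z)]
      exact Set.indicator_le_indicator_of_subset (hsub n) (fun z => by positivity) z
    · filter_upwards [ae_sub_ne_zero 0] with z hz
      refine tendsto_const_nhds.congr' ?_
      filter_upwards [eventually_two_lt_mul_norm (z := z) (by simpa using hz)] with n hn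
      rw [eq_comm]
      exact Set.indicator_of_notMem (by simpa using hn) _
  rw [Metric.tendstoLocallyUniformly_iff]
  intro ε hε x
  -- The radius is `4 = 1 + 3`: `v` ranges within `1` of `x`, and the differing region lies within
  -- `3` of `v`.
  obtain ⟨M, hM⟩ := (isCompact_closedBall x 4).exists_bound_of_continuousOn hu.continuousOn
  have hM0 : 0 ≤ M := (norm_nonneg _).trans (hM x (by simp))
  refine ⟨Metric.ball x 1, Metric.ball_mem_nhds _ one_pos, ?_⟩
  have h0 : Filter.Tendsto (fun n => M * ∫ z, ind n z) Filter.atTop (nhds 0) := by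
    simpa using hlim.const_mul M
  filter_upwards [h0.eventually (gt_mem_nhds hε)] with n hn v hv
  refine lt_of_le_of_lt ?_ hn
  have hv1 := integrable_singular_mul_of_continuous hu hui v
  rw [dist_eq_norm, ← integral_sub (integrable_smul_kernel hBm hB hu.aestronglyMeasurable hv1)
    (integrable_smul_kernel (hAm n) (hA n) hu.aestronglyMeasurable hv1),
    ← integral_sub_left_eq_self (ind n) volume v, ← integral_const_mul]
  refine norm_integral_le_of_norm_le (((hi n).comp_sub_left v).const_mul M) ?_
  filter_upwards [ae_sub_ne_zero v] with v' hv'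
  rw [← smul_sub, norm_smul]
  by_cases hz : v - v' ∈ {z : V | ((n : ℝ) + 1) * ‖z‖ ≤ 2}
  · simp only [ind]
    rw [Set.indicator_of_mem hz]
    have hu' : ‖u v'‖ ≤ M := hM v' (by
      have h1 := mem_ball_iff_norm.1 hv
      have h2 := mem_ball_zero_iff.1 (hsub n hz)
      rw [mem_closedBall_iff_norm]
      have : v' - x = (v - x) - (v - v') := by abel
      rw [this]
      linarith [norm_sub_le (v - x) (v - v')])
    gcongr
    refine (norm_sub_le _ _).trans ?_
    linarith [hA n _ hv', hB _ hv']
  · rw [hAB n _ (by simpa using hz), sub_self, norm_zero, mul_zero]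
    exact mul_nonneg hM0 (Set.indicator_nonneg (fun z _ => by positivity) _)

end LocallyUniform

/-- The convolution of a Coulomb kernel with a continuous integrable function is `C¹`. -/
lemma IsCoulombKernel.contDiff_convolution (hK : IsCoulombKernel K) {u : V → ℝ} (hu : Continuous u)
    (hui : Integrable u) : ContDiff ℝ 1 fun v => ∫ v', K (v - v') * u v' := by
  obtain ⟨C, hC0, hC, hCn, hCK⟩ := hK.exists_norm_fderiv_le
  have hr : ∀ n, ContDiff ℝ 1 (regKernel K n) := fun n => (hK.contDiff_regKernel n).of_le (by simp)
  have hle1 : ∀ z : V, ‖z‖⁻¹ ≤ (1 + C) * (1 + ‖z‖⁻¹) ^ 2 := fun z => by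
    have := inv_norm_le_sq z
    have : 0 ≤ C * (1 + ‖z‖⁻¹) ^ 2 := by positivity
    linarith
  have hle2 : ∀ z : V, C * (‖z‖⁻¹) ^ 2 ≤ (1 + C) * (1 + ‖z‖⁻¹) ^ 2 := fun z => by
    have h1 : (‖z‖⁻¹) ^ 2 ≤ (1 + ‖z‖⁻¹) ^ 2 := by
      gcongr; linarith
    have := mul_le_mul_of_nonneg_left h1 hC0
    have : 0 ≤ (1 + ‖z‖⁻¹) ^ 2 := by positivity
    linarith
  have hcf : ∀ n, Continuous (fderiv ℝ (regKernel K n)) := fun n =>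
    (hr n).continuous_fderiv one_ne_zero
  have lu0 := tendstoLocallyUniformly_integral_smul (A := regKernel K) (B := K) (C := 1 + C)
    (by positivity) (fun n => (hr n).continuous.stronglyMeasurable) hK.measurable.stronglyMeasurable
    (fun n z _ => (hK.abs_regKernel_le n z).trans (hle1 z)) (fun z _ => (hK.bound z).trans (hle1 z))
    (fun n z hz => hK.regKernel_eq hz.le) hu hui
  have lu1 := tendstoLocallyUniformly_integral_smul (A := fun n => fderiv ℝ (regKernel K n))
    (B := fderiv ℝ K) (C := 1 + C) (by positivity) (fun n => (hcf n).stronglyMeasurable)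
    (measurable_fderiv ℝ K).stronglyMeasurable
    (fun n z _ => (hC n z).trans (hle2 z)) (fun z hz => (hCK z hz).trans (hle2 z))
    (fun n z hz => (hK.regKernel_eventuallyEq hz).fderiv_eq) hu hui
  have hcont : ∀ n, Continuous fun v => ∫ v', u v' • fderiv ℝ (regKernel K n) (v - v') := by
    intro n
    refine continuous_of_dominated (bound := fun v' => |u v'| * (C * ((n : ℝ) + 1) ^ 2))
      (fun v => ?_) (fun v => ae_of_all _ fun v' => ?_) (hui.abs.mul_const _)
      (ae_of_all _ fun v' => ?_)
    · exact (hu.smul ((hcf n).comp (by fun_prop))).aestronglyMeasurable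
    · rw [norm_smul, Real.norm_eq_abs]
      gcongr
      exact hCn n _
    · exact ((hcf n).comp (continuous_id.sub continuous_const)).const_smul (u v')
  have hderiv : ∀ n v, HasFDerivAt (fun v => ∫ v', u v' • regKernel K n (v - v'))
      (∫ v', u v' • fderiv ℝ (regKernel K n) (v - v')) v := by
    intro n v
    refine hasFDerivAt_integral_of_dominated_of_fderiv_le (s := Set.univ)
      (F := fun v v' => u v' • regKernel K n (v - v'))
      (F' := fun v v' => u v' • fderiv ℝ (regKernel K n) (v - v')) Filter.univ_mem
      (bound := fun v' => |u v'| * (C * ((n : ℝ) + 1) ^ 2))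
      (Filter.Eventually.of_forall fun v => ?_) ?_ ?_ (ae_of_all _ fun v' v _ => ?_)
      (hui.abs.mul_const _) (ae_of_all _ fun v' v _ => ?_)
    · exact (hu.smul ((hr n).continuous.comp (by fun_prop))).aestronglyMeasurable
    · exact integrable_smul_kernel (C := 1 + C) (hr n).continuous.stronglyMeasurable
        (fun z _ => (hK.abs_regKernel_le n z).trans (hle1 z)) hu.aestronglyMeasurable
        (integrable_singular_mul_of_continuous hu hui v)
    · exact (hu.smul ((hcf n).comp (by fun_prop))).aestronglyMeasurable
    · rw [norm_smul, Real.norm_eq_abs]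
      gcongr
      exact hCn n _
    · have h1 := ((hr n).differentiable one_ne_zero (v - v')).hasFDerivAt.comp v
        ((hasFDerivAt_id v).sub_const v')
      exact h1.const_smul (u v')
  -- The regularized convolutions and their derivatives both converge locally uniformly, so the
  -- limit may be differentiated; its derivative is continuous by the same uniformity.
  have hlim : ∀ v, HasFDerivAt (fun v => ∫ v', u v' • K (v - v'))
      (∫ v', u v' • fderiv ℝ K (v - v')) v := fun v =>
    hasFDerivAt_of_tendstoLocallyUniformlyOn isOpen_univ
      (tendstoLocallyUniformlyOn_univ.2 lu1)
      (fun n v _ => hderiv n v)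
      (fun v _ => (tendstoLocallyUniformlyOn_univ.2 lu0).tendsto_at (Set.mem_univ v))
      (Set.mem_univ v)
  have hfc : Continuous fun v => ∫ v', u v' • fderiv ℝ K (v - v') :=
    lu1.continuous (Filter.Frequently.of_forall hcont)
  have := contDiff_one_iff_hasFDerivAt.2 ⟨_, hfc, hlim⟩
  simpa only [smul_eq_mul, mul_comm] using this

/-- Weak gradients of `C¹` functions are classical. -/
lemma HasWeakGradient.ae_eq_pd {g : V → ℝ} {G : V → V} (h : HasWeakGradient g G)
    (hg : ContDiff ℝ 1 g) (i : Fin 3) : ∀ᵐ v, G v i = pd i g v := by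
  refine ae_eq_of_integral_contDiff_smul_eq (locallyIntegrable_coord h.2.1 i)
    (continuous_pd i hg).locallyIntegrable fun η hη hc => ?_
  have hη1 : ContDiff ℝ 1 η := hη.of_le (by simp)
  have h1 := h.2.2 η hη hc i
  have h2 := integral_mul_fderiv_eq_neg_fderiv_mul_of_integrable (μ := (volume : Measure V))
    (f := g) (g := η) (v := EuclideanSpace.single i 1)
    (((continuous_pd i hg).mul hη.continuous).integrable_of_hasCompactSupport hc.mul_left)
    ((hg.continuous.mul (continuous_pd i hη1)).integrable_of_hasCompactSupport
      (hasCompactSupport_pd i hc).mul_left)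
    ((hg.continuous.mul hη.continuous).integrable_of_hasCompactSupport hc.mul_left)
    (fun x _ => hg.differentiable one_ne_zero x) (fun x _ => hη1.differentiable one_ne_zero x)
  have h3 : ∫ v, G v i * η v = ∫ v, pd i g v * η v := by
    rw [← neg_inj, ← h1]; exact h2
  simpa only [smul_eq_mul, mul_comm] using h3

end Convolution

/-! ### Pointwise bounds of the flux and of the source. -/

lemma exists_abs_pd_phi_le : ∃ C : ℝ, 0 ≤ C ∧ ∀ (i j : Fin 3) (z : V), z ≠ 0 →
    |pd j (phi i j) z| ≤ C * (‖z‖⁻¹) ^ 2 := by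
  choose C hC0 _ _ hC using fun p : Fin 3 × Fin 3 => (isCoulombKernel_phi p.1 p.2).exists_norm_fderiv_le
  refine ⟨∑ p, C p, Finset.sum_nonneg fun p _ => hC0 p, fun i j z hz => ?_⟩
  refine (abs_pd_le _ _ _).trans ((hC (i, j) z hz).trans ?_)
  gcongr
  exact Finset.single_le_sum (f := C) (fun p _ => hC0 p) (Finset.mem_univ (i, j))

lemma pd_sqrtMu (j : Fin 3) (v : V) : pd j sqrtMu v = -(v j * sqrtMu v) := by
  have h1 : HasFDerivAt (fun v : V => ‖v‖ ^ 2) (2 • innerSL ℝ v) v :=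
    (hasStrictFDerivAt_norm_sq v).hasFDerivAt
  have h2 : HasFDerivAt (fun v : V => Real.exp (-‖v‖ ^ 2 / 2))
      (Real.exp (-‖v‖ ^ 2 / 2) • ((2 : ℝ)⁻¹ • -((2 : ℕ) • innerSL ℝ v : V →L[ℝ] ℝ))) v := by
    have := (h1.fun_neg.mul_const (2 : ℝ)⁻¹).exp
    simpa only [div_eq_mul_inv] using this
  have h3 : sqrtMu = fun v => Real.exp (-‖v‖ ^ 2 / 2) := funext sqrtMu_eq
  rw [pd, h3, h2.fderiv]
  simp [inner_eq_sum, mul_comm]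

lemma abs_coord_le (v : V) (i : Fin 3) : |v i| ≤ ‖v‖ := PiLp.norm_apply_le v i

lemma pd_coord_mul_sqrtMu (i j : Fin 3) (v : V) : pd j (fun v => v i * sqrtMu v) v =
    ((if i = j then 1 else 0) - v i * v j) * sqrtMu v := by
  rw [pd_mul (by fun_prop) (contDiff_sqrtMu.differentiable (by simp) v), pd_sqrtMu, pd_coord]
  simp only [eq_comm (a := j)]
  ring

lemma integrable_of_le_majorant {g k : V → ℝ} (hg : AEStronglyMeasurable g) {v : V}
    (hv : majorantInt g v < ⊤) (hk : AEStronglyMeasurable k) {A : ℝ}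
    (h : ∀ v', v - v' ≠ 0 → |k v'| ≤ A * (majorant v v' * |g v'|)) : Integrable k := by
  refine (Integrable.const_mul ?_ A).mono' hk ?_ (g := fun v' => A * (majorant v v' * |g v'|))
  · refine ⟨(measurable_majorant.comp measurable_prodMk_left).aestronglyMeasurable.mul hg.norm, ?_⟩
    rw [hasFiniteIntegral_iff_enorm]
    refine lt_of_le_of_lt (le_of_eq (lintegral_congr fun v' => ?_)) hv
    rw [enorm_mul, Real.enorm_of_nonneg (majorant_nonneg _ _), Real.enorm_abs]
  · filter_upwards [ae_sub_ne_zero v] with v' hv'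
    exact h v' hv'

lemma integral_majorant_mul {g : V → ℝ} (hg : AEStronglyMeasurable g) (v : V) :
    ∫ v', majorant v v' * |g v'| = (majorantInt g v).toReal := by
  rw [integral_eq_lintegral_of_nonneg_ae
    (ae_of_all _ fun v' => mul_nonneg (majorant_nonneg _ _) (abs_nonneg _))
    ((measurable_majorant.comp measurable_prodMk_left).aestronglyMeasurable.mul hg.norm), majorantInt]
  congr 1
  refine lintegral_congr fun v' => ?_
  rw [ENNReal.ofReal_mul (majorant_nonneg _ _), Real.enorm_eq_ofReal_abs]

/-- The integrand of `φ^{ij} * (P ∂_j g)` after integration by parts. -/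
def gradIntegrand (g P : V → ℝ) (i j : Fin 3) (v v' : V) : ℝ :=
  g v' * (pd j (phi i j) (v - v') * P v' - phi i j (v - v') * pd j P v')

/-- After integration by parts the size of `∇g` no longer matters. The hypothesis `hG` only makes
the original convolution converge and does not enter any bound. -/
lemma sigmaConv_grad {g : V → ℝ} {G : V → V} (h : HasWeakGradient g G) {P : V → ℝ}
    (hP : ContDiff ℝ 1 P) (i j : Fin 3) {v : V} (hv : majorantInt g v < ⊤)
    (hb : ∀ v', |P v'| + |pd j P v'| ≤ (1 + ‖v'‖) ^ 5 * sqrtMu v')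
    (hG : Integrable fun v' => ‖v - v'‖⁻¹ * (P v' * G v' j)) :
    Integrable (gradIntegrand g P i j v) ∧
      sigmaConv i j (fun v' => P v' * G v' j) v = ∫ v', gradIntegrand g P i j v v' := by
  obtain ⟨C, hC0, hC⟩ := exists_abs_pd_phi_le
  have hg := h.1.aestronglyMeasurable
  have hm : ∀ v', (1 + ‖v - v'‖⁻¹) ^ 2 * (|P v'| + |pd j P v'|) ≤ majorant v v' := fun v' =>
    mul_le_mul_of_nonneg_left (hb v') (by positivity)
  refine ⟨?_, (isCoulombKernel_phi i j).integral_mul_grad h hP j v ?_ hG⟩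
  · refine integrable_of_le_majorant hg hv ?_ (A := 1 + C) fun v' hv' => ?_
    · exact hg.mul (((((measurable_pd j (phi i j)).comp (by fun_prop)).mul
        hP.continuous.measurable).sub (((measurable_phi i j).comp (by fun_prop)).mul
          (continuous_pd j hP).measurable)).aestronglyMeasurable)
    · rw [gradIntegrand, abs_mul]
      have ht : (0 : ℝ) ≤ ‖v - v'‖⁻¹ := by positivity
      have e1 : |pd j (phi i j) (v - v') * P v'| ≤ C * (1 + ‖v - v'‖⁻¹) ^ 2 * |P v'| := by
        rw [abs_mul]
        gcongr
        refine (hC i j _ hv').trans (mul_le_mul_of_nonneg_left ?_ hC0)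
        nlinarith
      have e2 : |phi i j (v - v') * pd j P v'| ≤ (1 + ‖v - v'‖⁻¹) ^ 2 * |pd j P v'| := by
        rw [abs_mul]
        gcongr
        exact (abs_phi_le _ _ _).trans (inv_norm_le_sq _)
      have hm0 : 0 ≤ (1 + ‖v - v'‖⁻¹) ^ 2 := by positivity
      have e3 : |pd j (phi i j) (v - v') * P v' - phi i j (v - v') * pd j P v'| ≤
          (1 + C) * majorant v v' := by
        refine (abs_sub _ _).trans ?_
        have := mul_nonneg hm0 (abs_nonneg (P v'))
        have := mul_nonneg hC0 (mul_nonneg hm0 (abs_nonneg (pd j P v')))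
        have := mul_le_mul_of_nonneg_left (hm v') hC0
        linarith [hm v']
      calc _ ≤ |g v'| * ((1 + C) * majorant v v') := by gcongr
        _ = _ := by ring
  · refine integrable_of_le_majorant hg hv ?_ (A := 1) fun v' _ => ?_
    · have e : Measurable fun v' : V => (1 + ‖v - v'‖⁻¹) ^ 2 := by fun_prop
      exact e.aestronglyMeasurable.mul ((hP.continuous.abs.add
        (continuous_pd j hP).abs).aestronglyMeasurable.mul hg.norm)
    · rw [abs_of_nonneg (by positivity), ← mul_assoc, one_mul]
      gcongr
      exact hm v'

lemma sqrtMu_bound (j : Fin 3) (v : V) :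
    |sqrtMu v| + |pd j sqrtMu v| ≤ (1 + ‖v‖) ^ 5 * sqrtMu v := by
  have hs := sqrtMu_pos v
  rw [pd_sqrtMu, abs_neg, abs_mul, abs_of_pos hs]
  have h1 : 1 + ‖v‖ ≤ (1 + ‖v‖) ^ 5 := le_self_pow₀ (by linarith [norm_nonneg v]) (by norm_num)
  have := abs_coord_le v j
  calc _ = (1 + |v j|) * sqrtMu v := by ring
    _ ≤ _ := by gcongr; linarith

lemma coord_mul_sqrtMu_bound (i j : Fin 3) (v : V) :
    |v i * sqrtMu v| + |pd j (fun v => v i * sqrtMu v) v| ≤ (1 + ‖v‖) ^ 5 * sqrtMu v := by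
  have hs := sqrtMu_pos v
  rw [pd_coord_mul_sqrtMu, abs_mul, abs_mul, abs_of_pos hs]
  have h1 : (1 + ‖v‖) ^ 2 ≤ (1 + ‖v‖) ^ 5 :=
    pow_le_pow_right₀ (by linarith [norm_nonneg v]) (by norm_num)
  have hi := abs_coord_le v i
  have hj := abs_coord_le v j
  have h2 : |(if i = j then (1 : ℝ) else 0) - v i * v j| ≤ 1 + ‖v‖ * ‖v‖ := by
    refine (abs_sub _ _).trans (add_le_add ?_ ?_)
    · split_ifs <;> simp
    · rw [abs_mul]; gcongr
  calc _ = (|v i| + |(if i = j then (1 : ℝ) else 0) - v i * v j|) * sqrtMu v := by ring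
    _ ≤ _ := by
      gcongr
      nlinarith [norm_nonneg v]

lemma integrable_phi_mul {g P : V → ℝ} (hg : AEStronglyMeasurable g) (hP : Measurable P)
    (i j : Fin 3) {v : V} (hv : majorantInt g v < ⊤) (hb : ∀ v', |P v'| ≤ (1 + ‖v'‖) ^ 5 * sqrtMu v') :
    Integrable fun v' => phi i j (v - v') * (P v' * g v') := by
  refine integrable_of_le_majorant hg hv ?_ (A := 1) fun v' _ => ?_
  · exact ((measurable_phi i j).comp (by fun_prop)).aestronglyMeasurable.mul
      (hP.aestronglyMeasurable.mul hg)
  · rw [abs_mul, abs_mul, one_mul, ← mul_assoc, majorant]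
    have := (abs_phi_le i j (v - v')).trans (inv_norm_le_sq _)
    gcongr
    exact hb v'

lemma integral_sum_sum {a : Fin 3 → Fin 3 → V → ℝ} (h : ∀ i j, Integrable (a i j)) :
    ∑ i, ∑ j, ∫ v, a i j v = ∫ v, ∑ i, ∑ j, a i j v := by
  rw [integral_finsetSum _ fun i _ => integrable_finsetSum _ fun j _ => h i j]
  exact Finset.sum_congr rfl fun i _ => (integral_finsetSum _ fun j _ => h i j).symm

lemma inv_norm_sq_le (v v' : V) :
    (‖v - v'‖⁻¹) ^ 2 ≤ ((1 + ‖v‖) ^ 2)⁻¹ * ((1 + ‖v'‖) ^ 2 * (1 + ‖v - v'‖⁻¹) ^ 2) := by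
  calc (‖v - v'‖⁻¹) ^ 2 ≤ ((1 + ‖v‖)⁻¹ * (1 + ‖v'‖) * (1 + ‖v - v'‖⁻¹)) ^ 2 := by
        gcongr; exact inv_norm_sub_le v v'
    _ = _ := by rw [mul_pow, mul_pow, inv_pow]; ring

lemma abs_sum_sum_le {D : Fin 3 → Fin 3 → ℝ} {B : ℝ} (hD : ∀ i j, |D i j| ≤ B) (ξ : V) :
    |∑ i, ∑ j, ξ i * D i j| ≤ 9 * (‖ξ‖ * B) := by
  calc |∑ i, ∑ j, ξ i * D i j| ≤ ∑ i, ∑ j, |ξ i * D i j| :=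
        (Finset.abs_sum_le_sum_abs _ _).trans
          (Finset.sum_le_sum fun i _ => Finset.abs_sum_le_sum_abs _ _)
    _ ≤ ∑ i : Fin 3, ∑ j : Fin 3, ‖ξ‖ * B :=
        Finset.sum_le_sum fun i _ => Finset.sum_le_sum fun j _ => by
          rw [abs_mul]
          exact mul_le_mul (abs_coord_le ξ i) (hD i j) (abs_nonneg _) (norm_nonneg _)
    _ = _ := by simp; ring

/-- Pointwise bound of the kernel of the flux. -/
lemma abs_fluxKernel_le {C : ℝ} (hC0 : 0 ≤ C) {v v' : V} {D : Fin 3 → Fin 3 → ℝ}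
    (hD : ∀ i j, |D i j| ≤ C * (‖v - v'‖⁻¹) ^ 2) (a : ℝ) (b ξ : V) :
    |phiForm (v - v') ξ b - a * ((∑ i, ∑ j, ξ i * D i j) + phiForm (v - v') ξ v')| ≤
      (20 + 9 * C) * (√(modelDensity v a b) * √(modelForm v ξ)) *
        ((1 + ‖v'‖) ^ 5 * (1 + ‖v - v'‖⁻¹) ^ 2) := by
  set U := (1 + ‖v'‖) ^ 5 * (1 + ‖v - v'‖⁻¹) ^ 2 with hUdef
  have hU : 0 ≤ U := by positivity
  have h1 := abs_phiForm_le_modelForm v v' ξ b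
  have h2 := abs_phiForm_right_le v v' ξ
  have h3 := abs_sum_sum_le hD ξ
  have hN1 := sqrt_modelForm_le v a b
  have hN2 := sqrt_mul_abs_le v a b
  have hξ := norm_mul_inv_sq_le v ξ
  have hs := Real.sqrt_nonneg (modelForm v ξ)
  set N := √(modelDensity v a b)
  set m := √(modelForm v ξ)
  set r := √((1 + ‖v‖)⁻¹)
  have h4 : (‖v - v'‖⁻¹) ^ 2 ≤ ((1 + ‖v‖) ^ 2)⁻¹ * U := by
    refine (inv_norm_sq_le v v').trans ?_
    rw [hUdef]
    gcongr
    · linarith [norm_nonneg v']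
    · norm_num
  have h5 : |∑ i, ∑ j, ξ i * D i j| ≤ 9 * C * (m * r) * U := by
    refine h3.trans ?_
    calc 9 * (‖ξ‖ * (C * (‖v - v'‖⁻¹) ^ 2)) ≤ 9 * (‖ξ‖ * (C * (((1 + ‖v‖) ^ 2)⁻¹ * U))) := by gcongr
      _ = 9 * C * (‖ξ‖ * ((1 + ‖v‖) ^ 2)⁻¹) * U := by ring
      _ ≤ _ := by gcongr
  calc _ ≤ |phiForm (v - v') ξ b| +
        |a| * (|∑ i, ∑ j, ξ i * D i j| + |phiForm (v - v') ξ v'|) := by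
        refine (abs_sub _ _).trans ?_
        rw [abs_mul]
        gcongr
        exact abs_add_le _ _
    -- The constant `20 + 9C` is `16` for the form in `ξ` and `b`, `4` for the slot `v'`, and `9C`
    -- for the nine entries of `∂φ`.
    _ ≤ 16 * (m * √(modelForm v b)) * U + |a| * (9 * C * (m * r) * U + 4 * (m * r) * U) := by gcongr
    _ = 16 * (√(modelForm v b) * m) * U + (9 * C + 4) * ((r * |a|) * m) * U := by ring
    _ ≤ 16 * (N * m) * U + (9 * C + 4) * (N * m) * U := by gcongr
    _ = _ := by ring

/-- Pointwise bound of the kernel of the source. -/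
lemma abs_sourceKernel_le {C : ℝ} (hC0 : 0 ≤ C) {v v' : V} {D : Fin 3 → Fin 3 → ℝ}
    (hD : ∀ i j, |D i j| ≤ C * (‖v - v'‖⁻¹) ^ 2) (a : ℝ) (b : V) :
    |-phiForm (v - v') b v' + a * ((∑ i, ∑ j, v' i * D i j) - ∑ i, phi i i (v - v') +
      phiForm (v - v') v' v')| ≤
      (8 + 9 * C) * (√(modelDensity v a b) * √((1 + ‖v‖)⁻¹)) *
        ((1 + ‖v'‖) ^ 5 * (1 + ‖v - v'‖⁻¹) ^ 2) := by
  set U := (1 + ‖v'‖) ^ 5 * (1 + ‖v - v'‖⁻¹) ^ 2 with hUdef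
  have hU : 0 ≤ U := by positivity
  have hn := norm_nonneg v'
  have h2 := abs_phiForm_right_le v v' b
  have h3 := abs_sum_sum_le hD v'
  have hN1 := sqrt_modelForm_le v a b
  have hN2 := sqrt_mul_abs_le v a b
  have hrr : √((1 + ‖v‖)⁻¹) * √((1 + ‖v‖)⁻¹) = (1 + ‖v‖)⁻¹ := Real.mul_self_sqrt (by positivity)
  have hr0 : 0 ≤ √((1 + ‖v‖)⁻¹) := Real.sqrt_nonneg _
  set N := √(modelDensity v a b)
  set r := √((1 + ‖v‖)⁻¹)
  have ht : 0 ≤ ‖v - v'‖⁻¹ := by positivity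
  have ht1 : 1 + ‖v - v'‖⁻¹ ≤ (1 + ‖v - v'‖⁻¹) ^ 2 := by nlinarith
  have hinv : ((1 + ‖v‖) ^ 2)⁻¹ ≤ (1 + ‖v‖)⁻¹ := by
    gcongr; nlinarith [norm_nonneg v]
  have h4 : ‖v'‖ * (‖v - v'‖⁻¹) ^ 2 ≤ (1 + ‖v‖)⁻¹ * U := by
    calc _ ≤ (1 + ‖v'‖) * (((1 + ‖v‖) ^ 2)⁻¹ * ((1 + ‖v'‖) ^ 2 * (1 + ‖v - v'‖⁻¹) ^ 2)) := by
          gcongr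
          · linarith
          · exact inv_norm_sq_le v v'
      _ = ((1 + ‖v‖) ^ 2)⁻¹ * ((1 + ‖v'‖) ^ 3 * (1 + ‖v - v'‖⁻¹) ^ 2) := by ring
      _ ≤ _ := by
          rw [hUdef]
          gcongr
          · linarith
          · norm_num
  have h5 : |∑ i, ∑ j, v' i * D i j| ≤ 9 * C * ((1 + ‖v‖)⁻¹ * U) := by
    refine h3.trans ?_
    calc 9 * (‖v'‖ * (C * (‖v - v'‖⁻¹) ^ 2)) = 9 * C * (‖v'‖ * (‖v - v'‖⁻¹) ^ 2) := by ring
      _ ≤ _ := by gcongr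
  have h6 : ‖v - v'‖⁻¹ ≤ (1 + ‖v‖)⁻¹ * U := by
    refine (inv_norm_sub_le v v').trans ?_
    rw [mul_assoc]
    gcongr
    rw [hUdef]
    gcongr
    exact le_self_pow₀ (by linarith) (by norm_num)
  have h7 : |∑ i, phi i i (v - v')| ≤ 3 * ((1 + ‖v‖)⁻¹ * U) := by
    calc |∑ i, phi i i (v - v')| ≤ ∑ i : Fin 3, |phi i i (v - v')| := Finset.abs_sum_le_sum_abs _ _
      _ ≤ ∑ i : Fin 3, (1 + ‖v‖)⁻¹ * U :=
          Finset.sum_le_sum fun i _ => (abs_phi_le _ _ _).trans h6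
      _ = _ := by simp
  have h8 : |phiForm (v - v') v' v'| ≤ (1 + ‖v‖)⁻¹ * U := by
    rw [abs_of_nonneg (phiForm_self_nonneg _ _)]
    refine (phiForm_self_le _ _).trans ?_
    calc _ ≤ (1 + ‖v'‖) ^ 2 * ((1 + ‖v‖)⁻¹ * (1 + ‖v'‖) * (1 + ‖v - v'‖⁻¹)) := by
          gcongr
          · linarith
          · exact inv_norm_sub_le v v'
      _ = (1 + ‖v‖)⁻¹ * ((1 + ‖v'‖) ^ 3 * (1 + ‖v - v'‖⁻¹)) := by ring
      _ ≤ _ := by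
          rw [hUdef]
          gcongr
          · linarith
          · norm_num
  calc _ ≤ |phiForm (v - v') b v'| + |a| * (|∑ i, ∑ j, v' i * D i j| + |∑ i, phi i i (v - v')| +
          |phiForm (v - v') v' v'|) := by
        refine (abs_add_le _ _).trans ?_
        rw [abs_mul, abs_neg]
        gcongr
        refine (abs_add_le _ _).trans ?_
        gcongr
        exact abs_sub _ _
    _ ≤ 4 * (√(modelForm v b) * r) * U + |a| * (9 * C * ((1 + ‖v‖)⁻¹ * U) +
          3 * ((1 + ‖v‖)⁻¹ * U) + (1 + ‖v‖)⁻¹ * U) := by gcongr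
    _ = 4 * (√(modelForm v b) * r) * U + (9 * C + 4) * ((r * |a|) * r) * U := by
        rw [← hrr]; ring
    _ ≤ 4 * (N * r) * U + (9 * C + 4) * (N * r) * U := by gcongr
    _ = _ := by ring

/-- The pointwise bounds of the flux and of the source by the convolution of the majorant. -/
lemma exists_gamma_bound : ∃ C : ℝ, 0 ≤ C ∧ ∀ (g : V → ℝ) (G : V → V) (f : V → ℝ) (F : V → V),
    HasWeakGradient g G → ∀ v, majorantInt g v < ⊤ →
    (∀ j, Integrable fun v' => (1 + ‖v - v'‖⁻¹) ^ 2 * |sqrtMu v' * G v' j|) →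
    (∀ ξ : V, |∑ i, gammaFlux g G f F i v * ξ i| ≤ C * (majorantInt g v).toReal *
      (√(modelDensity v (f v) (F v)) * √(modelForm v ξ))) ∧
    |gammaSource g G f F v| ≤ C * (majorantInt g v).toReal *
      (√(modelDensity v (f v) (F v)) * √((1 + ‖v‖)⁻¹)) := by
  obtain ⟨C, hC0, hC⟩ := exists_abs_pd_phi_le
  refine ⟨20 + 9 * C, by positivity, fun g G f F h v hv hG => ?_⟩
  have hg := h.1.aestronglyMeasurable
  have hmaj : Integrable fun v' => majorant v v' * |g v'| :=
    integrable_of_le_majorant hg hv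
      ((measurable_majorant.comp measurable_prodMk_left).aestronglyMeasurable.mul hg.norm) (A := 1)
      fun v' _ => by rw [abs_of_nonneg (mul_nonneg (majorant_nonneg _ _) (abs_nonneg _)), one_mul]
  have hs1 : ContDiff ℝ 1 sqrtMu := contDiff_sqrtMu.of_le (by simp)
  have hcs : ∀ i : Fin 3, ContDiff ℝ 1 fun v => v i * sqrtMu v := fun i =>
    (by fun_prop : ContDiff ℝ 1 fun v : V => v i).mul hs1
  have hGm : ∀ j, AEStronglyMeasurable (fun v' => G v' j) volume := fun j =>
    (locallyIntegrable_coord h.2.1 j).aestronglyMeasurable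
  have htm : Measurable fun v' : V => ‖v - v'‖⁻¹ := by fun_prop
  have ht : ∀ v', (0 : ℝ) ≤ ‖v - v'‖⁻¹ := fun v' => by positivity
  have hG1 : ∀ j, Integrable fun v' => ‖v - v'‖⁻¹ * (sqrtMu v' * G v' j) := fun j => by
    refine (hG j).mono' (htm.aestronglyMeasurable.mul
      (hs1.continuous.aestronglyMeasurable.mul (hGm j))) (ae_of_all _ fun v' => ?_)
    rw [norm_mul, Real.norm_of_nonneg (ht v'), Real.norm_eq_abs]
    gcongr
    exact inv_norm_le_sq _
  -- Only `μ^{1/2}∇g` is known to be integrable. The extra factor `v'` costs nothing, since `|v'| ≤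
  -- |v| + |v-v'|` and the kernel cancels `|v-v'|`.
  have hG2 : ∀ i j, Integrable fun v' => ‖v - v'‖⁻¹ * (v' i * sqrtMu v' * G v' j) := fun i j => by
    refine ((hG j).const_mul (1 + ‖v‖)).mono' (htm.aestronglyMeasurable.mul
      ((hcs i).continuous.aestronglyMeasurable.mul (hGm j))) (ae_of_all _ fun v' => ?_)
    rw [norm_mul, Real.norm_of_nonneg (ht v'), Real.norm_eq_abs, mul_assoc, abs_mul (v' i),
      ← mul_assoc, ← mul_assoc]
    refine mul_le_mul_of_nonneg_right ?_ (abs_nonneg _)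
    have h1 : ‖v'‖ ≤ ‖v‖ + ‖v - v'‖ := by
      have := norm_sub_le v (v - v')
      rwa [sub_sub_cancel] at this
    have h2 : ‖v - v'‖⁻¹ * ‖v - v'‖ ≤ 1 := inv_mul_le_one
    have h3 := ht v'
    calc ‖v - v'‖⁻¹ * |v' i| ≤ ‖v - v'‖⁻¹ * (‖v‖ + ‖v - v'‖) := by
          gcongr; exact (abs_coord_le v' i).trans h1
      _ ≤ ‖v - v'‖⁻¹ * ‖v‖ + 1 := by rw [mul_add]; gcongr
      _ ≤ (1 + ‖v‖) * (1 + ‖v - v'‖⁻¹) ^ 2 := by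
          have := norm_nonneg v
          nlinarith [mul_nonneg this h3, mul_nonneg this (sq_nonneg ‖v - v'‖⁻¹), sq_nonneg ‖v - v'‖⁻¹]
  have hbs : ∀ v', |sqrtMu v'| ≤ (1 + ‖v'‖) ^ 5 * sqrtMu v' := fun v' =>
    (le_add_of_nonneg_right (abs_nonneg _)).trans (sqrtMu_bound 0 v')
  have hbc : ∀ i v', |v' i * sqrtMu v'| ≤ (1 + ‖v'‖) ^ 5 * sqrtMu v' := fun i v' =>
    (le_add_of_nonneg_right (abs_nonneg _)).trans (coord_mul_sqrtMu_bound i 0 v')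
  have a1 := fun i j => integrable_phi_mul hg measurable_sqrtMu i j hv hbs
  have a2 := fun i j => integrable_phi_mul hg (hcs i).continuous.measurable i j hv (hbc i)
  have c1 := fun i j => sigmaConv_grad h hs1 i j hv (sqrtMu_bound j) (hG1 j)
  have c2 := fun i j => sigmaConv_grad h (hcs i) i j hv (coord_mul_sqrtMu_bound i j) (hG2 i j)
  have hconv : ∀ {k : V → ℝ} {X : ℝ}, (∀ v', v - v' ≠ 0 → |k v'| ≤
      (20 + 9 * C) * X * (majorant v v' * |g v'|)) →
      |∫ v', k v'| ≤ (20 + 9 * C) * (majorantInt g v).toReal * X := by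
    intro k X hk
    rw [← Real.norm_eq_abs]
    refine (norm_integral_le_of_norm_le (hmaj.const_mul ((20 + 9 * C) * X)) ?_).trans_eq ?_
    · filter_upwards [ae_sub_ne_zero v] with v' hv'
      exact hk v' hv'
    · rw [integral_const_mul, integral_majorant_mul hg]; ring
  constructor
  · intro ξ
    have e1 : ∑ i, gammaFlux g G f F i v * ξ i =
        ∫ v', ∑ i, ∑ j, (phi i j (v - v') * (sqrtMu v' * g v') * F v j -
          gradIntegrand g sqrtMu i j v v' * f v) * ξ i := by
      have hI : ∀ i j, Integrable fun v' => (phi i j (v - v') * (sqrtMu v' * g v') * F v j -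
          gradIntegrand g sqrtMu i j v v' * f v) * ξ i := fun i j =>
        (((a1 i j).mul_const _).sub ((c1 i j).1.mul_const _)).mul_const _
      rw [← integral_sum_sum hI]
      refine Finset.sum_congr rfl fun i _ => ?_
      rw [gammaFlux, Finset.sum_mul]
      refine Finset.sum_congr rfl fun j _ => ?_
      rw [integral_mul_const, integral_sub ((a1 i j).mul_const _) ((c1 i j).1.mul_const _),
        integral_mul_const, integral_mul_const, (c1 i j).2, sigmaConv]
    rw [e1]
    refine hconv fun v' hv' => ?_
    have hk := abs_fluxKernel_le hC0 (v := v) (v' := v') (fun i j => hC i j _ hv') (f v) (F v) ξ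
    -- As `∂_j μ^{1/2} = -v_j μ^{1/2}`, the differentiated Gaussian again produces a value of the
    -- form `φ(v-v')`, with `v'` in the second slot.
    have e2 : ∑ i, ∑ j, (phi i j (v - v') * (sqrtMu v' * g v') * F v j -
          gradIntegrand g sqrtMu i j v v' * f v) * ξ i =
        (phiForm (v - v') ξ (F v) - f v * ((∑ i, ∑ j, ξ i * pd j (phi i j) (v - v')) +
          phiForm (v - v') ξ v')) * (sqrtMu v' * g v') := by
      simp only [gradIntegrand, pd_sqrtMu, phiForm, Fin.sum_univ_three]
      ring
    rw [e2, abs_mul, abs_mul, abs_of_pos (sqrtMu_pos v')]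
    have := sqrtMu_pos v'
    refine (mul_le_mul_of_nonneg_right hk (by positivity)).trans_eq ?_
    rw [majorant]; ring
  · have e1 : gammaSource g G f F v =
        ∫ v', ∑ i, ∑ j, (-(phi i j (v - v') * (v' i * sqrtMu v' * g v') * F v j) +
          gradIntegrand g (fun v => v i * sqrtMu v) i j v v' * f v) := by
      have hI : ∀ i j, Integrable fun v' =>
          -(phi i j (v - v') * (v' i * sqrtMu v' * g v') * F v j) +
            gradIntegrand g (fun v => v i * sqrtMu v) i j v v' * f v := fun i j =>
        ((a2 i j).mul_const _).neg.add ((c2 i j).1.mul_const _)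
      rw [← integral_sum_sum hI]
      refine Finset.sum_congr rfl fun i _ => Finset.sum_congr rfl fun j _ => ?_
      have h3 : Integrable fun v' => -(phi i j (v - v') * (v' i * sqrtMu v' * g v') * F v j) :=
        ((a2 i j).mul_const _).neg
      rw [integral_add h3 ((c2 i j).1.mul_const _), integral_neg,
        integral_mul_const, integral_mul_const, (c2 i j).2, sigmaConv]
    rw [e1]
    refine hconv fun v' hv' => ?_
    have hk := abs_sourceKernel_le hC0 (v := v) (v' := v') (fun i j => hC i j _ hv') (f v) (F v)
    -- The derivative of `v_i μ^{1/2}` is `(δ_{ij} - v_i v_j) μ^{1/2}`, which accounts for the trace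
    -- and for the quadratic term in `v'`.
    have e2 : ∑ i, ∑ j, (-(phi i j (v - v') * (v' i * sqrtMu v' * g v') * F v j) +
          gradIntegrand g (fun v => v i * sqrtMu v) i j v v' * f v) =
        (-phiForm (v - v') (F v) v' + f v * ((∑ i, ∑ j, v' i * pd j (phi i j) (v - v')) -
          ∑ i, phi i i (v - v') + phiForm (v - v') v' v')) * (sqrtMu v' * g v') := by
      rw [phiForm_comm]
      simp only [gradIntegrand, pd_coord_mul_sqrtMu, phiForm, Fin.sum_univ_three]
      simp
      ring
    rw [e2, abs_mul, abs_mul, abs_of_pos (sqrtMu_pos v')]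
    have := sqrtMu_pos v'
    have h20 : (8 + 9 * C) * (√(modelDensity v (f v) (F v)) * √((1 + ‖v‖)⁻¹)) ≤
        (20 + 9 * C) * (√(modelDensity v (f v) (F v)) * √((1 + ‖v‖)⁻¹)) := by
      gcongr; norm_num
    refine (mul_le_mul_of_nonneg_right hk (by positivity)).trans ?_
    refine (mul_le_mul_of_nonneg_right (mul_le_mul_of_nonneg_right h20 (by positivity))
      (by positivity)).trans_eq ?_
    rw [majorant]; ring

/-! ### Gradients of the weights, and measurability. -/

lemma gradient_apply (f : V → ℝ) (v : V) (i : Fin 3) : (∇ f v) i = pd i f v := by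
  have := InnerProductSpace.toDual_symm_apply (𝕜 := ℝ) (E := V) (x := EuclideanSpace.single i 1)
    (y := fderiv ℝ f v)
  rw [pd, ← this, inner_eq_sum]
  simp [gradient]

lemma norm_gradient (f : V → ℝ) (v : V) : ‖∇ f v‖ = ‖fderiv ℝ f v‖ := by
  simp [gradient]

lemma measurable_gradient (f : V → ℝ) : Measurable (∇ f) :=
  (InnerProductSpace.toDual ℝ V).symm.continuous.measurable.comp (measurable_fderiv ℝ f)

/-- For the gradient of the weight there is no anisotropic gain; the isotropic bound yields the
factor `(1+|v|)^{-1/2}` that the undifferentiated `g₃` requires. -/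
lemma sqrt_modelForm_le_mul_norm (v ξ : V) : √(modelForm v ξ) ≤ √((1 + ‖v‖)⁻¹) * ‖ξ‖ := by
  rw [← Real.sqrt_sq (norm_nonneg ξ), ← Real.sqrt_mul (by positivity)]
  apply Real.sqrt_le_sqrt
  have h := crossSq_le v ξ
  have hn := norm_nonneg v
  rw [modelForm, inv_mul_le_iff₀ (by positivity)]
  have : (1 + ‖v‖) ^ 3 * ((1 + ‖v‖)⁻¹ * ‖ξ‖ ^ 2) = (1 + ‖v‖) ^ 2 * ‖ξ‖ ^ 2 := by field_simp
  rw [this]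
  nlinarith [mul_nonneg hn (sq_nonneg ‖ξ‖)]

lemma norm_gradient_weight_le (s : ℝ) {v : V} (hv : v ≠ 0) :
    ‖∇ (weight s) v‖ ≤ |s| * weight s v := by
  have h1 : HasFDerivAt (fun v : V => ‖v‖) (fderiv ℝ (fun v : V => ‖v‖) v) v :=
    ((contDiffAt_norm ℝ hv (n := 1)).differentiableAt one_ne_zero).hasFDerivAt
  have h2 := (h1.const_add 1).rpow_const (p := s) (Or.inl (by positivity : (1 + ‖v‖) ≠ 0))
  have h3 : ‖fderiv ℝ (fun v : V => ‖v‖) v‖ ≤ 1 := by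
    simpa using norm_fderiv_le_of_lipschitz ℝ (lipschitzWith_one_norm (E := V)) (x₀ := v)
  rw [norm_gradient]
  have : weight s = fun v => (1 + ‖v‖) ^ s := rfl
  rw [this, h2.fderiv, norm_smul, norm_mul, Real.norm_eq_abs, Real.norm_of_nonneg (by positivity)]
  calc |s| * (1 + ‖v‖) ^ (s - 1) * ‖fderiv ℝ (fun v : V => ‖v‖) v‖
      ≤ |s| * (1 + ‖v‖) ^ s * 1 := by
        gcongr
        · linarith [norm_nonneg v]
        · linarith
    _ = _ := mul_one _

section Measurability

lemma aestronglyMeasurable_sigmaConv (i j : Fin 3) {u : V → ℝ} (hu : AEStronglyMeasurable u) :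
    AEStronglyMeasurable (sigmaConv i j u) := by
  have hm : Measurable fun p : V × V => phi i j (p.1 - p.2) :=
    (measurable_phi i j).comp (by fun_prop)
  exact AEStronglyMeasurable.integral_prod_right' (f := fun p : V × V => phi i j (p.1 - p.2) * u p.2)
    (hm.aestronglyMeasurable.mul
      (hu.comp_quasiMeasurePreserving Measure.quasiMeasurePreserving_snd))

lemma aestronglyMeasurable_sigmaConv_prod (i j : Fin 3) {u : T3 × V → ℝ}
    (hu : AEStronglyMeasurable u) :
    AEStronglyMeasurable fun z : T3 × V => sigmaConv i j (fun v' => u (z.1, v')) z.2 := by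
  have hm : Measurable fun p : (T3 × V) × V => phi i j (p.1.2 - p.2) :=
    (measurable_phi i j).comp (by fun_prop)
  refine AEStronglyMeasurable.integral_prod_right'
    (f := fun p : (T3 × V) × V => phi i j (p.1.2 - p.2) * u (p.1.1, p.2))
    (hm.aestronglyMeasurable.mul (hu.comp_quasiMeasurePreserving
      (f := fun p : (T3 × V) × V => (p.1.1, p.2)) ?_))
  exact MeasureTheory.QuasiMeasurePreserving.prodMap
    (Measure.quasiMeasurePreserving_fst (μ := (volume : Measure T3)) (ν := (volume : Measure V)))
    (Measure.QuasiMeasurePreserving.id (volume : Measure V))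

lemma aestronglyMeasurable_coord {α : Type*} [MeasurableSpace α] {m : Measure α} {G : α → V}
    (hG : AEStronglyMeasurable G m) (i : Fin 3) : AEStronglyMeasurable (fun a => G a i) m :=
  (EuclideanSpace.proj (𝕜 := ℝ) i).continuous.comp_aestronglyMeasurable hG

lemma measurable_coord_mul_sqrtMu (i : Fin 3) : Measurable fun v : V => v i * sqrtMu v :=
  (by fun_prop : Measurable fun v : V => v i).mul measurable_sqrtMu

variable {g f : V → ℝ} {G F : V → V}

lemma aestronglyMeasurable_gammaFlux (hg : AEStronglyMeasurable g) (hG : AEStronglyMeasurable G)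
    (hf : AEStronglyMeasurable f) (hF : AEStronglyMeasurable F) (i : Fin 3) :
    AEStronglyMeasurable (gammaFlux g G f F i) := by
  have hs := measurable_sqrtMu.aestronglyMeasurable (μ := (volume : Measure V))
  unfold gammaFlux
  refine Finset.aestronglyMeasurable_fun_sum _ fun j _ => ?_
  exact ((aestronglyMeasurable_sigmaConv i j (hs.mul hg)).mul (aestronglyMeasurable_coord hF j)).sub
    ((aestronglyMeasurable_sigmaConv i j (hs.mul (aestronglyMeasurable_coord hG j))).mul hf)

lemma aestronglyMeasurable_gammaSource (hg : AEStronglyMeasurable g) (hG : AEStronglyMeasurable G)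
    (hf : AEStronglyMeasurable f) (hF : AEStronglyMeasurable F) :
    AEStronglyMeasurable (gammaSource g G f F) := by
  have hs := fun i => (measurable_coord_mul_sqrtMu i).aestronglyMeasurable (μ := (volume : Measure V))
  unfold gammaSource
  refine Finset.aestronglyMeasurable_fun_sum _ fun i _ =>
    Finset.aestronglyMeasurable_fun_sum _ fun j _ => ?_
  exact ((aestronglyMeasurable_sigmaConv i j ((hs i).mul hg)).mul
    (aestronglyMeasurable_coord hF j)).neg.add
    ((aestronglyMeasurable_sigmaConv i j ((hs i).mul (aestronglyMeasurable_coord hG j))).mul hf)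

lemma aestronglyMeasurable_gammaAction (hg : AEStronglyMeasurable g) (hG : AEStronglyMeasurable G)
    (hf : AEStronglyMeasurable f) (hF : AEStronglyMeasurable F) {ψ : V → ℝ} {Ψ : V → V}
    (hψ : AEStronglyMeasurable ψ) (hΨ : AEStronglyMeasurable Ψ) :
    AEStronglyMeasurable (gammaAction g G f F ψ Ψ) := by
  unfold gammaAction
  exact (Finset.aestronglyMeasurable_fun_sum _ fun i _ =>
    (aestronglyMeasurable_gammaFlux hg hG hf hF i).mul (aestronglyMeasurable_coord hΨ i)).neg.add
    ((aestronglyMeasurable_gammaSource hg hG hf hF).mul hψ)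

lemma aestronglyMeasurable_weakIntegrand (ϑ : ℝ) {h : V → ℝ} {H : V → V}
    (hg : AEStronglyMeasurable g) (hG : AEStronglyMeasurable G)
    (hf : AEStronglyMeasurable f) (hF : AEStronglyMeasurable F)
    (hh : AEStronglyMeasurable h) (hH : AEStronglyMeasurable H) :
    AEStronglyMeasurable (weakIntegrand ϑ g G f F h H) := by
  have hw := (continuous_weight (2 * ϑ)).aestronglyMeasurable (μ := (volume : Measure V))
  exact aestronglyMeasurable_gammaAction hg hG hf hF (hw.mul hh)
    ((hw.smul hH).add (hh.smul (measurable_gradient _).aestronglyMeasurable))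

lemma aestronglyMeasurable_weakIntegrandXV (ϑ : ℝ) {g₁ g₂ g₃ : T3 × V → ℝ} {G₁ G₂ G₃ : T3 × V → V}
    (h1 : AEStronglyMeasurable g₁) (H1 : AEStronglyMeasurable G₁)
    (h2 : AEStronglyMeasurable g₂) (H2 : AEStronglyMeasurable G₂)
    (h3 : AEStronglyMeasurable g₃) (H3 : AEStronglyMeasurable G₃) :
    AEStronglyMeasurable (weakIntegrandXV ϑ g₁ G₁ g₂ G₂ g₃ G₃) := by
  have hs : AEStronglyMeasurable (fun z : T3 × V => sqrtMu z.2) :=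
    (measurable_sqrtMu.comp measurable_snd).aestronglyMeasurable
  have hs' (i : Fin 3) : AEStronglyMeasurable (fun z : T3 × V => z.2 i * sqrtMu z.2) :=
    ((measurable_coord_mul_sqrtMu i).comp measurable_snd).aestronglyMeasurable
  have hw : AEStronglyMeasurable (fun z : T3 × V => weight (2 * ϑ) z.2) :=
    ((continuous_weight (2 * ϑ)).measurable.comp measurable_snd).aestronglyMeasurable
  have hdw : AEStronglyMeasurable (fun z : T3 × V => ∇ (weight (2 * ϑ)) z.2) :=
    ((measurable_gradient (weight (2 * ϑ))).comp measurable_snd).aestronglyMeasurable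
  refine AEStronglyMeasurable.add (AEStronglyMeasurable.neg
    (Finset.aestronglyMeasurable_fun_sum _ fun i _ => AEStronglyMeasurable.mul
      (Finset.aestronglyMeasurable_fun_sum _ fun j _ => ?_)
      (aestronglyMeasurable_coord ((hw.smul H3).add (h3.smul hdw)) i)))
    (AEStronglyMeasurable.mul (Finset.aestronglyMeasurable_fun_sum _ fun i _ =>
      Finset.aestronglyMeasurable_fun_sum _ fun j _ => ?_) (hw.mul h3))
  · exact ((aestronglyMeasurable_sigmaConv_prod i j (hs.mul h1)).mul
      (aestronglyMeasurable_coord H2 j)).sub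
      ((aestronglyMeasurable_sigmaConv_prod i j (hs.mul (aestronglyMeasurable_coord H1 j))).mul h2)
  · exact ((aestronglyMeasurable_sigmaConv_prod i j ((hs' i).mul h1)).mul
      (aestronglyMeasurable_coord H2 j)).neg.add
      ((aestronglyMeasurable_sigmaConv_prod i j
        ((hs' i).mul (aestronglyMeasurable_coord H1 j))).mul h2)

end Measurability

/-! ### The pointwise bound of the distributional pairing. -/

/-- The integrand that dominates the pairing. -/
def pairBound (ϑ : ℝ) (g₁ : V → ℝ) (g₂ : V → ℝ) (G₂ : V → V) (g₃ : V → ℝ) (G₃ : V → V) (v : V) :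
    ℝ≥0∞ :=
  majorantInt g₁ v * ENNReal.ofReal (weight (2 * ϑ) v *
    (√(modelDensity v (g₂ v) (G₂ v)) * √(modelDensity v (g₃ v) (G₃ v))))

lemma ae_integrable_singular_mul_grad {G : V → V} (hG : GammaDefined G) :
    ∀ᵐ v, ∀ j, Integrable fun v' => (1 + ‖v - v'‖⁻¹) ^ 2 * |sqrtMu v' * G v' j| := by
  rw [ae_all_iff]
  intro j
  exact ae_integrable_singular_mul ((EuclideanSpace.proj (𝕜 := ℝ) j).integrable_comp hG)

/-- The bound of the action of `Γ[g₁, g₂]` on `m g₃` with an arbitrary scalar factor `m`. -/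
lemma exists_enorm_gammaAction_le : ∃ C : ℝ≥0, ∀ (g₁ g₂ g₃ : V → ℝ) (G₁ G₂ G₃ : V → V),
    HasWeakGradient g₁ G₁ → GammaDefined G₁ → (∀ᵐ v, majorantInt g₁ v < ⊤) →
    ∀ᵐ v, ∀ (m : V → ℝ) (p : V → V) (B : ℝ), 0 ≤ B → |m v| ≤ B → ‖p v‖ ≤ B →
      ‖gammaAction g₁ G₁ g₂ G₂ (fun v => m v * g₃ v) (fun v => m v • G₃ v + g₃ v • p v) v‖ₑ ≤
        C * (majorantInt g₁ v * ENNReal.ofReal (B *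
          (√(modelDensity v (g₂ v) (G₂ v)) * √(modelDensity v (g₃ v) (G₃ v))))) ∧
      ‖gammaSource g₁ G₁ g₂ G₂ v * (m v * g₃ v)‖ₑ ≤
        C * (majorantInt g₁ v * ENNReal.ofReal (B *
          (√(modelDensity v (g₂ v) (G₂ v)) * √(modelDensity v (g₃ v) (G₃ v))))) := by
  obtain ⟨C, hC0, hC⟩ := exists_gamma_bound
  refine ⟨(3 * C).toNNReal, fun g₁ g₂ g₃ G₁ G₂ G₃ h hG hfin => ?_⟩
  -- The exceptional null set depends only on `g₁` and `G₁`, so the bound holds at once for the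
  -- weight and for all its approximations.
  filter_upwards [hfin, ae_integrable_singular_mul_grad hG] with v hv hGv m p B hB hm hp
  obtain ⟨h1, h2⟩ := hC g₁ G₁ g₂ G₂ h v hv hGv
  set L := (majorantInt g₁ v).toReal
  have hL : 0 ≤ L := ENNReal.toReal_nonneg
  have hN1 := sqrt_modelForm_le v (g₃ v) (G₃ v)
  have hN2 := sqrt_mul_abs_le v (g₃ v) (G₃ v)
  have hp' := sqrt_modelForm_le_mul_norm v (p v)
  have hr0 : 0 ≤ √((1 + ‖v‖)⁻¹) := Real.sqrt_nonneg _
  have hN0 : 0 ≤ √(modelDensity v (g₂ v) (G₂ v)) := Real.sqrt_nonneg _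
  have hN3 : 0 ≤ √(modelDensity v (g₃ v) (G₃ v)) := Real.sqrt_nonneg _
  set N := √(modelDensity v (g₂ v) (G₂ v))
  set N' := √(modelDensity v (g₃ v) (G₃ v))
  set r := √((1 + ‖v‖)⁻¹)
  have e1 := h1 (G₃ v)
  have e2 := h1 (p v)
  set X := ∑ i, gammaFlux g₁ G₁ g₂ G₂ i v * (G₃ v) i
  set Y := ∑ i, gammaFlux g₁ G₁ g₂ G₂ i v * (p v) i
  set S := gammaSource g₁ G₁ g₂ G₂ v
  have e3 : gammaAction g₁ G₁ g₂ G₂ (fun v => m v * g₃ v) (fun v => m v • G₃ v + g₃ v • p v) v =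
      -(m v * X + g₃ v * Y) + S * (m v * g₃ v) := by
    simp only [gammaAction, X, Y, S, Fin.sum_univ_three, PiLp.add_apply, PiLp.smul_apply, smul_eq_mul]
    ring
  have f1 : |m v * X| ≤ C * L * (B * (N * N')) := by
    rw [abs_mul]
    calc |m v| * |X| ≤ B * (C * L * (N * N')) := by
          gcongr
          exact e1.trans (by gcongr)
      _ = _ := by ring
  -- The gradient of the factor pairs with `g₃` itself; the `r = (1+|v|)^{-1/2}` gained from `p`
  -- combines with `|g₃|` into the zero-order part of its density.
  have f2 : |g₃ v * Y| ≤ C * L * (B * (N * N')) := by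
    rw [abs_mul]
    calc |g₃ v| * |Y| ≤ |g₃ v| * (C * L * (N * (r * B))) := by
          gcongr
          exact e2.trans (by gcongr; exact hp'.trans (by gcongr))
      _ = C * L * (B * (N * (r * |g₃ v|))) := by ring
      _ ≤ _ := by gcongr
  have f3 : |S * (m v * g₃ v)| ≤ C * L * (B * (N * N')) := by
    rw [abs_mul, abs_mul]
    calc |S| * (|m v| * |g₃ v|) ≤ (C * L * (N * r)) * (B * |g₃ v|) := by gcongr
      _ = C * L * (B * (N * (r * |g₃ v|))) := by ring
      _ ≤ _ := by gcongr
  have hconv : ∀ x : ℝ, |x| ≤ 3 * (C * L * (B * (N * N'))) → ‖x‖ₑ ≤ (3 * C).toNNReal *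
      (majorantInt g₁ v * ENNReal.ofReal (B * (N * N'))) := by
    intro x hx
    rw [Real.enorm_eq_ofReal_abs]
    refine (ENNReal.ofReal_le_ofReal hx).trans_eq ?_
    rw [show 3 * (C * L * (B * (N * N'))) = (3 * C) * (L * (B * (N * N'))) by ring,
      ENNReal.ofReal_mul (by positivity), ENNReal.ofReal_mul hL, ENNReal.ofReal_toReal hv.ne,
      ENNReal.ofReal]
  have hpos : 0 ≤ C * L * (B * (N * N')) := by positivity
  refine ⟨hconv _ ?_, hconv _ (by linarith)⟩
  rw [e3]
  refine (abs_add_le _ _).trans ?_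
  rw [abs_neg]
  linarith [abs_add_le (m v * X) (g₃ v * Y)]

lemma exists_enorm_weakIntegrand_le (ϑ : ℝ) : ∃ C : ℝ≥0, ∀ (g₁ g₂ g₃ : V → ℝ) (G₁ G₂ G₃ : V → V),
    HasWeakGradient g₁ G₁ → GammaDefined G₁ → (∀ᵐ v, majorantInt g₁ v < ⊤) →
    ∀ᵐ v, ‖weakIntegrand ϑ g₁ G₁ g₂ G₂ g₃ G₃ v‖ₑ ≤ C * pairBound ϑ g₁ g₂ G₂ g₃ G₃ v := by
  obtain ⟨C, hC⟩ := exists_enorm_gammaAction_le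
  refine ⟨C * (1 + |2 * ϑ|).toNNReal, fun g₁ g₂ g₃ G₁ G₂ G₃ h hG hfin => ?_⟩
  filter_upwards [hC g₁ g₂ g₃ G₁ G₂ G₃ h hG hfin, ae_sub_ne_zero 0] with v hv hv0
  have hw := (weight_pos (2 * ϑ) v).le
  refine (hv (weight (2 * ϑ)) (∇ (weight (2 * ϑ))) ((1 + |2 * ϑ|) * weight (2 * ϑ) v) (by positivity)
    ?_ ?_).1.trans_eq ?_
  · rw [abs_of_nonneg hw]
    nlinarith [mul_nonneg (abs_nonneg (2 * ϑ)) hw]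
  · refine (norm_gradient_weight_le _ (by simpa using hv0)).trans ?_
    linarith
  · rw [pairBound, mul_assoc (1 + _), ENNReal.ofReal_mul (by positivity), ENNReal.ofReal]
    push_cast
    ring

/-! ### Compactly supported `C¹` approximations of the weight. -/

/-- The weight with `|v|` replaced by `√(|v|² + ε)`. -/
def regWeight (s ε : ℝ) (v : V) : ℝ := (1 + √(‖v‖ ^ 2 + ε)) ^ s

lemma regWeight_zero (s : ℝ) (v : V) : regWeight s 0 v = weight s v := by
  simp [regWeight, weight, Real.sqrt_sq]

lemma contDiff_regWeight (s : ℝ) {ε : ℝ} (hε : 0 < ε) : ContDiff ℝ 1 (regWeight s ε) := by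
  unfold regWeight
  refine ContDiff.rpow_const_of_ne ?_ fun v => by positivity
  exact contDiff_const.add (((contDiff_norm_sq ℝ).add contDiff_const).sqrt fun v => by positivity)

/-- The gradient of `regWeight`. -/
def regWeightGrad (s ε : ℝ) (v : V) : V :=
  (s * (1 + √(‖v‖ ^ 2 + ε)) ^ (s - 1) * (√(‖v‖ ^ 2 + ε))⁻¹) • v

lemma gradient_regWeight (s : ℝ) {ε : ℝ} {v : V} (h : 0 < ‖v‖ ^ 2 + ε) :
    ∇ (regWeight s ε) v = regWeightGrad s ε v := by
  have h1 : HasFDerivAt (fun v : V => ‖v‖ ^ 2) (2 • innerSL ℝ v) v :=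
    (hasStrictFDerivAt_norm_sq v).hasFDerivAt
  have h2 := ((h1.add_const ε).sqrt h.ne').const_add 1
  have h3 := h2.rpow_const (p := s) (Or.inl (by positivity : 1 + √(‖v‖ ^ 2 + ε) ≠ 0))
  ext i
  rw [gradient_apply, pd]
  have : regWeight s ε = fun v => (1 + √(‖v‖ ^ 2 + ε)) ^ s := rfl
  rw [this, h3.fderiv]
  simp [regWeightGrad]
  have := (Real.sqrt_pos.2 h).ne'
  field_simp
  simp [EuclideanSpace.inner_single_right]

lemma regWeight_le (s : ℝ) {ε : ℝ} (h0 : 0 ≤ ε) (h1 : ε ≤ 1) (v : V) :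
    regWeight s ε v ≤ 2 ^ |s| * weight s v := by
  have hv := norm_nonneg v
  have e1 : ‖v‖ ≤ √(‖v‖ ^ 2 + ε) := Real.le_sqrt_of_sq_le (by linarith)
  have e2 : √(‖v‖ ^ 2 + ε) ≤ ‖v‖ + 1 := Real.sqrt_le_iff.2 ⟨by linarith, by nlinarith⟩
  rw [regWeight, weight]
  rcases le_total 0 s with hs | hs
  · rw [abs_of_nonneg hs, ← Real.mul_rpow (by norm_num) (by positivity)]
    exact Real.rpow_le_rpow (by positivity) (by linarith) hs
  · calc (1 + √(‖v‖ ^ 2 + ε)) ^ s ≤ (1 + ‖v‖) ^ s :=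
          Real.rpow_le_rpow_of_nonpos (by positivity) (by linarith) hs
      _ ≤ 2 ^ |s| * (1 + ‖v‖) ^ s :=
          le_mul_of_one_le_left (by positivity) (Real.one_le_rpow (by norm_num) (abs_nonneg s))

lemma norm_regWeightGrad_le (s : ℝ) {ε : ℝ} (h0 : 0 ≤ ε) (h1 : ε ≤ 1) (v : V) :
    ‖regWeightGrad s ε v‖ ≤ |s| * (2 ^ |s| * weight s v) := by
  refine le_trans ?_ (mul_le_mul_of_nonneg_left (regWeight_le s h0 h1 v) (abs_nonneg s))
  have e1 : ‖v‖ ≤ √(‖v‖ ^ 2 + ε) := Real.le_sqrt_of_sq_le (by linarith)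
  have e3 : 0 ≤ √(‖v‖ ^ 2 + ε) := Real.sqrt_nonneg _
  rw [regWeightGrad, norm_smul, norm_mul, norm_mul, Real.norm_eq_abs, regWeight,
    Real.norm_of_nonneg (by positivity), Real.norm_of_nonneg (by positivity), mul_assoc, mul_assoc]
  gcongr
  calc (1 + √(‖v‖ ^ 2 + ε)) ^ (s - 1) * ((√(‖v‖ ^ 2 + ε))⁻¹ * ‖v‖)
      ≤ (1 + √(‖v‖ ^ 2 + ε)) ^ s * 1 := by
        gcongr
        · linarith
        · linarith
        · exact inv_mul_le_one_of_le₀ e1 e3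
    _ = _ := mul_one _

lemma tendsto_inv_succ : Filter.Tendsto (fun n : ℕ => ((n : ℝ) + 1)⁻¹) Filter.atTop (nhds 0) := by
  simpa using tendsto_one_div_add_atTop_nhds_zero_nat (𝕜 := ℝ)

lemma tendsto_regWeight (s : ℝ) (v : V) :
    Filter.Tendsto (fun ε => regWeight s ε v) (nhds 0) (nhds (weight s v)) := by
  rw [← regWeight_zero]
  have : Continuous fun ε => regWeight s ε v := by
    unfold regWeight
    exact Continuous.rpow_const (by fun_prop) fun ε => Or.inl (by positivity)
  exact this.tendsto 0

lemma tendsto_regWeightGrad (s : ℝ) {v : V} (hv : v ≠ 0) :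
    Filter.Tendsto (fun ε => regWeightGrad s ε v) (nhds 0) (nhds (∇ (weight s) v)) := by
  have hn : 0 < ‖v‖ := norm_pos_iff.2 hv
  rw [show weight s = regWeight s 0 from funext fun v => (regWeight_zero s v).symm,
    gradient_regWeight s (by positivity)]
  have h1 : ContinuousAt (fun ε => (√(‖v‖ ^ 2 + ε))⁻¹) 0 :=
    ContinuousAt.inv₀ (by fun_prop) (by simpa using hv)
  have h2 : Continuous fun ε => (1 + √(‖v‖ ^ 2 + ε)) ^ (s - 1) :=
    Continuous.rpow_const (by fun_prop) fun ε => Or.inl (by positivity)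
  exact ((continuousAt_const.mul h2.continuousAt).mul h1).smul continuousAt_const

lemma exists_norm_gradient_cutoff_le : ∃ M : ℝ, 0 ≤ M ∧ ∀ v : V, ‖∇ (cutoff : V → ℝ) v‖ ≤ M := by
  obtain ⟨M, hM⟩ := (contDiff_cutoff.continuous_fderiv (by simp)).bounded_above_of_compact_support
    (cutoff.hasCompactSupport.fderiv ℝ)
  exact ⟨M, (norm_nonneg _).trans (hM 0), fun v => (norm_gradient _ v).trans_le (hM v)⟩

lemma gradient_mul {f g : V → ℝ} {v : V} (hf : DifferentiableAt ℝ f v)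
    (hg : DifferentiableAt ℝ g v) :
    ∇ (fun v => f v * g v) v = f v • ∇ g v + g v • ∇ f v := by
  ext i
  simp only [gradient_apply, PiLp.add_apply, PiLp.smul_apply, smul_eq_mul, pd_mul hf hg i]
  ring

lemma gradient_comp_smul {f : V → ℝ} {c : ℝ} {v : V} (hf : Differentiable ℝ f) :
    ∇ (fun v => f (c • v)) v = c • ∇ f (c • v) := by
  ext i
  simp only [gradient_apply, PiLp.smul_apply, smul_eq_mul, pd]
  have h1 : HasFDerivAt (fun v : V => c • v) (c • ContinuousLinearMap.id ℝ V) v :=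
    (hasFDerivAt_id v).const_smul c
  have h2 := (hf (c • v)).hasFDerivAt.comp v h1
  have : (fun v => f (c • v)) = f ∘ fun v => c • v := rfl
  rw [this, h2.fderiv]
  simp

/-- The power weights are limits of compactly supported `C¹` functions with the same bounds. -/
lemma exists_weight_approx (s : ℝ) : ∃ (C : ℝ) (W : ℕ → V → ℝ), 0 ≤ C ∧
    (∀ n, ContDiff ℝ 1 (W n)) ∧ (∀ n, HasCompactSupport (W n)) ∧
    (∀ n v, |W n v| ≤ C * weight s v) ∧ (∀ n v, ‖∇ (W n) v‖ ≤ C * weight s v) ∧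
    (∀ v, Filter.Tendsto (fun n => W n v) Filter.atTop (nhds (weight s v))) ∧
    ∀ v, v ≠ 0 → Filter.Tendsto (fun n => ∇ (W n) v) Filter.atTop (nhds (∇ (weight s) v)) := by
  obtain ⟨M, hM0, hM⟩ := exists_norm_gradient_cutoff_le
  set e : ℕ → ℝ := fun n => ((n : ℝ) + 1)⁻¹
  have he0 (n) : 0 < e n := by positivity
  have he1 (n) : e n ≤ 1 := inv_le_one_of_one_le₀ (by linarith [n.cast_nonneg (α := ℝ)])
  have hdc : Differentiable ℝ (cutoff : V → ℝ) := contDiff_cutoff.differentiable (by simp)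
  have hcd (n : ℕ) : ContDiff ℝ 1 fun v : V => cutoff (e n • v) :=
    (contDiff_cutoff.of_le (by simp)).comp (contDiff_const_smul (e n))
  have hgrad (n : ℕ) (v : V) : ∇ (fun v => regWeight s (e n) v * cutoff (e n • v)) v =
      regWeight s (e n) v • e n • ∇ (cutoff : V → ℝ) (e n • v) +
        cutoff (e n • v) • regWeightGrad s (e n) v := by
    rw [gradient_mul ((contDiff_regWeight s (he0 n)).differentiable one_ne_zero v)
      ((hcd n).differentiable one_ne_zero v), gradient_comp_smul hdc,
      gradient_regWeight s (by have := he0 n; positivity)]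
  have hw0 (n v) : 0 ≤ regWeight s (e n) v := by unfold regWeight; positivity
  have hc0 (v : V) : 0 ≤ cutoff v := cutoff.nonneg
  have hc1 (v : V) : cutoff v ≤ 1 := cutoff.le_one
  have hpow : (0 : ℝ) ≤ 2 ^ |s| := by positivity
  have htc (v : V) : Filter.Tendsto (fun n => cutoff (e n • v)) Filter.atTop (nhds 1) := by
    have : Filter.Tendsto (fun n => cutoff (e n • v)) Filter.atTop (nhds (cutoff ((0 : ℝ) • v))) :=
      (cutoff.continuous.tendsto _).comp (tendsto_inv_succ.smul_const v)
    rwa [zero_smul, cutoff_eq_one (by simp)] at this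
  -- The term `M` comes from the gradient of the cutoff, `|s|` from that of the power, and `2 ^ |s|`
  -- from replacing `|v|` by `√(|v|²+ε)`, which smooths the kink at the origin.
  refine ⟨2 ^ |s| * (M + 1 + |s|), fun n v => regWeight s (e n) v * cutoff (e n • v), by positivity,
    fun n => (contDiff_regWeight s (he0 n)).mul (hcd n), fun n => ?_, fun n v => ?_, fun n v => ?_,
    fun v => ?_, fun v hv => ?_⟩
  · refine hasCompactSupport_of_eq_zero (R := 2 * (n + 1)) fun v hv => ?_
    have hpos : (0 : ℝ) < n + 1 := by positivity
    change regWeight s (e n) v * cutoff (e n • v) = 0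
    rw [cutoff_eq_zero, mul_zero]
    rw [norm_smul, Real.norm_of_nonneg (he0 n).le]
    change 2 ≤ ((n : ℝ) + 1)⁻¹ * ‖v‖
    rw [inv_mul_eq_div, le_div_iff₀ hpos]
    exact hv
  · have hw := (weight_pos s v).le
    rw [abs_of_nonneg (mul_nonneg (hw0 n v) (hc0 _))]
    have h1 := regWeight_le s (he0 n).le (he1 n) v
    calc _ ≤ 2 ^ |s| * weight s v * 1 := by gcongr; exacts [hc0 _, hc1 _]
      _ ≤ 2 ^ |s| * weight s v * (M + 1 + |s|) := by
          gcongr; linarith [abs_nonneg s]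
      _ = _ := by ring
  · have hw := (weight_pos s v).le
    have h1 := regWeight_le s (he0 n).le (he1 n) v
    have h2 := norm_regWeightGrad_le s (he0 n).le (he1 n) v
    rw [hgrad]
    refine (norm_add_le _ _).trans ?_
    rw [norm_smul, norm_smul, norm_smul, Real.norm_of_nonneg (hw0 n v), Real.norm_of_nonneg (hc0 _),
      Real.norm_of_nonneg (he0 n).le]
    calc _ ≤ 2 ^ |s| * weight s v * (1 * M) + 1 * (|s| * (2 ^ |s| * weight s v)) := by
          gcongr; exacts [he1 n, hM _, hc1 _]
      _ ≤ 2 ^ |s| * (M + 1 + |s|) * weight s v := by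
          nlinarith [mul_nonneg hpow hw]
  · simpa using ((tendsto_regWeight s v).comp tendsto_inv_succ).mul (htc v)
  · simp only [hgrad]
    have h1 : Filter.Tendsto (fun n => e n • ∇ (cutoff : V → ℝ) (e n • v)) Filter.atTop (nhds 0) := by
      refine squeeze_zero_norm (a := fun n => e n * M) (fun n => ?_) ?_
      · rw [norm_smul, Real.norm_of_nonneg (he0 n).le]
        exact mul_le_mul_of_nonneg_left (hM _) (he0 n).le
      · simpa using tendsto_inv_succ.mul_const M
    have h2 := (((tendsto_regWeight s v).comp tendsto_inv_succ).smul h1).add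
      ((htc v).smul ((tendsto_regWeightGrad s hv).comp tendsto_inv_succ))
    simpa using h2

/-! ### The classical pairing equals the distributional one. -/

section ClassicalPairing

variable {g₁ g₂ g₃ : V → ℝ} {G₁ G₂ G₃ : V → V}

lemma HasWeakGradient.ae_eq_gradient {g : V → ℝ} {G : V → V} (h : HasWeakGradient g G)
    (hg : ContDiff ℝ 1 g) : G =ᵐ[volume] ∇ g := by
  have := ae_all_iff.2 fun i => h.ae_eq_pd hg i
  filter_upwards [this] with v hv
  ext i
  rw [hv i, gradient_apply]

lemma HasWeakGradient.congr {g : V → ℝ} {G G' : V → V} (h : HasWeakGradient g G)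
    (hG : G =ᵐ[volume] G') : HasWeakGradient g G' := by
  refine ⟨h.1, h.2.1.congr hG, fun η hη hc i => ?_⟩
  rw [h.2.2 η hη hc i]
  congr 1
  refine integral_congr_ae ?_
  filter_upwards [hG] with v hv
  simp only [hv]

lemma sigmaConv_congr (i j : Fin 3) {u u' : V → ℝ} (h : u =ᵐ[volume] u') :
    sigmaConv i j u = sigmaConv i j u' := by
  funext v
  refine integral_congr_ae ?_
  filter_upwards [h] with v' hv'
  simp only [hv']

lemma weakIntegrand_congr (ϑ : ℝ) {G₁' G₂' : V → V} (h1 : G₁ =ᵐ[volume] G₁')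
    (h2 : G₂ =ᵐ[volume] G₂') :
    weakIntegrand ϑ g₁ G₁ g₂ G₂ g₃ G₃ =ᵐ[volume] weakIntegrand ϑ g₁ G₁' g₂ G₂' g₃ G₃ := by
  have e1 (i j) : sigmaConv i j (fun v' => sqrtMu v' * G₁ v' j) =
      sigmaConv i j (fun v' => sqrtMu v' * G₁' v' j) :=
    sigmaConv_congr i j (by filter_upwards [h1] with v hv; rw [hv])
  have e2 (i j) : sigmaConv i j (fun v' => v' i * sqrtMu v' * G₁ v' j) =
      sigmaConv i j (fun v' => v' i * sqrtMu v' * G₁' v' j) :=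
    sigmaConv_congr i j (by filter_upwards [h1] with v hv; rw [hv])
  filter_upwards [h2] with v hv
  simp only [weakIntegrand, gammaAction, gammaFlux, gammaSource, e1, e2, hv]

lemma contDiff_sigmaConv (i j : Fin 3) {u : V → ℝ} (hu : Continuous u) (hui : Integrable u) :
    ContDiff ℝ 1 (sigmaConv i j u) :=
  (isCoulombKernel_phi i j).contDiff_convolution hu hui

lemma contDiff_pd (i : Fin 3) {f : V → ℝ} (hf : ContDiff ℝ 2 f) : ContDiff ℝ 1 (pd i f) :=
  (hf.fderiv_right (m := 1) (by norm_num)).clm_apply contDiff_const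

lemma integrable_sqrtMu_mul (hg : AEStronglyMeasurable g₁) {v : V} (hv : majorantInt g₁ v < ⊤) :
    Integrable fun v' => sqrtMu v' * g₁ v' := by
  refine integrable_of_le_majorant hg hv (measurable_sqrtMu.aestronglyMeasurable.mul hg) (A := 1)
    fun v' _ => ?_
  have hs := sqrtMu_pos v'
  rw [abs_mul, abs_of_pos hs, one_mul, majorant]
  gcongr
  have h1 : 1 ≤ (1 + ‖v - v'‖⁻¹) ^ 2 :=
    one_le_pow₀ (by linarith [inv_nonneg.2 (norm_nonneg (v - v'))])
  have h2 : 1 ≤ (1 + ‖v'‖) ^ 5 := one_le_pow₀ (by linarith [norm_nonneg v'])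
  calc sqrtMu v' = 1 * (1 * sqrtMu v') := by ring
    _ ≤ _ := by gcongr

/-- The flux is built from convolutions with continuous integrable functions and from first
derivatives of `g₂`. Finiteness of `majorantInt` at a single point is enough for `μ^{1/2}g₁` to be
integrable, since the majorant dominates `μ^{1/2}`. -/
lemma contDiff_gammaFlux (h1 : ContDiff ℝ 1 g₁) (h2 : ContDiff ℝ 2 g₂) (hG : GammaDefined (∇ g₁))
    {v : V} (hv : majorantInt g₁ v < ⊤) (i : Fin 3) :
    ContDiff ℝ 1 (gammaFlux g₁ (∇ g₁) g₂ (∇ g₂) i) := by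
  unfold gammaFlux
  refine ContDiff.sum fun j _ => ?_
  have hs := contDiff_sqrtMu.continuous
  refine ((contDiff_sigmaConv i j (hs.mul h1.continuous)
    (integrable_sqrtMu_mul h1.continuous.aestronglyMeasurable hv)).mul ?_).sub
    ((contDiff_sigmaConv i j (hs.mul ?_) ?_).mul (h2.of_le (by norm_num)))
  · simpa only [gradient_apply] using contDiff_pd j h2
  · simpa only [gradient_apply] using continuous_pd j h1
  · exact (EuclideanSpace.proj (𝕜 := ℝ) j).integrable_comp hG

lemma measurable_modelDensity_uncurry :
    Measurable fun p : V × ℝ × V => modelDensity p.1 p.2.1 p.2.2 := by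
  have hi : Measurable fun p : V × ℝ × V => inner ℝ p.1 p.2.2 := measurable_fst.inner measurable_snd.snd
  have h1 : Measurable fun p : V × ℝ × V => ‖p.1‖ := measurable_fst.norm
  have h2 : Measurable fun p : V × ℝ × V => ‖p.2.2‖ := measurable_snd.snd.norm
  exact ((((h1.const_add 1).pow_const 3).inv.mul ((h2.pow_const 2).add
    (((h1.pow_const 2).mul (h2.pow_const 2)).sub (hi.pow_const 2)))).add
    ((h1.const_add 1).inv.mul (measurable_snd.fst.pow_const 2)))

lemma aemeasurable_modelDensity {α : Type*} [MeasurableSpace α] {m : Measure α} {q : α → V}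
    {f : α → ℝ} {F : α → V} (hp : AEMeasurable (fun a => (q a, f a, F a)) m) :
    AEMeasurable (fun a => modelDensity (q a) (f a) (F a)) m := by
  have := measurable_modelDensity_uncurry.comp_aemeasurable hp
  exact this

lemma aemeasurable_pairBound (ϑ : ℝ) (h1 : AEStronglyMeasurable g₁) (h2 : AEStronglyMeasurable g₂)
    (H2 : AEStronglyMeasurable G₂) (h3 : AEStronglyMeasurable g₃) (H3 : AEStronglyMeasurable G₃) :
    AEMeasurable (pairBound ϑ g₁ g₂ G₂ g₃ G₃) := by
  have p2 := (aemeasurable_id (μ := (volume : Measure V))).prodMk (h2.aemeasurable.prodMk H2.aemeasurable)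
  have p3 := (aemeasurable_id (μ := (volume : Measure V))).prodMk (h3.aemeasurable.prodMk H3.aemeasurable)
  refine (measurable_lintegral_majorant h1.enorm).aemeasurable.mul (AEMeasurable.ennreal_ofReal ?_)
  exact (continuous_weight _).aemeasurable.mul
    ((aemeasurable_modelDensity p2).sqrt.mul
      (aemeasurable_modelDensity p3).sqrt)

/-- The `C¹` function `W Φ i` has compact support and is an admissible test function for the weak
gradient of `g₃`; the product rule distributes the derivative. -/
lemma integral_mul_div_eq (h3 : HasWeakGradient g₃ G₃) {Φ : Fin 3 → V → ℝ}
    (hΦ : ∀ i, ContDiff ℝ 1 (Φ i)) {W : V → ℝ} (hW : ContDiff ℝ 1 W) (hc : HasCompactSupport W) :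
    Integrable (fun v => W v * (∑ i, pd i (Φ i) v) * g₃ v) ∧
    Integrable (fun v => -∑ i, Φ i v * (W v • G₃ v + g₃ v • ∇ W v) i) ∧
    ∫ v, W v * (∑ i, pd i (Φ i) v) * g₃ v =
      ∫ v, -∑ i, Φ i v * (W v • G₃ v + g₃ v • ∇ W v) i := by
  have hint {f k : V → ℝ} (hf : LocallyIntegrable f) (hk : Continuous k) (hkc : HasCompactSupport k) :
      Integrable fun v => k v * f v := hf.integrable_smul_left_of_hasCompactSupport hk hkc
  have a1 (i) : Integrable fun v => (W v * pd i (Φ i) v) * g₃ v :=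
    hint h3.1 (hW.continuous.mul (continuous_pd i (hΦ i))) hc.mul_right
  have a2 (i) : Integrable fun v => (pd i W v * Φ i v) * g₃ v :=
    hint h3.1 ((continuous_pd i hW).mul (hΦ i).continuous) (hasCompactSupport_pd i hc).mul_right
  have a3 (i) : Integrable fun v => (W v * Φ i v) * G₃ v i :=
    hint (locallyIntegrable_coord h3.2.1 i) (hW.continuous.mul (hΦ i).continuous) hc.mul_right
  have e1 : (fun v => W v * (∑ i, pd i (Φ i) v) * g₃ v) =
      fun v => ∑ i, (W v * pd i (Φ i) v) * g₃ v := by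
    funext v; rw [Finset.mul_sum, Finset.sum_mul]
  have e2 : (fun v => -∑ i, Φ i v * (W v • G₃ v + g₃ v • ∇ W v) i) =
      fun v => ∑ i, (-((W v * Φ i v) * G₃ v i) - (pd i W v * Φ i v) * g₃ v) := by
    funext v
    rw [← Finset.sum_neg_distrib]
    refine Finset.sum_congr rfl fun i _ => ?_
    simp only [PiLp.add_apply, PiLp.smul_apply, smul_eq_mul, gradient_apply]
    ring
  have a4 (i) : Integrable fun v => -((W v * Φ i v) * G₃ v i) - (pd i W v * Φ i v) * g₃ v :=
    (a3 i).neg.sub (a2 i)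
  rw [e1, e2]
  refine ⟨integrable_finsetSum _ fun i _ => a1 i, integrable_finsetSum _ fun i _ => a4 i, ?_⟩
  rw [integral_finsetSum _ fun i _ => a1 i, integral_finsetSum _ fun i _ => a4 i]
  refine Finset.sum_congr rfl fun i _ => ?_
  have h := h3.integral_mul_pd (hW.mul (hΦ i)) hc.mul_right i
  have hp (v) : g₃ v * pd i (fun v => W v * Φ i v) v =
      (W v * pd i (Φ i) v) * g₃ v + (pd i W v * Φ i v) * g₃ v := by
    rw [pd_mul (hW.differentiable one_ne_zero v) ((hΦ i).differentiable one_ne_zero v)]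
    ring
  have h' : ∫ v, g₃ v * pd i (fun v => W v * Φ i v) v = -∫ v, G₃ v i * (W v * Φ i v) := h
  simp only [hp] at h'
  rw [integral_add (a1 i) (a2 i)] at h'
  have e4 : ∫ v, (-((W v * Φ i v) * G₃ v i) - (pd i W v * Φ i v) * g₃ v) =
      -(∫ v, (W v * Φ i v) * G₃ v i) - ∫ v, (pd i W v * Φ i v) * g₃ v := by
    rw [← integral_neg]
    exact integral_sub (a3 i).neg (a2 i)
  have : ∫ v, G₃ v i * (W v * Φ i v) = ∫ v, (W v * Φ i v) * G₃ v i := by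
    simp only [mul_comm]
  linarith

/-- The weight is neither compactly supported nor in general `C¹` at the origin, so the integration
by parts is done with the approximations `W n`. The limit is dominated on the classical side by the
assumed integrability and on the weak side by `pairBound`. -/
lemma integral_classicalIntegrand_of_gradient (ϑ : ℝ) (h1 : ContDiff ℝ 1 g₁) (h2 : ContDiff ℝ 2 g₂)
    (hw1 : HasWeakGradient g₁ (∇ g₁)) (hw3 : HasWeakGradient g₃ G₃) (hG : GammaDefined (∇ g₁))
    (hfin : ∀ᵐ v, majorantInt g₁ v < ⊤)
    (hb : ∫⁻ v, pairBound ϑ g₁ g₂ (∇ g₂) g₃ G₃ v < ⊤)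
    (hci : Integrable (classicalIntegrand ϑ g₁ g₂ g₃)) :
    ∫ v, classicalIntegrand ϑ g₁ g₂ g₃ v =
      ∫ v, weakIntegrand ϑ g₁ (∇ g₁) g₂ (∇ g₂) g₃ G₃ v := by
  obtain ⟨C, W, hC0, hW, hWc, hWb, hWg, hWt, hWgt⟩ := exists_weight_approx (2 * ϑ)
  obtain ⟨D, hD⟩ := exists_enorm_gammaAction_le
  obtain ⟨v₀, hv₀⟩ := hfin.exists
  have hΦ (i) := contDiff_gammaFlux h1 h2 hG hv₀ i
  set Φ : Fin 3 → V → ℝ := gammaFlux g₁ (∇ g₁) g₂ (∇ g₂)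
  set S : V → ℝ := gammaSource g₁ (∇ g₁) g₂ (∇ g₂)
  set A : ℕ → V → ℝ := fun n => gammaAction g₁ (∇ g₁) g₂ (∇ g₂) (fun v => W n v * g₃ v)
    (fun v => W n v • G₃ v + g₃ v • ∇ (W n) v)
  have m1 := h1.continuous.aestronglyMeasurable (μ := (volume : Measure V))
  have M1 := hw1.2.1.aestronglyMeasurable
  have m2 := h2.continuous.aestronglyMeasurable (μ := (volume : Measure V))
  have M2 := (measurable_gradient g₂).aestronglyMeasurable (μ := (volume : Measure V))
  have m3 := hw3.1.aestronglyMeasurable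
  have M3 := hw3.2.1.aestronglyMeasurable
  have mW (n) := (hW n).continuous.aestronglyMeasurable (μ := (volume : Measure V))
  have mA (n) : AEStronglyMeasurable (A n) := aestronglyMeasurable_gammaAction m1 M1 m2 M2
    ((mW n).mul m3) (((mW n).smul M3).add (m3.smul (measurable_gradient _).aestronglyMeasurable))
  have mS : AEStronglyMeasurable S := aestronglyMeasurable_gammaSource m1 M1 m2 M2
  set b : V → ℝ≥0∞ := fun v => D * (ENNReal.ofReal C * pairBound ϑ g₁ g₂ (∇ g₂) g₃ G₃ v)
  have mp := aemeasurable_pairBound ϑ m1 m2 M2 m3 M3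
  have mb : AEMeasurable b := (mp.const_mul _).const_mul _
  have hbfin : ∫⁻ v, b v ≠ ⊤ := by
    rw [lintegral_const_mul' _ _ ENNReal.coe_ne_top, lintegral_const_mul' _ _ ENNReal.ofReal_ne_top]
    exact ENNReal.mul_ne_top ENNReal.coe_ne_top (ENNReal.mul_ne_top ENNReal.ofReal_ne_top hb.ne)
  have hbd : ∀ᵐ v, ∀ n, ‖A n v‖ₑ ≤ b v ∧ ‖S v * (W n v * g₃ v)‖ₑ ≤ b v := by
    filter_upwards [hD g₁ g₂ g₃ (∇ g₁) (∇ g₂) G₃ hw1 hG hfin] with v hv n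
    have := hv (W n) (∇ (W n)) (C * weight (2 * ϑ) v)
      (mul_nonneg hC0 (weight_pos _ v).le) (hWb n v) (hWg n v)
    rw [mul_assoc C, ENNReal.ofReal_mul hC0, mul_left_comm (majorantInt g₁ v)] at this
    exact this
  have hbr := integrable_toReal_of_lintegral_ne_top mb hbfin
  have hbt : ∀ᵐ v, b v < ⊤ := ae_lt_top' mb hbfin
  have hSi (n) : Integrable fun v => S v * (W n v * g₃ v) := by
    refine ⟨mS.mul ((mW n).mul m3), lt_of_le_of_lt (lintegral_mono_ae ?_) hbfin.lt_top⟩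
    filter_upwards [hbd] with v hv using (hv n).2
  have key (n) : ∫ v, W n v * Gamma g₁ g₂ v * g₃ v = ∫ v, A n v := by
    obtain ⟨i1, i2, e⟩ := integral_mul_div_eq hw3 hΦ (hW n) (hWc n)
    have e1 : (fun v => W n v * Gamma g₁ g₂ v * g₃ v) = fun v =>
        W n v * (∑ i, pd i (Φ i) v) * g₃ v + S v * (W n v * g₃ v) := by
      funext v; simp only [Gamma, Φ, S]; ring
    rw [e1, integral_add i1 (hSi n), e, ← integral_add i2 (hSi n)]
    rfl
  have hmeas (n) : AEStronglyMeasurable fun v => W n v * Gamma g₁ g₂ v * g₃ v := by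
    obtain ⟨i1, -, -⟩ := integral_mul_div_eq hw3 hΦ (hW n) (hWc n)
    refine (i1.add (hSi n)).1.congr (ae_of_all _ fun v => ?_)
    simp only [Pi.add_apply, Gamma, Φ, S]; ring
  have t1 : Filter.Tendsto (fun n => ∫ v, W n v * Gamma g₁ g₂ v * g₃ v) Filter.atTop
      (nhds (∫ v, classicalIntegrand ϑ g₁ g₂ g₃ v)) := by
    refine tendsto_integral_of_dominated_convergence
      (fun v => C * |classicalIntegrand ϑ g₁ g₂ g₃ v|) hmeas (hci.abs.const_mul C)
      (fun n => ae_of_all _ fun v => ?_) (ae_of_all _ fun v => ?_)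
    · rw [Real.norm_eq_abs, classicalIntegrand, abs_mul, abs_mul, abs_mul, abs_mul,
        abs_of_pos (weight_pos _ v), ← mul_assoc, ← mul_assoc]
      gcongr
      exact hWb n v
    · exact ((hWt v).mul_const _).mul_const _
  -- Here `A n` differs from the weak integrand only through the weight and its gradient, both of
  -- which converge away from the origin.
  have t2 : Filter.Tendsto (fun n => ∫ v, A n v) Filter.atTop
      (nhds (∫ v, weakIntegrand ϑ g₁ (∇ g₁) g₂ (∇ g₂) g₃ G₃ v)) := by
    refine tendsto_integral_of_dominated_convergence (fun v => (b v).toReal) mA hbr (fun n => ?_) ?_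
    · filter_upwards [hbd, hbt] with v hv hvt
      rw [← toReal_enorm]
      exact ENNReal.toReal_mono hvt.ne (hv n).1
    · filter_upwards [ae_sub_ne_zero 0] with v hv
      have hg := hWgt v (by simpa using hv)
      have hgi (i : Fin 3) : Filter.Tendsto (fun n => (W n v • G₃ v + g₃ v • ∇ (W n) v) i)
          Filter.atTop (nhds ((weight (2 * ϑ) v • G₃ v + g₃ v • ∇ (weight (2 * ϑ)) v) i)) :=
        ((EuclideanSpace.proj (𝕜 := ℝ) i).continuous.tendsto _).comp
          (((hWt v).smul_const _).add (hg.const_smul _))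
      exact (tendsto_finsetSum _ fun i _ => (hgi i).const_mul _).neg.add
        (((hWt v).mul_const _).const_mul _)
  exact tendsto_nhds_unique (t1.congr key) t2

lemma pairBound_congr (ϑ : ℝ) {G₂' : V → V} (h2 : G₂ =ᵐ[volume] G₂') :
    pairBound ϑ g₁ g₂ G₂ g₃ G₃ =ᵐ[volume] pairBound ϑ g₁ g₂ G₂' g₃ G₃ := by
  filter_upwards [h2] with v hv
  simp only [pairBound, hv]

/-- The classical pairing agrees with the distributional one. -/
lemma integral_classicalIntegrand (ϑ : ℝ) (h1 : ContDiff ℝ 1 g₁) (h2 : ContDiff ℝ 2 g₂)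
    (hw1 : HasWeakGradient g₁ G₁) (hw2 : HasWeakGradient g₂ G₂) (hw3 : HasWeakGradient g₃ G₃)
    (hG : GammaDefined G₁) (hfin : ∀ᵐ v, majorantInt g₁ v < ⊤)
    (hb : ∫⁻ v, pairBound ϑ g₁ g₂ G₂ g₃ G₃ v < ⊤)
    (hci : Integrable (classicalIntegrand ϑ g₁ g₂ g₃)) :
    ∫ v, classicalIntegrand ϑ g₁ g₂ g₃ v = ∫ v, weakIntegrand ϑ g₁ G₁ g₂ G₂ g₃ G₃ v := by
  have e1 := hw1.ae_eq_gradient h1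
  have e2 := hw2.ae_eq_gradient (h2.of_le (by norm_num))
  have hG' : GammaDefined (∇ g₁) := by
    refine Integrable.congr hG ?_
    filter_upwards [e1] with v hv
    rw [hv]
  rw [lintegral_congr_ae (pairBound_congr ϑ e2)] at hb
  rw [integral_congr_ae (weakIntegrand_congr ϑ e1 e2)]
  exact integral_classicalIntegrand_of_gradient ϑ h1 h2 (hw1.congr e1) hw3 hG' hfin hb hci

end ClassicalPairing

/-! ### From the pointwise bound to the pairings on `ℝ³` and on `𝕋³ × ℝ³`. -/

section Pairing

variable {g₁ g₂ g₃ : T3 × V → ℝ} {G₁ G₂ G₃ : T3 × V → V}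

/-- `pairBound` for functions of `(x, v)`. -/
def pairBoundXV (ϑ : ℝ) (g₁ : T3 × V → ℝ) (g₂ : T3 × V → ℝ) (G₂ : T3 × V → V) (g₃ : T3 × V → ℝ)
    (G₃ : T3 × V → V) (z : T3 × V) : ℝ≥0∞ :=
  majorantInt (fun v => g₁ (z.1, v)) z.2 * ENNReal.ofReal (weight (2 * ϑ) z.2 *
    (√(modelDensity z.2 (g₂ z) (G₂ z)) * √(modelDensity z.2 (g₃ z) (G₃ z))))

lemma pairBoundXV_mk (ϑ : ℝ) (x : T3) (v : V) : pairBoundXV ϑ g₁ g₂ G₂ g₃ G₃ (x, v) =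
    pairBound ϑ (fun v => g₁ (x, v)) (fun v => g₂ (x, v)) (fun v => G₂ (x, v))
      (fun v => g₃ (x, v)) (fun v => G₃ (x, v)) v := rfl

lemma weakIntegrandXV_mk (ϑ : ℝ) (x : T3) (v : V) : weakIntegrandXV ϑ g₁ G₁ g₂ G₂ g₃ G₃ (x, v) =
    weakIntegrand ϑ (fun v => g₁ (x, v)) (fun v => G₁ (x, v)) (fun v => g₂ (x, v))
      (fun v => G₂ (x, v)) (fun v => g₃ (x, v)) (fun v => G₃ (x, v)) v := rfl

lemma classicalIntegrandXV_mk (ϑ : ℝ) (x : T3) (v : V) : classicalIntegrandXV ϑ g₁ g₂ g₃ (x, v) =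
    classicalIntegrand ϑ (fun v => g₁ (x, v)) (fun v => g₂ (x, v)) (fun v => g₃ (x, v)) v := rfl

lemma PairingBound.mono {ϑ : ℝ} {g₁ g₂ g₃ : V → ℝ} {G₁ G₂ G₃ : V → V} {A B : ℝ≥0∞}
    (h : PairingBound ϑ g₁ G₁ g₂ G₂ g₃ G₃ A) (hAB : A ≤ B) : PairingBound ϑ g₁ G₁ g₂ G₂ g₃ G₃ B :=
  ⟨h.1, h.2.1.trans hAB, fun h1 h2 h3 => (h.2.2 h1 h2 h3).trans hAB⟩

lemma PairingBoundXV.mono {ϑ : ℝ} {A B : ℝ≥0∞} (h : PairingBoundXV ϑ g₁ G₁ g₂ G₂ g₃ G₃ A)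
    (hAB : A ≤ B) : PairingBoundXV ϑ g₁ G₁ g₂ G₂ g₃ G₃ B :=
  ⟨h.1, h.2.1.trans hAB, fun h1 h2 h3 => (h.2.2 h1 h2 h3).trans hAB⟩

lemma exists_pairingBound (ϑ : ℝ) : ∃ C : ℝ≥0, ∀ (g₁ g₂ g₃ : V → ℝ) (G₁ G₂ G₃ : V → V),
    HasWeakGradient g₁ G₁ → HasWeakGradient g₂ G₂ → HasWeakGradient g₃ G₃ → GammaDefined G₁ →
    (∀ᵐ v, majorantInt g₁ v < ⊤) → ∫⁻ v, pairBound ϑ g₁ g₂ G₂ g₃ G₃ v < ⊤ →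
    PairingBound ϑ g₁ G₁ g₂ G₂ g₃ G₃ (C * ∫⁻ v, pairBound ϑ g₁ g₂ G₂ g₃ G₃ v) := by
  obtain ⟨C, hC⟩ := exists_enorm_weakIntegrand_le ϑ
  refine ⟨C, fun g₁ g₂ g₃ G₁ G₂ G₃ h1 h2 h3 hG hfin hb => ?_⟩
  have hle : ∫⁻ v, ‖weakIntegrand ϑ g₁ G₁ g₂ G₂ g₃ G₃ v‖ₑ ≤
      C * ∫⁻ v, pairBound ϑ g₁ g₂ G₂ g₃ G₃ v := by
    rw [← lintegral_const_mul' _ _ ENNReal.coe_ne_top]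
    exact lintegral_mono_ae (hC g₁ g₂ g₃ G₁ G₂ G₃ h1 hG hfin)
  have hbound := (enorm_integral_le_lintegral_enorm _).trans hle
  refine ⟨⟨aestronglyMeasurable_weakIntegrand ϑ h1.1.aestronglyMeasurable
    h1.2.1.aestronglyMeasurable h2.1.aestronglyMeasurable h2.2.1.aestronglyMeasurable
    h3.1.aestronglyMeasurable h3.2.1.aestronglyMeasurable,
    hle.trans_lt (ENNReal.mul_lt_top ENNReal.coe_lt_top hb)⟩, hbound, fun c1 c2 hci => ?_⟩
  rwa [integral_classicalIntegrand ϑ c1 c2 h1 h2 h3 hG hfin hb hci]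

lemma aemeasurable_majorantInt_slice (h1 : AEStronglyMeasurable g₁) :
    AEMeasurable fun z : T3 × V => majorantInt (fun v => g₁ (z.1, v)) z.2 := by
  have hq : Measure.QuasiMeasurePreserving (fun p : (T3 × V) × V => (p.1.1, p.2)) :=
    MeasureTheory.QuasiMeasurePreserving.prodMap
      (Measure.quasiMeasurePreserving_fst (μ := (volume : Measure T3)) (ν := (volume : Measure V)))
      (Measure.QuasiMeasurePreserving.id (volume : Measure V))
  have hm : Measurable fun p : (T3 × V) × V => ENNReal.ofReal (majorant p.1.2 p.2) :=
    (measurable_majorant.comp (measurable_fst.snd.prodMk measurable_snd)).ennreal_ofReal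
  exact AEMeasurable.lintegral_prod_right' (f := fun p : (T3 × V) × V =>
    ENNReal.ofReal (majorant p.1.2 p.2) * ‖g₁ (p.1.1, p.2)‖ₑ)
    (hm.aemeasurable.mul (h1.comp_quasiMeasurePreserving hq).enorm)

lemma aemeasurable_modelDensity_slice {g : T3 × V → ℝ} {G : T3 × V → V}
    (h : AEStronglyMeasurable g) (H : AEStronglyMeasurable G) :
    AEMeasurable fun z : T3 × V => modelDensity z.2 (g z) (G z) :=
  aemeasurable_modelDensity (measurable_snd.aemeasurable.prodMk
    (h.aemeasurable.prodMk H.aemeasurable))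

lemma aemeasurable_weight_snd (s : ℝ) : AEMeasurable fun z : T3 × V => weight s z.2 :=
  ((continuous_weight s).measurable.comp measurable_snd).aemeasurable

lemma aemeasurable_pairBound_slice (ϑ : ℝ) (h1 : AEStronglyMeasurable g₁)
    (h2 : AEStronglyMeasurable g₂) (H2 : AEStronglyMeasurable G₂) (h3 : AEStronglyMeasurable g₃)
    (H3 : AEStronglyMeasurable G₃) :
    AEMeasurable (pairBoundXV ϑ g₁ g₂ G₂ g₃ G₃) :=
  (aemeasurable_majorantInt_slice h1).mul (((aemeasurable_weight_snd _).mul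
    ((aemeasurable_modelDensity_slice h2 H2).sqrt.mul
      (aemeasurable_modelDensity_slice h3 H3).sqrt)).ennreal_ofReal)

lemma exists_pairingBoundXV (ϑ : ℝ) : ∃ C : ℝ≥0, ∀ (g₁ g₂ g₃ : T3 × V → ℝ) (G₁ G₂ G₃ : T3 × V → V),
    HasWeakVelocityGradient g₁ G₁ → HasWeakVelocityGradient g₂ G₂ →
    HasWeakVelocityGradient g₃ G₃ → (∀ᵐ x : T3, GammaDefined fun v => G₁ (x, v)) →
    (∀ᵐ x : T3, ∀ᵐ v, majorantInt (fun v => g₁ (x, v)) v < ⊤) →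
    ∀ B : ℝ≥0∞, B < ⊤ → ∫⁻ z, pairBoundXV ϑ g₁ g₂ G₂ g₃ G₃ z ≤ B →
    PairingBoundXV ϑ g₁ G₁ g₂ G₂ g₃ G₃ (C * B) := by
  obtain ⟨C, hC⟩ := exists_enorm_weakIntegrand_le ϑ
  refine ⟨C, fun g₁ g₂ g₃ G₁ G₂ G₃ h1 h2 h3 hG hfin B hB hb => ?_⟩
  have hm := aestronglyMeasurable_weakIntegrandXV ϑ h1.1 h1.2.1 h2.1 h2.2.1 h3.1 h3.2.1
  have hpm := aemeasurable_pairBound_slice ϑ h1.1 h2.1 h2.2.1 h3.1 h3.2.1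
  have hpi := hpm.lintegral_prod_right'
  rw [Measure.volume_eq_prod, lintegral_prod _ hpm] at hb
  simp only [pairBoundXV_mk] at hb hpi
  -- The variable `x` is only a parameter: the velocity bound applies on almost every slice with a
  -- constant independent of `x`.
  have hle : ∫⁻ z, ‖weakIntegrandXV ϑ g₁ G₁ g₂ G₂ g₃ G₃ z‖ₑ ≤ C * B := by
    rw [Measure.volume_eq_prod, lintegral_prod _ hm.enorm]
    simp only [weakIntegrandXV_mk]
    refine le_trans ?_ (mul_le_mul_right hb _)
    rw [← lintegral_const_mul' _ _ ENNReal.coe_ne_top]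
    refine lintegral_mono_ae ?_
    filter_upwards [h1.2.2, hG, hfin] with x hx1 hxG hxf
    rw [← lintegral_const_mul' _ _ ENNReal.coe_ne_top]
    exact lintegral_mono_ae (hC _ _ _ _ _ _ hx1 hxG hxf)
  have hint : Integrable (weakIntegrandXV ϑ g₁ G₁ g₂ G₂ g₃ G₃) :=
    ⟨hm, hle.trans_lt (ENNReal.mul_lt_top ENNReal.coe_lt_top hB)⟩
  have hbound := (enorm_integral_le_lintegral_enorm _).trans hle
  refine ⟨hint, hbound, fun c1 c2 hci => ?_⟩
  have hfin' := ae_lt_top' hpi (hb.trans_lt hB).ne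
  rw [Measure.volume_eq_prod] at hci hint hbound ⊢
  rw [integral_prod _ hint] at hbound
  rw [integral_prod _ hci]
  have hci' := hci.prod_right_ae
  simp only [weakIntegrandXV_mk] at hbound
  simp only [classicalIntegrandXV_mk] at hci' ⊢
  refine le_trans (le_of_eq ?_) hbound
  congr 1
  refine integral_congr_ae ?_
  filter_upwards [h1.2.2, h2.2.2, h3.2.2, hG, hfin, c1, c2, hci', hfin'] with
    x hx1 hx2 hx3 hxG hxf hxc1 hxc2 hxi hxb
  exact integral_classicalIntegrand ϑ hxc1 hxc2 hx1 hx2 hx3 hxG hxf hxb hxi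

end Pairing

/-! ### Cauchy–Schwarz in the weighted norms. -/

section CauchySchwarz

variable {α : Type*} [MeasurableSpace α] {m : Measure α}

lemma lintegral_mul_le_sqrt {f g : α → ℝ≥0∞} (hf : AEMeasurable f m) (hg : AEMeasurable g m) :
    ∫⁻ a, f a * g a ∂m ≤
      (∫⁻ a, f a ^ 2 ∂m) ^ (1 / 2 : ℝ) * (∫⁻ a, g a ^ 2 ∂m) ^ (1 / 2 : ℝ) := by
  simpa only [ENNReal.rpow_two, Pi.mul_apply] using
    ENNReal.lintegral_mul_le_Lp_mul_Lq m Real.HolderConjugate.two_two hf hg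

lemma ofReal_sqrt_sq {x : ℝ} (hx : 0 ≤ x) : ENNReal.ofReal √x ^ 2 = ENNReal.ofReal x := by
  rw [← ENNReal.ofReal_pow (Real.sqrt_nonneg _), Real.sq_sqrt hx]

lemma ofReal_mul_sqrt_mul_sqrt {w a b : ℝ} (hw : 0 ≤ w) : ENNReal.ofReal (w * (√a * √b)) =
    ENNReal.ofReal √(w * a) * ENNReal.ofReal √(w * b) := by
  rw [← ENNReal.ofReal_mul (Real.sqrt_nonneg _), Real.sqrt_mul hw, Real.sqrt_mul hw]
  congr 1
  linear_combination -(√a * √b) * Real.mul_self_sqrt hw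

lemma lintegral_weight_mul_sqrt_le {w a b : α → ℝ} (hw : AEMeasurable w m) (ha : AEMeasurable a m)
    (hb : AEMeasurable b m) (hw0 : ∀ x, 0 ≤ w x) (ha0 : ∀ x, 0 ≤ a x) (hb0 : ∀ x, 0 ≤ b x) :
    ∫⁻ x, ENNReal.ofReal (w x * (√(a x) * √(b x))) ∂m ≤
      (∫⁻ x, ENNReal.ofReal (w x * a x) ∂m) ^ (1 / 2 : ℝ) *
        (∫⁻ x, ENNReal.ofReal (w x * b x) ∂m) ^ (1 / 2 : ℝ) := by
  have h := lintegral_mul_le_sqrt (hw.mul ha).sqrt.ennreal_ofReal (hw.mul hb).sqrt.ennreal_ofReal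
  simp only [Pi.mul_apply, ofReal_sqrt_sq (mul_nonneg (hw0 _) (ha0 _)),
    ofReal_sqrt_sq (mul_nonneg (hw0 _) (hb0 _))] at h
  simpa only [ofReal_mul_sqrt_mul_sqrt (hw0 _)] using h

lemma sqrt_le_of_le_mul_sq {a b : ℝ≥0∞} {C : ℝ≥0} (h : a ≤ C * b ^ 2) :
    a ^ (1 / 2 : ℝ) ≤ (C ^ (1 / 2 : ℝ) : ℝ≥0) * b := by
  refine (ENNReal.rpow_le_rpow h (by norm_num)).trans_eq ?_
  rw [ENNReal.mul_rpow_of_nonneg _ _ (by norm_num), ENNReal.coe_rpow_of_nonneg _ (by norm_num),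
    ← ENNReal.rpow_two, ← ENNReal.rpow_mul]
  norm_num

end CauchySchwarz

lemma aemeasurable_sigmaDensity {g : T3 × V → ℝ} {G : T3 × V → V}
    (h : AEStronglyMeasurable g) (H : AEStronglyMeasurable G) :
    AEMeasurable fun z : T3 × V => sigmaDensity z.2 (g z) (G z) := by
  have hs (i j) : AEMeasurable fun z : T3 × V => sigmaConv i j mu z.2 :=
    ((aestronglyMeasurable_sigmaConv i j (u := mu) (by
      have : Continuous mu := by unfold mu; fun_prop
      exact this.aestronglyMeasurable)).comp_quasiMeasurePreserving
      Measure.quasiMeasurePreserving_snd).aemeasurable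
  have hv (i : Fin 3) : AEMeasurable fun z : T3 × V => z.2 i := by fun_prop
  have hG (i) := (aestronglyMeasurable_coord H i).aemeasurable
  unfold sigmaDensity
  refine Finset.aemeasurable_fun_sum _ fun i _ => Finset.aemeasurable_fun_sum _ fun j _ => ?_
  exact (((hs i j).mul (hG i)).mul (hG j)).add
    ((((hs i j).mul (hv i)).mul (hv j)).mul (h.aemeasurable.pow_const 2))

/-- The square of the model norm of a function of `(x, v)`. -/
def modelNormSqXV (ϑ : ℝ) (g : T3 × V → ℝ) (G : T3 × V → V) : ℝ≥0∞ :=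
  ∫⁻ z : T3 × V, ENNReal.ofReal (weight (2 * ϑ) z.2 * modelDensity z.2 (g z) (G z))

lemma exists_modelNormSqXV_le (ϑ : ℝ) : ∃ C : ℝ≥0, ∀ (g : T3 × V → ℝ) (G : T3 × V → V),
    HasWeakVelocityGradient g G → modelNormSqXV ϑ g G ≤ C * sigmaNormXV ϑ g G ^ 2 := by
  obtain ⟨C, hC⟩ := exists_modelNormSq_le ϑ
  refine ⟨C, fun g G h => ?_⟩
  have h1 := ((aemeasurable_weight_snd (2 * ϑ)).mul
    (aemeasurable_modelDensity_slice h.1 h.2.1)).ennreal_ofReal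
  have h2 := ((aemeasurable_weight_snd (2 * ϑ)).mul
    (aemeasurable_sigmaDensity h.1 h.2.1)).ennreal_ofReal
  have e : sigmaNormXV ϑ g G ^ 2 =
      ∫⁻ z : T3 × V, ENNReal.ofReal (weight (2 * ϑ) z.2 * sigmaDensity z.2 (g z) (G z)) := by
    rw [sigmaNormXV, ← ENNReal.rpow_two, ← ENNReal.rpow_mul]; norm_num
  rw [e, modelNormSqXV, Measure.volume_eq_prod]
  refine (lintegral_prod _ h1).trans_le (le_trans ?_
    (mul_le_mul_right (lintegral_prod _ h2).ge _))
  rw [← lintegral_const_mul' _ _ ENNReal.coe_ne_top]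
  refine lintegral_mono_ae ?_
  filter_upwards [h.2.2] with x hx
  have := hC _ _ hx
  rwa [sigmaNorm_sq] at this

/-! ### The estimate with the sup norm of `g₁`. -/

lemma exists_pairingBound_sup (ϑ : ℝ) : ∃ C : ℝ≥0, ∀ (g₁ g₂ g₃ : V → ℝ) (G₁ G₂ G₃ : V → V),
    HasWeakGradient g₁ G₁ → HasWeakGradient g₂ G₂ → HasWeakGradient g₃ G₃ → GammaDefined G₁ →
    eLpNorm g₁ ⊤ volume < ⊤ → sigmaNorm ϑ g₂ G₂ < ⊤ → sigmaNorm ϑ g₃ G₃ < ⊤ →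
    PairingBound ϑ g₁ G₁ g₂ G₂ g₃ G₃
      (C * eLpNorm g₁ ⊤ volume * sigmaNorm ϑ g₂ G₂ * sigmaNorm ϑ g₃ G₃) := by
  obtain ⟨A, hA⟩ := exists_majorantInt_le
  obtain ⟨P, hP⟩ := exists_pairingBound ϑ
  obtain ⟨D, hD⟩ := exists_modelNormSq_le ϑ
  set D' : ℝ≥0 := D ^ (1 / 2 : ℝ)
  refine ⟨P * (A * (D' * D')), fun g₁ g₂ g₃ G₁ G₂ G₃ h1 h2 h3 hG f1 f2 f3 => ?_⟩
  have p {g : V → ℝ} {G : V → V} (h : HasWeakGradient g G) :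
      AEMeasurable fun v => modelDensity v (g v) (G v) :=
    aemeasurable_modelDensity (aemeasurable_id.prodMk
      (h.1.aestronglyMeasurable.aemeasurable.prodMk h.2.1.aestronglyMeasurable.aemeasurable))
  -- Once `majorantInt g₁` is bounded by a constant, the weight is shared equally between the two
  -- densities.
  have hcs := lintegral_weight_mul_sqrt_le (continuous_weight (2 * ϑ)).aemeasurable (p h2) (p h3)
    (fun v => (weight_pos _ v).le) (fun v => modelDensity_nonneg _ _ _)
    (fun v => modelDensity_nonneg _ _ _)
  have hle : ∫⁻ v, pairBound ϑ g₁ g₂ G₂ g₃ G₃ v ≤ (A * eLpNorm g₁ ⊤ volume) *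
      ((D' * sigmaNorm ϑ g₂ G₂) * (D' * sigmaNorm ϑ g₃ G₃)) := by
    calc ∫⁻ v, pairBound ϑ g₁ g₂ G₂ g₃ G₃ v
        ≤ ∫⁻ v, (A * eLpNorm g₁ ⊤ volume) * ENNReal.ofReal (weight (2 * ϑ) v *
          (√(modelDensity v (g₂ v) (G₂ v)) * √(modelDensity v (g₃ v) (G₃ v)))) :=
          lintegral_mono fun v => mul_le_mul_left (hA g₁ v) _
      _ = _ := lintegral_const_mul' _ _ (ENNReal.mul_ne_top ENNReal.coe_ne_top f1.ne)
      _ ≤ _ := by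
          gcongr
          refine hcs.trans (mul_le_mul' ?_ ?_)
          exacts [sqrt_le_of_le_mul_sq (hD g₂ G₂ h2), sqrt_le_of_le_mul_sq (hD g₃ G₃ h3)]
  have hfin : ∀ᵐ v, majorantInt g₁ v < ⊤ :=
    ae_of_all _ fun v => (hA g₁ v).trans_lt (ENNReal.mul_lt_top ENNReal.coe_lt_top f1)
  refine (hP g₁ g₂ g₃ G₁ G₂ G₃ h1 h2 h3 hG hfin (hle.trans_lt ?_)).mono ?_
  · exact ENNReal.mul_lt_top (ENNReal.mul_lt_top ENNReal.coe_lt_top f1) (ENNReal.mul_lt_top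
      (ENNReal.mul_lt_top ENNReal.coe_lt_top f2) (ENNReal.mul_lt_top ENNReal.coe_lt_top f3))
  · refine (mul_le_mul_right hle _).trans_eq ?_
    push_cast
    ring

lemma eLpNorm_slice_le {g : T3 × V → ℝ} :
    ∀ᵐ x : T3, eLpNorm (fun v => g (x, v)) ⊤ volume ≤ eLpNorm g ⊤ volume := by
  have h : ∀ᵐ z : T3 × V, ‖g z‖ₑ ≤ eLpNorm g ⊤ volume := by
    rw [eLpNorm_exponent_top]; exact ae_le_eLpNormEssSup
  filter_upwards [Measure.ae_ae_of_ae_prod h] with x hx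
  rw [eLpNorm_exponent_top (f := fun v => g (x, v))]
  exact essSup_le_of_ae_le _ hx

lemma exists_pairingBoundXV_sup (ϑ : ℝ) : ∃ C : ℝ≥0,
    ∀ (g₁ g₂ g₃ : T3 × V → ℝ) (G₁ G₂ G₃ : T3 × V → V),
    HasWeakVelocityGradient g₁ G₁ → HasWeakVelocityGradient g₂ G₂ →
    HasWeakVelocityGradient g₃ G₃ → (∀ᵐ x : T3, GammaDefined fun v => G₁ (x, v)) →
    eLpNorm g₁ ⊤ volume < ⊤ → sigmaNormXV ϑ g₂ G₂ < ⊤ → sigmaNormXV ϑ g₃ G₃ < ⊤ →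
    PairingBoundXV ϑ g₁ G₁ g₂ G₂ g₃ G₃
      (C * eLpNorm g₁ ⊤ volume * sigmaNormXV ϑ g₂ G₂ * sigmaNormXV ϑ g₃ G₃) := by
  obtain ⟨A, hA⟩ := exists_majorantInt_le
  obtain ⟨P, hP⟩ := exists_pairingBoundXV ϑ
  obtain ⟨D, hD⟩ := exists_modelNormSqXV_le ϑ
  set D' : ℝ≥0 := D ^ (1 / 2 : ℝ)
  refine ⟨P * (A * (D' * D')), fun g₁ g₂ g₃ G₁ G₂ G₃ h1 h2 h3 hG f1 f2 f3 => ?_⟩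
  have hcs := lintegral_weight_mul_sqrt_le (aemeasurable_weight_snd (2 * ϑ))
    (aemeasurable_modelDensity_slice h2.1 h2.2.1) (aemeasurable_modelDensity_slice h3.1 h3.2.1)
    (fun z => (weight_pos _ z.2).le) (fun z => modelDensity_nonneg _ _ _)
    (fun z => modelDensity_nonneg _ _ _)
  have hM : ∀ᵐ x : T3, ∀ v, majorantInt (fun v => g₁ (x, v)) v ≤ A * eLpNorm g₁ ⊤ volume := by
    filter_upwards [eLpNorm_slice_le (g := g₁)] with x hx v
    exact (hA _ v).trans (mul_le_mul_right hx _)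
  have hM' : ∀ᵐ z : T3 × V, majorantInt (fun v => g₁ (z.1, v)) z.2 ≤ A * eLpNorm g₁ ⊤ volume := by
    filter_upwards [Measure.quasiMeasurePreserving_fst.ae hM] with z hz using hz z.2
  have hle : ∫⁻ z, pairBoundXV ϑ g₁ g₂ G₂ g₃ G₃ z ≤ (A * eLpNorm g₁ ⊤ volume) *
      ((D' * sigmaNormXV ϑ g₂ G₂) * (D' * sigmaNormXV ϑ g₃ G₃)) := by
    calc ∫⁻ z, pairBoundXV ϑ g₁ g₂ G₂ g₃ G₃ z
        ≤ ∫⁻ z : T3 × V, (A * eLpNorm g₁ ⊤ volume) * ENNReal.ofReal (weight (2 * ϑ) z.2 *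
          (√(modelDensity z.2 (g₂ z) (G₂ z)) * √(modelDensity z.2 (g₃ z) (G₃ z)))) := by
          refine lintegral_mono_ae ?_
          filter_upwards [hM'] with z hz using mul_le_mul_left hz _
      _ = _ := lintegral_const_mul' _ _ (ENNReal.mul_ne_top ENNReal.coe_ne_top f1.ne)
      _ ≤ _ := by
          gcongr
          refine hcs.trans (mul_le_mul' ?_ ?_)
          exacts [sqrt_le_of_le_mul_sq (hD g₂ G₂ h2), sqrt_le_of_le_mul_sq (hD g₃ G₃ h3)]
  refine (hP g₁ g₂ g₃ G₁ G₂ G₃ h1 h2 h3 hG ?_ _ ?_ hle).mono ?_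
  · filter_upwards [hM] with x hx
    exact ae_of_all _ fun v => (hx v).trans_lt (ENNReal.mul_lt_top ENNReal.coe_lt_top f1)
  · exact ENNReal.mul_lt_top (ENNReal.mul_lt_top ENNReal.coe_lt_top f1) (ENNReal.mul_lt_top
      (ENNReal.mul_lt_top ENNReal.coe_lt_top f2) (ENNReal.mul_lt_top ENNReal.coe_lt_top f3))
  · refine le_of_eq ?_
    push_cast
    ring

/-! ### The estimate with the `L²` or σ-norm of `g₁`. -/

/-- The zero-order part of the model density loses one power of the weight. The exponent `2ϑ - 1` is
weak enough to be controlled by the σ-norm as well as by the `L²` norm, which is how the minimum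
arises. -/
lemma ofReal_weight_mul_enorm_sq_le (ϑ : ℝ) (v : V) (a : ℝ) (b : V) :
    ENNReal.ofReal (weight (2 * ϑ - 1) v) * ‖a‖ₑ ^ 2 ≤
      ENNReal.ofReal (weight (2 * ϑ) v * modelDensity v a b) := by
  rw [enorm_sq_eq_ofReal, ← ENNReal.ofReal_mul (weight_pos _ v).le]
  apply ENNReal.ofReal_le_ofReal
  rw [Real.norm_eq_abs, sq_abs, sub_eq_add_neg, weight_add, mul_assoc]
  have hw := (weight_pos (2 * ϑ) v).le
  gcongr
  have h := modelForm_nonneg v b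
  have : weight (-1) v = (1 + ‖v‖)⁻¹ := Real.rpow_neg_one _
  rw [this, modelDensity]
  linarith

lemma lintegral_weight_mul_sq_le_modelNormSqXV (ϑ : ℝ) (g : T3 × V → ℝ) (G : T3 × V → V) :
    ∫⁻ z : T3 × V, ENNReal.ofReal (weight (2 * ϑ - 1) z.2) * ‖g z‖ₑ ^ 2 ≤ modelNormSqXV ϑ g G := by
  rw [modelNormSqXV]
  apply lintegral_mono
  intro z
  exact ofReal_weight_mul_enorm_sq_le ϑ z.2 (g z) (G z)

lemma lintegral_weight_mul_sq_le_l2NormXV (ϑ : ℝ) (g : T3 × V → ℝ) :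
    ∫⁻ z : T3 × V, ENNReal.ofReal (weight (2 * ϑ - 1) z.2) * ‖g z‖ₑ ^ 2 ≤ l2NormXV ϑ g ^ 2 := by
  have e : l2NormXV ϑ g ^ 2 = ∫⁻ z : T3 × V, ‖weight ϑ z.2 * g z‖ₑ ^ 2 := by
    rw [l2NormXV, eLpNorm_eq_lintegral_rpow_enorm_toReal two_ne_zero ENNReal.ofNat_ne_top,
      ← ENNReal.rpow_two, ← ENNReal.rpow_mul]
    norm_num
  rw [e]
  refine lintegral_mono fun z => ?_
  have hw := (weight_pos ϑ z.2).le
  rw [enorm_mul, mul_pow, enorm_sq_eq_ofReal (weight ϑ z.2), Real.norm_of_nonneg hw]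
  gcongr
  rw [sq, ← weight_add, ← two_mul]
  exact Real.rpow_le_rpow_of_exponent_le (by linarith [norm_nonneg z.2]) (by linarith)

lemma exists_lintegral_majorantInt_slice_sq_le (s : ℝ) : ∃ C : ℝ≥0, ∀ g : T3 × V → ℝ,
    AEStronglyMeasurable g →
    ∫⁻ z : T3 × V, ENNReal.ofReal (((1 + ‖z.2‖) ^ 4)⁻¹) *
        majorantInt (fun v => g (z.1, v)) z.2 ^ 2 ≤
      C * ∫⁻ z : T3 × V, ENNReal.ofReal (weight s z.2) * ‖g z‖ₑ ^ 2 := by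
  obtain ⟨C, hC⟩ := exists_lintegral_majorantInt_sq_le s
  refine ⟨C, fun g hg => ?_⟩
  have h0 : Measurable fun z : T3 × V => ENNReal.ofReal (((1 + ‖z.2‖) ^ 4)⁻¹) := by fun_prop
  have h1 := h0.aemeasurable (μ := volume).mul ((aemeasurable_majorantInt_slice hg).pow_const 2)
  have h2 := (aemeasurable_weight_snd s).ennreal_ofReal.mul (hg.enorm.pow_const 2)
  rw [Measure.volume_eq_prod]
  refine (lintegral_prod _ h1).trans_le (le_trans ?_
    (mul_le_mul_right (lintegral_prod _ h2).ge _))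
  rw [← lintegral_const_mul' _ _ ENNReal.coe_ne_top]
  refine lintegral_mono_ae ?_
  filter_upwards [hg.prodMk_left] with x hx using hC _ hx

lemma ofReal_sqrt_modelDensity_le (v : V) (a : ℝ) (b : V) :
    ENNReal.ofReal √(modelDensity v a b) ≤ ‖a‖ₑ + ‖b‖ₑ := by
  rw [← ofReal_norm, ← ofReal_norm, ← ENNReal.ofReal_add (norm_nonneg _) (norm_nonneg _)]
  apply ENNReal.ofReal_le_ofReal
  refine Real.sqrt_le_iff.2 ⟨by positivity, (modelDensity_le v a b).trans ?_⟩
  rw [← sq_abs a, ← Real.norm_eq_abs]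
  nlinarith [mul_nonneg (norm_nonneg a) (norm_nonneg b)]

lemma ae_lt_top_of_lintegral_mul_sq {α : Type*} [MeasurableSpace α] {m : Measure α}
    {w f : α → ℝ≥0∞} (hw : AEMeasurable w m) (hf : AEMeasurable f m) (h0 : ∀ a, w a ≠ 0)
    (h : ∫⁻ a, w a * f a ^ 2 ∂m ≠ ⊤) : ∀ᵐ a ∂m, f a < ⊤ := by
  filter_upwards [ae_lt_top' (hw.mul (hf.pow_const 2)) h] with a ha
  by_contra hc
  rw [not_lt, top_le_iff] at hc
  simp [hc, ENNReal.mul_top (h0 a)] at ha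

/-- The density of `g₂` is bounded by sup norms and leaves the integral. Then `w^{2ϑ}` is split
evenly between `majorantInt g₁` and the density of `g₃`; the Gaussian inside `majorantInt` allows
the weight `2ϑ - 1` on `g₁`. -/
lemma exists_pairingBoundXV_l2 {ϑ : ℝ} (hϑ : ϑ ≤ -2) : ∃ C : ℝ≥0,
    ∀ (g₁ g₂ g₃ : T3 × V → ℝ) (G₁ G₂ G₃ : T3 × V → V),
    HasWeakVelocityGradient g₁ G₁ → HasWeakVelocityGradient g₂ G₂ →
    HasWeakVelocityGradient g₃ G₃ → (∀ᵐ x : T3, GammaDefined fun v => G₁ (x, v)) →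
    min (l2NormXV ϑ g₁) (sigmaNormXV ϑ g₁ G₁) < ⊤ →
    eLpNorm g₂ ⊤ volume < ⊤ → eLpNorm G₂ ⊤ volume < ⊤ → sigmaNormXV ϑ g₃ G₃ < ⊤ →
    PairingBoundXV ϑ g₁ G₁ g₂ G₂ g₃ G₃
      (C * min (l2NormXV ϑ g₁) (sigmaNormXV ϑ g₁ G₁) *
        (eLpNorm g₂ ⊤ volume + eLpNorm G₂ ⊤ volume) * sigmaNormXV ϑ g₃ G₃) := by
  obtain ⟨A, hA⟩ := exists_lintegral_majorantInt_slice_sq_le (2 * ϑ - 1)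
  obtain ⟨P, hP⟩ := exists_pairingBoundXV ϑ
  obtain ⟨D, hD⟩ := exists_modelNormSqXV_le ϑ
  set D' : ℝ≥0 := D ^ (1 / 2 : ℝ)
  set E : ℝ≥0 := (A * (1 + D)) ^ (1 / 2 : ℝ)
  refine ⟨P * (E * D'), fun g₁ g₂ g₃ G₁ G₂ G₃ h1 h2 h3 hG f1 f2 F2 f3 => ?_⟩
  set R := min (l2NormXV ϑ g₁) (sigmaNormXV ϑ g₁ G₁)
  set N := eLpNorm g₂ ⊤ volume + eLpNorm G₂ ⊤ volume
  have hN : N < ⊤ := ENNReal.add_lt_top.2 ⟨f2, F2⟩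
  have hR : ∫⁻ z : T3 × V, ENNReal.ofReal (weight (2 * ϑ - 1) z.2) * ‖g₁ z‖ₑ ^ 2 ≤
      ((1 + D : ℝ≥0) : ℝ≥0∞) * R ^ 2 := by
    rcases min_choice (l2NormXV ϑ g₁) (sigmaNormXV ϑ g₁ G₁) with h | h
    · simp only [R, h]
      refine (lintegral_weight_mul_sq_le_l2NormXV ϑ g₁).trans (le_mul_of_one_le_left' ?_)
      push_cast; exact le_self_add
    · simp only [R, h]
      refine (lintegral_weight_mul_sq_le_modelNormSqXV ϑ g₁ G₁).trans
        ((hD g₁ G₁ h1).trans (mul_le_mul_left ?_ _))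
      push_cast; exact le_add_self
  have hΛ : ∫⁻ z : T3 × V, ENNReal.ofReal (((1 + ‖z.2‖) ^ 4)⁻¹) *
      majorantInt (fun v => g₁ (z.1, v)) z.2 ^ 2 ≤ ((A * (1 + D) : ℝ≥0) : ℝ≥0∞) * R ^ 2 := by
    refine (hA g₁ h1.1).trans ((mul_le_mul_right hR _).trans_eq ?_)
    rw [ENNReal.coe_mul, mul_assoc]
  have mΛ := aemeasurable_majorantInt_slice h1.1
  have m4 : Measurable fun z : T3 × V => ENNReal.ofReal (((1 + ‖z.2‖) ^ 4)⁻¹) := by fun_prop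
  have hfin : ∀ᵐ z : T3 × V, majorantInt (fun v => g₁ (z.1, v)) z.2 < ⊤ := by
    refine ae_lt_top_of_lintegral_mul_sq m4.aemeasurable mΛ (fun z => ?_) (hΛ.trans_lt
      (ENNReal.mul_lt_top ENNReal.coe_lt_top (ENNReal.pow_lt_top f1))).ne
    rw [Ne, ENNReal.ofReal_eq_zero, not_le]
    positivity
  have hd2 : ∀ᵐ z : T3 × V, ENNReal.ofReal √(modelDensity z.2 (g₂ z) (G₂ z)) ≤ N := by
    have e1 : ∀ᵐ z : T3 × V, ‖g₂ z‖ₑ ≤ eLpNorm g₂ ⊤ volume := by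
      rw [eLpNorm_exponent_top]; exact ae_le_eLpNormEssSup
    have e2 : ∀ᵐ z : T3 × V, ‖G₂ z‖ₑ ≤ eLpNorm G₂ ⊤ volume := by
      rw [eLpNorm_exponent_top]; exact ae_le_eLpNormEssSup
    filter_upwards [e1, e2] with z z1 z2
    exact (ofReal_sqrt_modelDensity_le _ _ _).trans (add_le_add z1 z2)
  set w : T3 × V → ℝ := fun z => weight (2 * ϑ) z.2
  have hw0 (z) : 0 ≤ w z := (weight_pos _ _).le
  -- This is where `ϑ ≤ -2` enters: `w^{2ϑ}` must supply the decay `(1+|v|)⁻⁴` under which the `L²`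
  -- bound of the convolution holds.
  have hw4 (z : T3 × V) : w z ≤ ((1 + ‖z.2‖) ^ 4)⁻¹ := by
    have : ((1 + ‖z.2‖) ^ 4)⁻¹ = (1 + ‖z.2‖) ^ (-4 : ℝ) := by
      rw [Real.rpow_neg (by positivity)]; norm_cast
    rw [this]
    exact Real.rpow_le_rpow_of_exponent_le (by linarith [norm_nonneg z.2]) (by linarith)
  have mw : AEMeasurable w := aemeasurable_weight_snd _
  have m3 := aemeasurable_modelDensity_slice h3.1 h3.2.1
  have hcs := lintegral_mul_le_sqrt (mΛ.mul mw.sqrt.ennreal_ofReal) (mw.mul m3).sqrt.ennreal_ofReal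
  simp only [Pi.mul_apply, mul_pow, ofReal_sqrt_sq (hw0 _),
    ofReal_sqrt_sq (mul_nonneg (hw0 _) (modelDensity_nonneg _ _ _))] at hcs
  have hL : ∫⁻ z : T3 × V, majorantInt (fun v => g₁ (z.1, v)) z.2 ^ 2 * ENNReal.ofReal (w z) ≤
      ((A * (1 + D) : ℝ≥0) : ℝ≥0∞) * R ^ 2 := by
    refine le_trans (lintegral_mono fun z => ?_) hΛ
    rw [mul_comm]
    gcongr
    exact hw4 z
  have hle : ∫⁻ z, pairBoundXV ϑ g₁ g₂ G₂ g₃ G₃ z ≤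
      N * ((E * R) * (D' * sigmaNormXV ϑ g₃ G₃)) := by
    calc ∫⁻ z, pairBoundXV ϑ g₁ g₂ G₂ g₃ G₃ z
        ≤ ∫⁻ z : T3 × V, N * (majorantInt (fun v => g₁ (z.1, v)) z.2 * ENNReal.ofReal √(w z) *
          ENNReal.ofReal √(w z * modelDensity z.2 (g₃ z) (G₃ z))) := by
          refine lintegral_mono_ae ?_
          filter_upwards [hd2] with z hz
          have e : ENNReal.ofReal (w z * (√(modelDensity z.2 (g₂ z) (G₂ z)) *
              √(modelDensity z.2 (g₃ z) (G₃ z)))) =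
              ENNReal.ofReal √(modelDensity z.2 (g₂ z) (G₂ z)) * (ENNReal.ofReal √(w z) *
              ENNReal.ofReal √(w z * modelDensity z.2 (g₃ z) (G₃ z))) := by
            rw [← ENNReal.ofReal_mul (Real.sqrt_nonneg _), ← ENNReal.ofReal_mul (Real.sqrt_nonneg _),
              Real.sqrt_mul (hw0 z)]
            congr 1
            linear_combination -(√(modelDensity z.2 (g₂ z) (G₂ z)) *
              √(modelDensity z.2 (g₃ z) (G₃ z))) * Real.mul_self_sqrt (hw0 z)
          change majorantInt _ _ * ENNReal.ofReal (w z * _) ≤ _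
          rw [e]
          calc _ ≤ majorantInt (fun v => g₁ (z.1, v)) z.2 * (N * (ENNReal.ofReal √(w z) *
              ENNReal.ofReal √(w z * modelDensity z.2 (g₃ z) (G₃ z)))) := by gcongr
            _ = _ := by ring
      _ = _ := lintegral_const_mul' _ _ hN.ne
      _ ≤ _ := by
          gcongr
          exact hcs.trans (mul_le_mul' (sqrt_le_of_le_mul_sq hL)
            (sqrt_le_of_le_mul_sq (hD g₃ G₃ h3)))
  refine (hP g₁ g₂ g₃ G₁ G₂ G₃ h1 h2 h3 hG (Measure.ae_ae_of_ae_prod hfin) _ ?_ hle).mono ?_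
  · exact ENNReal.mul_lt_top hN (ENNReal.mul_lt_top (ENNReal.mul_lt_top ENNReal.coe_lt_top f1)
      (ENNReal.mul_lt_top ENNReal.coe_lt_top f3))
  · refine le_of_eq ?_
    push_cast
    ring

end Landau

end

theorem mainTheorem6 :
    (∀ ϑ : ℝ, ∃ C : ℝ≥0,
      (∀ (g₁ g₂ g₃ : Landau.V → ℝ) (G₁ G₂ G₃ : Landau.V → Landau.V),
        Landau.HasWeakGradient g₁ G₁ → Landau.HasWeakGradient g₂ G₂ →
        Landau.HasWeakGradient g₃ G₃ → Landau.GammaDefined G₁ →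
        eLpNorm g₁ ⊤ volume < ⊤ → Landau.sigmaNorm ϑ g₂ G₂ < ⊤ → Landau.sigmaNorm ϑ g₃ G₃ < ⊤ →
        Landau.PairingBound ϑ g₁ G₁ g₂ G₂ g₃ G₃
          (C * eLpNorm g₁ ⊤ volume * Landau.sigmaNorm ϑ g₂ G₂ * Landau.sigmaNorm ϑ g₃ G₃)) ∧
      (∀ (g₁ g₂ g₃ : Landau.T3 × Landau.V → ℝ) (G₁ G₂ G₃ : Landau.T3 × Landau.V → Landau.V),
        Landau.HasWeakVelocityGradient g₁ G₁ → Landau.HasWeakVelocityGradient g₂ G₂ →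
        Landau.HasWeakVelocityGradient g₃ G₃ →
        (∀ᵐ x : Landau.T3, Landau.GammaDefined (fun v => G₁ (x, v))) →
        eLpNorm g₁ ⊤ volume < ⊤ → Landau.sigmaNormXV ϑ g₂ G₂ < ⊤ →
        Landau.sigmaNormXV ϑ g₃ G₃ < ⊤ →
        Landau.PairingBoundXV ϑ g₁ G₁ g₂ G₂ g₃ G₃
          (C * eLpNorm g₁ ⊤ volume * Landau.sigmaNormXV ϑ g₂ G₂ *
            Landau.sigmaNormXV ϑ g₃ G₃))) ∧
    (∃ ϑbar : ℝ, ϑbar < 0 ∧ ∀ ϑ : ℝ, ϑ ≤ ϑbar → ∃ C : ℝ≥0,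
      ∀ (g₁ g₂ g₃ : Landau.T3 × Landau.V → ℝ) (G₁ G₂ G₃ : Landau.T3 × Landau.V → Landau.V),
        Landau.HasWeakVelocityGradient g₁ G₁ → Landau.HasWeakVelocityGradient g₂ G₂ →
        Landau.HasWeakVelocityGradient g₃ G₃ →
        (∀ᵐ x : Landau.T3, Landau.GammaDefined (fun v => G₁ (x, v))) →
        min (Landau.l2NormXV ϑ g₁) (Landau.sigmaNormXV ϑ g₁ G₁) < ⊤ →
        eLpNorm g₂ ⊤ volume < ⊤ → eLpNorm G₂ ⊤ volume < ⊤ →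
        Landau.sigmaNormXV ϑ g₃ G₃ < ⊤ →
        Landau.PairingBoundXV ϑ g₁ G₁ g₂ G₂ g₃ G₃
          (C * min (Landau.l2NormXV ϑ g₁) (Landau.sigmaNormXV ϑ g₁ G₁) *
            (eLpNorm g₂ ⊤ volume + eLpNorm G₂ ⊤ volume) * Landau.sigmaNormXV ϑ g₃ G₃)) := by
  refine ⟨fun ϑ => ?_, -2, by norm_num, fun ϑ hϑ => Landau.exists_pairingBoundXV_l2 hϑ⟩
  obtain ⟨C, hC⟩ := Landau.exists_pairingBound_sup ϑ
  obtain ⟨C', hC'⟩ := Landau.exists_pairingBoundXV_sup ϑ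
  -- A single constant has to serve both the functions of `v` and those of `(x, v)`.
  refine ⟨max C C', fun g₁ g₂ g₃ G₁ G₂ G₃ h1 h2 h3 hG f1 f2 f3 => ?_,
    fun g₁ g₂ g₃ G₁ G₂ G₃ h1 h2 h3 hG f1 f2 f3 => ?_⟩
  · refine (hC g₁ g₂ g₃ G₁ G₂ G₃ h1 h2 h3 hG f1 f2 f3).mono ?_
    gcongr
    exact le_max_left _ _
  · refine (hC' g₁ g₂ g₃ G₁ G₂ G₃ h1 h2 h3 hG f1 f2 f3).mono ?_
    gcongr
    exact le_max_right _ _
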